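/- Let $X$ be a compact complex manifold of dimension $n$ with a Kähler form $\omega$, let $\alpha$ be a smooth closed real $(1,1)$-form on $X$, and let $0<\theta_0<\pi$. For a smooth real $(1,1)$-form $\beta$ put $$\theta_\omega(\beta)=\sum_{j=1}^n\operatorname{arccot}\lambda_j,\qquad Q_\omega(\beta)=-\cot\theta_\omega(\beta),$$ where $\lambda_1,\dots,\lambda_n$ are the eigenvalues of $\omega^{-1}\beta$ at the point considered and $\operatorname{arccot}$ takes values in $(0,\pi)$. Let $\alpha_k=\alpha+\sqrt{-1}\partial\bar\partial\psi_k$, with $\psi_k\in C^\infty(X,\mathbb R)$, be a sequence of closed real $(1,1)$-forms such that $0<\theta_\omega(\alpha_k)<\pi$ on $X$ for every $k$, and suppose that $$\psi_k\to\psi_\infty\ \text{ in } L^1(X,\omega^n)\qquad\text{and}\qquad \|Q_\omega(\alpha_k)+\cot\theta_0\|_{L^2(X,\omega^n)}\to 0 .$$ Then the current $\alpha_\infty=\alpha+\sqrt{-1}\partial\bar\partial\psi_\infty$ is a viscosity subsolution, $$Q_\omega(\alpha_\infty)\le_v-\cot\theta_0 ,$$ which means the following. The current $\alpha_\infty+C\omega$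 is positive for some real constant $C$. Moreover, for every $x\in X$, every holomorphic coordinate neighbourhood of $x$, every upper semicontinuous (quasi-plurisubharmonic) local potential $\varphi$ of $\alpha_\infty$ near $x$ (that is, $\sqrt{-1}\partial\bar\partial\varphi=\alpha_\infty$ as currents), and every $C^2$ function $q$ defined near $x$ with $q\ge\varphi$ and $q(x)=\varphi(x)$, one has $$\theta_\omega(\sqrt{-1}\partial\bar\partial q)(x)<\pi\qquad\text{and}\qquad Q_\omega(\sqrt{-1}\partial\bar\partial q)(x)\le-\cot\theta_0 .$$ -/

import Mathlib

open scoped Manifold Topology ComplexOrder Matrix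
open MeasureTheory Filter Set

noncomputable section

namespace DHYM

/-! ### Wirtinger calculus on `ℂⁿ` -/

/-- The Wirtinger derivative `∂f/∂z_j = (∂f/∂x_j - i ∂f/∂y_j) / 2`. -/
def dz {n : ℕ} (j : Fin n) (f : (Fin n → ℂ) → ℂ) (z : Fin n → ℂ) : ℂ :=
  (fderiv ℝ f z (Pi.single j 1) - Complex.I * fderiv ℝ f z (Pi.single j Complex.I)) / 2

/-- The Wirtinger derivative `∂f/∂z̄_j = (∂f/∂x_j + i ∂f/∂y_j) / 2`. -/
def dzbar {n : ℕ} (j : Fin n) (f : (Fin n → ℂ) → ℂ) (z : Fin n → ℂ) : ℂ :=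
  (fderiv ℝ f z (Pi.single j 1) + Complex.I * fderiv ℝ f z (Pi.single j Complex.I)) / 2

/-- The complex Hessian `(∂²q/∂z_j∂z̄_k)_{j,k}`, i.e. the coefficient matrix of `√-1 ∂∂̄ q`
in the frame `√-1 dz_j ∧ dz̄_k`. -/
def complexHessian {n : ℕ} (q : (Fin n → ℂ) → ℝ) (z : Fin n → ℂ) : Matrix (Fin n) (Fin n) ℂ :=
  Matrix.of fun j k => dz j (dzbar k fun w => (q w : ℂ)) z

/-! ### Lagrangian phase and the operator `Q` on matrices -/

/-- The inverse cotangent with values in `(0, π)`. -/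
def arccot (x : ℝ) : ℝ := Real.pi / 2 - Real.arctan x

/-- `∑ⱼ arccot λⱼ`, where the `λⱼ` are the eigenvalues of `B⁻¹ A` with algebraic multiplicity
(they are real if `A` is Hermitian and `B` is positive definite Hermitian). -/
def phase {n : ℕ} (B A : Matrix (Fin n) (Fin n) ℂ) : ℝ :=
  ((B⁻¹ * A).charpoly.roots.map fun l => arccot l.re).sum

/-- `Q_B(A) = -cot ∑ⱼ arccot λⱼ`. -/
def Q {n : ℕ} (B A : Matrix (Fin n) (Fin n) ℂ) : ℝ := -Real.cot (phase B A)

/-! ### Closed real `(1,1)`-forms on a complex manifold -/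

/-- The holomorphic coordinate charts of the complex manifold `X`. -/
abbrev holCharts (n : ℕ) (X : Type*) [TopologicalSpace X] [ChartedSpace (Fin n → ℂ) X] :
    Set (OpenPartialHomeomorph X (Fin n → ℂ)) :=
  IsManifold.maximalAtlas 𝓘(ℂ, Fin n → ℂ) (⊤ : ℕ∞) X

/-- The complex Jacobian matrix `(∂τ_a/∂z_b)_{a,b}` of a holomorphic map `τ`. -/
def jacobian {n : ℕ} (τ : (Fin n → ℂ) → Fin n → ℂ) (z : Fin n → ℂ) :
    Matrix (Fin n) (Fin n) ℂ :=
  Matrix.of fun a b => fderiv ℂ τ z (Pi.single b 1) a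

/-- A smooth closed real `(1,1)`-form `√-1 ∑ h_{jk} dz_j ∧ dz̄_k`, given by its coefficient
matrices `h` in all holomorphic coordinate charts. The values of `coeff` for other charts,
or outside the range of the coordinates, carry no information. -/
structure ClosedRealForm11 (n : ℕ) (X : Type*) [TopologicalSpace X]
    [ChartedSpace (Fin n → ℂ) X] where
  coeff : OpenPartialHomeomorph X (Fin n → ℂ) → (Fin n → ℂ) → Matrix (Fin n) (Fin n) ℂ
  /-- The form is real. -/
  hermitian : ∀ e ∈ holCharts n X, ∀ z ∈ e.target, (coeff e z).IsHermitian
  smooth : ∀ e ∈ holCharts n X, ∀ j k, ContDiffOn ℝ (⊤ : ℕ∞) (fun z => coeff e z j k) e.target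
  /-- The coefficients transform as those of a `(1,1)`-form:
  `h_{jk} = ∑ ∂τ_a/∂z_j · h'_{ab} · conj (∂τ_b/∂z_k)` for the change of coordinates `τ`. -/
  transform : ∀ e ∈ holCharts n X, ∀ e' ∈ holCharts n X, ∀ z ∈ (e.symm.trans e').source,
    coeff e z = (jacobian (e.symm.trans e') z)ᵀ * coeff e' (e' (e.symm z)) *
      (jacobian (e.symm.trans e') z).map star
  /-- `∂h_{jk}/∂z_l = ∂h_{lk}/∂z_j`; as the form is real, this says that it is `d`-closed. -/
  closed : ∀ e ∈ holCharts n X, ∀ z ∈ e.target, ∀ j k l,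
    dz l (fun w => coeff e w j k) z = dz j (fun w => coeff e w l k) z

section Manifold

variable {n : ℕ} {X : Type*} [TopologicalSpace X] [ChartedSpace (Fin n → ℂ) X]

/-- A Kähler form is a positive definite closed real `(1,1)`-form. -/
def IsKahler (ω : ClosedRealForm11 n X) : Prop :=
  ∀ e ∈ holCharts n X, ∀ z ∈ e.target, (ω.coeff e z).PosDef

/-- `α' = α + √-1 ∂∂̄ ψ` for a smooth function `ψ`. -/
def IsAddDDbar (α' α : ClosedRealForm11 n X) (ψ : X → ℝ) : Prop :=
  ∀ e ∈ holCharts n X, ∀ z ∈ e.target,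
    α'.coeff e z = α.coeff e z + complexHessian (fun w => ψ (e.symm w)) z

/-- The function `θ_ω(α) = ∑ⱼ arccot λⱼ` on `X`, with `λⱼ` the eigenvalues of `ω⁻¹ α`
(which do not depend on the coordinates used to compute them). -/
def formPhase (ω α : ClosedRealForm11 n X) (x : X) : ℝ :=
  phase (ω.coeff (chartAt (Fin n → ℂ) x) (chartAt (Fin n → ℂ) x x))
    (α.coeff (chartAt (Fin n → ℂ) x) (chartAt (Fin n → ℂ) x x))

/-- The function `Q_ω(α) = -cot ∑ⱼ arccot λⱼ` on `X`. -/
def formQ (ω α : ClosedRealForm11 n X) (x : X) : ℝ :=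
  Q (ω.coeff (chartAt (Fin n → ℂ) x) (chartAt (Fin n → ℂ) x x))
    (α.coeff (chartAt (Fin n → ℂ) x) (chartAt (Fin n → ℂ) x x))

/-- The volume form `ωⁿ/n! = 2ⁿ det(g) dλ` of `ω = √-1 ∑ g_{jk} dz_j ∧ dz̄_k` on the domain of
the chart `e`, as a measure on `X` that vanishes outside this domain. -/
def chartVolume [MeasurableSpace X] (ω : ClosedRealForm11 n X)
    (e : OpenPartialHomeomorph X (Fin n → ℂ)) : Measure X :=
  ((volume.restrict e.target).withDensity
    fun z => ENNReal.ofReal (2 ^ n * (ω.coeff e z).det.re)).map e.symm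

/-- The volume measure `ωⁿ/n!` of `X`. The measures `chartVolume ω e` agree on the overlaps of
the charts, and the least measure above all of them is the measure they glue to. -/
def kahlerVolume [MeasurableSpace X] (ω : ClosedRealForm11 n X) : Measure X :=
  ⨆ e ∈ holCharts n X, chartVolume ω e

end Manifold

/-! ### Plurisubharmonic functions -/

/-- `u` is plurisubharmonic (possibly `≡ -∞`) on the open set `U`: it is upper semicontinuous
with values in `[-∞, ∞)` and satisfies `2π u(z) ≤ ∫₀^{2π} u(z + e^{it} w) dt` for every closed
disc `{z + ζ w : |ζ| ≤ 1}` in `U`. The integral is that of the positive part minus that of the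
negative part. -/
def IsPSH {n : ℕ} (U : Set (Fin n → ℂ)) (u : (Fin n → ℂ) → EReal) : Prop :=
  UpperSemicontinuousOn u U ∧ (∀ z ∈ U, u z ≠ ⊤) ∧
  ∀ z w : Fin n → ℂ, (∀ ζ : ℂ, ‖ζ‖ ≤ 1 → z + ζ • w ∈ U) →
    ((2 * Real.pi : ℝ) : EReal) * u z ≤
      ((∫⁻ t in Ioc (0 : ℝ) (2 * Real.pi),
          (u (z + Complex.exp (t * Complex.I) • w)).toENNReal : ENNReal) : EReal) -
      ((∫⁻ t in Ioc (0 : ℝ) (2 * Real.pi),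
          (-u (z + Complex.exp (t * Complex.I) • w)).toENNReal : ENNReal) : EReal)

/-- `u` is quasi-plurisubharmonic on the open set `U`: near each point, `u + C|z|²` is
plurisubharmonic for some constant `C`. -/
def IsQuasiPSH {n : ℕ} (U : Set (Fin n → ℂ)) (u : (Fin n → ℂ) → EReal) : Prop :=
  ∀ z ∈ U, ∃ r > 0, ∃ C : ℝ, Metric.ball z r ⊆ U ∧
    IsPSH (Metric.ball z r) fun y => u y + ((C * ∑ i, ‖y i‖ ^ 2 : ℝ) : EReal)

/-! ### The current `α + √-1 ∂∂̄ ψ` and viscosity subsolutions -/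

/-- `η` is a real-valued smooth function with compact support in `U`. -/
def IsTestFunction {n : ℕ} (U : Set (Fin n → ℂ)) (η : (Fin n → ℂ) → ℝ) : Prop :=
  ContDiff ℝ (⊤ : ℕ∞) η ∧ HasCompactSupport η ∧ tsupport η ⊆ U

/-- `q` is an upper test of `φ` at `z`: `q` is `C²` near `z`, and `q ≥ φ` near `z` with
equality at `z`. -/
def IsUpperTest {n : ℕ} (φ : (Fin n → ℂ) → EReal) (q : (Fin n → ℂ) → ℝ) (z : Fin n → ℂ) :
    Prop :=
  ContDiffAt ℝ 2 q z ∧ (∀ᶠ y in 𝓝 z, φ y ≤ (q y : EReal)) ∧ φ z = (q z : EReal)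

section Currents

variable {n : ℕ} {X : Type*} [TopologicalSpace X] [ChartedSpace (Fin n → ℂ) X]

/-- The `(j,k)` coefficient of the current `α + √-1 ∂∂̄ ψ` in the chart `e`, a distribution
on `e.target`, evaluated at the test function `η`. -/
def currentCoeff (α : ClosedRealForm11 n X) (ψ : X → ℝ)
    (e : OpenPartialHomeomorph X (Fin n → ℂ)) (j k : Fin n) (η : (Fin n → ℂ) → ℝ) : ℂ :=
  ∫ z in e.target, (α.coeff e z j k * (η z : ℂ) + (ψ (e.symm z) : ℂ) * complexHessian η z j k)

/-- `α + √-1 ∂∂̄ ψ + C ω` is a positive current: in every chart,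
`∑ T_{jk} ξ_j conj ξ_k` is a positive distribution for every `ξ ∈ ℂⁿ`. -/
def IsPositiveAfterAdding (ω α : ClosedRealForm11 n X) (ψ : X → ℝ) (C : ℝ) : Prop :=
  ∀ e ∈ holCharts n X, ∀ η, IsTestFunction e.target η → (∀ z, 0 ≤ η z) → ∀ ξ : Fin n → ℂ,
    0 ≤ (∑ j, ∑ k, (currentCoeff α ψ e j k η +
      C * ∫ z in e.target, ω.coeff e z j k * (η z : ℂ)) * ξ j * star (ξ k)).re

/-- `φ` is an upper semicontinuous local potential of `α + √-1 ∂∂̄ ψ` on the open subset `U` of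
the chart `e`: a quasi-plurisubharmonic function, not identically `-∞` on any component of `U`,
with `√-1 ∂∂̄ φ = α + √-1 ∂∂̄ ψ` on `U` in the sense of currents. -/
structure IsLocalPotential (α : ClosedRealForm11 n X) (ψ : X → ℝ)
    (e : OpenPartialHomeomorph X (Fin n → ℂ)) (U : Set (Fin n → ℂ))
    (φ : (Fin n → ℂ) → EReal) : Prop where
  quasiPSH : IsQuasiPSH U φ
  ae_ne_bot : ∀ᵐ z ∂volume.restrict U, φ z ≠ ⊥
  locallyIntegrable : LocallyIntegrableOn (fun z => (φ z).toReal) U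
  ddbar_eq : ∀ η, IsTestFunction U η → ∀ j k,
    ∫ z in U, ((φ z).toReal : ℂ) * complexHessian η z j k = currentCoeff α ψ e j k η

/-- The current `α + √-1 ∂∂̄ ψ` is a viscosity subsolution, `Q_ω(α + √-1 ∂∂̄ ψ) ≤_v c`.
The operator `Q_ω` is considered, as usual, on the set where the phase is less than `π`
(`-cot` of the phase being `+∞` on its boundary), so that the inequality for a test includes
the membership in this set. -/
structure IsViscositySubsolution (ω α : ClosedRealForm11 n X) (ψ : X → ℝ) (c : ℝ) : Prop where
  /-- The current is bounded below by a multiple of `ω`; hence it has upper semicontinuous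
  local potentials near every point. -/
  boundedBelow : ∃ C : ℝ, IsPositiveAfterAdding ω α ψ C
  le_of_upperTest : ∀ e ∈ holCharts n X, ∀ U, IsOpen U → U ⊆ e.target →
    ∀ φ, IsLocalPotential α ψ e U φ → ∀ z ∈ U, ∀ q, IsUpperTest φ q z →
      phase (ω.coeff e z) (complexHessian q z) < Real.pi ∧
      Q (ω.coeff e z) (complexHessian q z) ≤ c

end Currents

end DHYM

end

noncomputable section

namespace DHYM

/-! ### Trigonometric convexity inequality -/

/-! Where the phase is below `π`, `Q` is a convex function of the Hermitian matrix. Its sublevel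
sets are therefore cut out by linear inequalities, and linear inequalities survive weak limits of
currents.

Suppose an upper test `q` has phase above `θ₀` at `z`, and let `H` be its complex Hessian there. The
tangent functional of `Q` at `H`, shifted if necessary to bring its phase below `π`, has the form `A
↦ ∑ A(vᵢ, vᵢ)` for a basis `v`. `exists_separating_basis` shows `∑ A(vᵢ, vᵢ) ≥ ∑ H(vᵢ, vᵢ) + δ - C
|Q(A) + cot θ₀|`, with the same `v`, `δ`, `C` for all metrics close to `ω(z)`. The eigenvalues of
`A` are unbounded, so this uniformity is not mere continuity: it rests on `A + Q(A) B ≥ 0`, which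
lets the error be absorbed into the main term.

Taking `A = α_k`, integrating against a test function and letting `k → ∞` kills the `Q` term, since
`L²` convergence gives local `L¹` convergence (`LocalConvergence.le_sum_currentForm`). Hence the
potential `φ` satisfies, as a distribution near `z`, a constant-coefficient Laplace inequality that
is stricter than that of `q` by `δ`. So `φ - q` is strictly subharmonic near `z` with maximum `0` at
`z`.

This violates the maximum principle. As `φ` is only upper semicontinuous, the principle is proved
with radial averages (`le_sum_levi_of_isUpperTest`): they strictly increase with the radius, the
mean value inequality for plurisubharmonic functions makes their lower limit at radius zero
nonnegative, yet they are nonpositive because `φ ≤ q`.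

Positivity of the limit current after adding a multiple of `ω` comes from passing to the limit in
`α_k + Q(α_k) ω ≥ 0`. -/

lemma arccot_mem_Ioo (x : ℝ) : arccot x ∈ Ioo 0 Real.pi := by
  have h1 := Real.arctan_lt_pi_div_two x
  have h2 := Real.neg_pi_div_two_lt_arctan x
  unfold arccot
  constructor <;> linarith

lemma cot_arccot (x : ℝ) : Real.cot (arccot x) = x := by
  rw [arccot, Real.cot_eq_cos_div_sin, Real.cos_pi_div_two_sub, Real.sin_pi_div_two_sub,
    ← Real.tan_eq_sin_div_cos, Real.tan_arctan]

lemma sin_arccot_sq (x : ℝ) : Real.sin (arccot x) ^ 2 = 1 / (1 + x ^ 2) := by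
  rw [arccot, Real.sin_pi_div_two_sub, Real.cos_sq_arctan]

lemma sin_arccot_mul_cos (x : ℝ) :
    Real.sin (arccot x) * Real.cos (arccot x) = x / (1 + x ^ 2) := by
  have h : 0 < Real.sin (arccot x) :=
    Real.sin_pos_of_mem_Ioo (arccot_mem_Ioo x)
  have h2 := cot_arccot x
  rw [Real.cot_eq_cos_div_sin, div_eq_iff h.ne'] at h2
  have h3 := sin_arccot_sq x
  rw [h2, mul_comm x, ← mul_assoc, ← sq, h3]
  ring

lemma continuous_arccot : Continuous arccot :=
  continuous_const.sub Real.continuous_arctan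

lemma tendsto_arccot_atTop : Tendsto arccot atTop (𝓝 0) := by
  have : Tendsto arccot atTop (𝓝 (Real.pi / 2 - Real.pi / 2)) :=
    tendsto_const_nhds.sub (tendsto_nhds_of_tendsto_nhdsWithin Real.tendsto_arctan_atTop)
  simpa using this

lemma cot_antitoneOn {a b : ℝ} (ha : 0 < a) (hab : a ≤ b) (hb : b < Real.pi) :
    Real.cot b ≤ Real.cot a := by
  have h1 : 0 < Real.sin a := Real.sin_pos_of_pos_of_lt_pi ha (hab.trans_lt hb)
  have h2 : 0 < Real.sin b := Real.sin_pos_of_pos_of_lt_pi (ha.trans_le hab) hb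
  have h3 : 0 ≤ Real.sin (b - a) := Real.sin_nonneg_of_nonneg_of_le_pi (by linarith) (by linarith)
  rw [Real.sin_sub] at h3
  rw [Real.cot_eq_cos_div_sin, Real.cot_eq_cos_div_sin, div_le_div_iff₀ h2 h1]
  nlinarith

lemma cot_lt_cot {a b : ℝ} (ha : 0 < a) (hab : a < b) (hb : b < Real.pi) :
    Real.cot b < Real.cot a := by
  have h1 : 0 < Real.sin a := Real.sin_pos_of_pos_of_lt_pi ha (hab.trans hb)
  have h2 : 0 < Real.sin b := Real.sin_pos_of_pos_of_lt_pi (ha.trans hab) hb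
  have h3 : 0 < Real.sin (b - a) := Real.sin_pos_of_pos_of_lt_pi (by linarith) (by linarith)
  rw [Real.sin_sub] at h3
  rw [Real.cot_eq_cos_div_sin, Real.cot_eq_cos_div_sin, div_lt_div_iff₀ h2 h1]
  nlinarith

/-- With `x = cot b` and `y = cot b'`, the two sides differ by `|(x sin a - cos a) - e^{i(a + a')}
(y sin a' - cos a')|² / (x + y)`, and `b + b' < π` makes `x + y` positive. This is the tangent
inequality for the concave function `(x y - 1) / (x + y) = cot (b + b')`; clearing the factor `sin²`
removes every restriction on `a` and `a'`. -/
lemma sin_sq_mul_cot_add_le (a a' : ℝ) {b b' : ℝ} (hb : 0 < b) (hb' : 0 < b')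
    (hbb : b + b' < Real.pi) :
    Real.sin (a + a') ^ 2 * Real.cot (b + b') - Real.sin (a + a') * Real.cos (a + a') ≤
      (Real.sin a ^ 2 * Real.cot b - Real.sin a * Real.cos a) +
      (Real.sin a' ^ 2 * Real.cot b' - Real.sin a' * Real.cos a') := by
  have h1 : 0 < Real.sin b := Real.sin_pos_of_pos_of_lt_pi hb (by linarith)
  have h2 : 0 < Real.sin b' := Real.sin_pos_of_pos_of_lt_pi hb' (by linarith)
  have h3 : 0 < Real.sin (b + b') := Real.sin_pos_of_pos_of_lt_pi (by linarith) hbb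
  obtain ⟨x, hx⟩ : ∃ x, x = Real.cot b := ⟨_, rfl⟩
  obtain ⟨y, hy⟩ : ∃ y, y = Real.cot b' := ⟨_, rfl⟩
  have hx' : Real.cos b = x * Real.sin b := by
    rw [hx, Real.cot_eq_cos_div_sin, div_mul_cancel₀ _ h1.ne']
  have hy' : Real.cos b' = y * Real.sin b' := by
    rw [hy, Real.cot_eq_cos_div_sin, div_mul_cancel₀ _ h2.ne']
  have hs : Real.sin (b + b') = (x + y) * (Real.sin b * Real.sin b') := by
    rw [Real.sin_add, hx', hy']; ring
  have hxy : 0 < x + y := by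
    rw [hs] at h3
    exact pos_of_mul_pos_left h3 (mul_pos h1 h2).le
  have hcot : Real.cot (b + b') = (x * y - 1) / (x + y) := by
    rw [Real.cot_eq_cos_div_sin, hs, Real.cos_add, hx', hy']
    field_simp
  rw [hcot, ← hx, ← hy]
  have e1 := Real.sin_sq_add_cos_sq a
  have e2 := Real.sin_sq_add_cos_sq a'
  rw [Real.sin_add, Real.cos_add]
  set s := Real.sin a
  set c := Real.cos a
  set s' := Real.sin a'
  set c' := Real.cos a'
  have key : 0 ≤ (s * x - c - (c * c' - s * s') * (s' * y - c')) ^ 2 +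
      ((s * c' + c * s') * (s' * y - c')) ^ 2 := by positivity
  rw [← sub_nonneg]
  have : (s ^ 2 * x - s * c + (s' ^ 2 * y - s' * c')) -
      ((s * c' + c * s') ^ 2 * ((x * y - 1) / (x + y)) -
      (s * c' + c * s') * (c * c' - s * s')) =
      ((s * x - c - (c * c' - s * s') * (s' * y - c')) ^ 2 +
      ((s * c' + c * s') * (s' * y - c')) ^ 2) / (x + y) := by
    have hc : c ^ 2 = 1 - s ^ 2 := by linarith
    have hc' : c' ^ 2 = 1 - s' ^ 2 := by linarith
    field_simp
    have q2 : c' ^ 3 = c' * (1 - s' ^ 2) := by rw [← hc']; ring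
    have q3 : c' ^ 4 = (1 - s' ^ 2) ^ 2 := by rw [← hc']; ring
    ring_nf
    simp only [hc, hc', q2, q3]
    ring
  rw [this]
  positivity

lemma sum_sin_sq_mul_cot {ι : Type*} (s : Finset ι) (a b : ι → ℝ) (hb : ∀ i, 0 < b i)
    (hs : ∑ i ∈ s, b i < Real.pi) :
    Real.sin (∑ i ∈ s, a i) ^ 2 * Real.cot (∑ i ∈ s, b i) -
        Real.sin (∑ i ∈ s, a i) * Real.cos (∑ i ∈ s, a i) ≤
      ∑ i ∈ s, (Real.sin (a i) ^ 2 * Real.cot (b i) - Real.sin (a i) * Real.cos (a i)) := by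
  classical
  induction s using Finset.induction_on with
  | empty => simp
  | insert i s hi ih =>
    rw [Finset.sum_insert hi] at hs
    rw [Finset.sum_insert hi, Finset.sum_insert hi, Finset.sum_insert hi]
    -- The two-term inequality needs both angles positive, and an empty tail has angle `0`.
    rcases s.eq_empty_or_nonempty with rfl | hne
    · simp
    · have hpos : 0 < ∑ j ∈ s, b j := Finset.sum_pos (fun j _ => hb j) hne
      have := ih (by linarith [hb i])
      have h2 := sin_sq_mul_cot_add_le (a i) (∑ j ∈ s, a j) (hb i) hpos hs
      linarith

/-- The gradient inequality for the convex function `-cot ∑ arccot λᵢ`. -/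
lemma sum_arccot_gradient_le {ι : Type*} [Fintype ι] (μ l : ι → ℝ)
    (hl : ∑ i, arccot (l i) < Real.pi) :
    Real.sin (∑ i, arccot (μ i)) ^ 2 * Real.cot (∑ i, arccot (l i)) -
        Real.sin (∑ i, arccot (μ i)) * Real.cos (∑ i, arccot (μ i)) ≤
      ∑ i, 1 / (1 + μ i ^ 2) * (l i - μ i) := by
  refine (sum_sin_sq_mul_cot Finset.univ (fun i => arccot (μ i)) (fun i => arccot (l i))
    (fun i => (arccot_mem_Ioo _).1) hl).trans (le_of_eq (Finset.sum_congr rfl fun i _ => ?_))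
  rw [sin_arccot_sq, sin_arccot_mul_cos, cot_arccot]
  ring

/-- The right side is affine in `D`, so by Birkhoff's theorem it suffices to treat permutation
matrices. There the diagonal inequality applies to the permuted `l`, whose total phase is unchanged.
This is what carries the inequality from diagonal to Hermitian matrices, with `D` the squared moduli
of a unitary matrix. -/
lemma sum_arccot_gradient_le_doublyStochastic {ι : Type*} [Fintype ι] [DecidableEq ι]
    (μ l : ι → ℝ) (hl : ∑ i, arccot (l i) < Real.pi) {D : Matrix ι ι ℝ}
    (hD : D ∈ doublyStochastic ℝ ι) :
    Real.sin (∑ i, arccot (μ i)) ^ 2 * Real.cot (∑ i, arccot (l i)) -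
        Real.sin (∑ i, arccot (μ i)) * Real.cos (∑ i, arccot (μ i)) ≤
      ∑ i, 1 / (1 + μ i ^ 2) * (∑ j, D i j * l j - μ i) := by
  rw [← SetLike.mem_coe, doublyStochastic_eq_convexHull_permMatrix] at hD
  set R := Real.sin (∑ i, arccot (μ i)) ^ 2 * Real.cot (∑ i, arccot (l i)) -
        Real.sin (∑ i, arccot (μ i)) * Real.cos (∑ i, arccot (μ i)) with hR
  let f : Matrix ι ι ℝ →ₗ[ℝ] ℝ :=
    { toFun := fun D => ∑ i, 1 / (1 + μ i ^ 2) * ∑ j, D i j * l j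
      map_add' := fun D E => by
        simp [add_mul, mul_add, Finset.sum_add_distrib]
      map_smul' := fun c D => by
        simp only [Matrix.smul_apply, smul_eq_mul, RingHom.id_apply, Finset.mul_sum]
        exact Finset.sum_congr rfl fun i _ => Finset.sum_congr rfl fun j _ => by ring }
  have hconv : Convex ℝ {D : Matrix ι ι ℝ | R + ∑ i, 1 / (1 + μ i ^ 2) * μ i ≤ f D} :=
    convex_halfSpace_ge f.isLinear _
  have hmem := convexHull_min (s := {σ.permMatrix ℝ | σ : Equiv.Perm ι}) ?_ hconv hD
  · have : f D = ∑ i, 1 / (1 + μ i ^ 2) * ∑ j, D i j * l j := rfl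
    rw [mem_ofPred_eq, this] at hmem
    simp only [mul_sub, Finset.sum_sub_distrib]
    linarith
  · rintro _ ⟨σ, rfl⟩
    have hsum : ∑ i, arccot (l (σ i)) = ∑ i, arccot (l i) :=
      Equiv.sum_comp σ fun i => arccot (l i)
    have h := sum_arccot_gradient_le μ (fun i => l (σ i)) (by rw [hsum]; exact hl)
    rw [hsum, ← hR] at h
    have hf : f (σ.permMatrix ℝ) = ∑ i, 1 / (1 + μ i ^ 2) * l (σ i) := by
      refine Finset.sum_congr rfl fun i _ => ?_
      congr 1
      simp [Equiv.Perm.permMatrix, PEquiv.toMatrix_apply, Equiv.toPEquiv_apply]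
    rw [mem_ofPred_eq, hf]
    simp only [mul_sub, Finset.sum_sub_distrib] at h
    linarith

/-! ### Simultaneous diagonalization and the phase -/

/-- The Hermitian form of a matrix, `∑ A_{jk} ξ_j conj ξ_k`. -/
def hermForm {n : ℕ} (A : Matrix (Fin n) (Fin n) ℂ) (ξ : Fin n → ℂ) : ℝ :=
  (∑ j, ∑ k, A j k * ξ j * star (ξ k)).re

lemma exists_unitary_diagonal {n : ℕ} {A : Matrix (Fin n) (Fin n) ℂ} (hA : A.IsHermitian) :
    ∃ (U : Matrix (Fin n) (Fin n) ℂ) (l : Fin n → ℝ), Uᴴ * U = 1 ∧ U * Uᴴ = 1 ∧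
      Uᴴ * A * U = Matrix.diagonal fun i => (l i : ℂ) := by
  refine ⟨hA.eigenvectorUnitary, hA.eigenvalues, ?_, ?_, ?_⟩
  · exact Unitary.coe_star_mul_self hA.eigenvectorUnitary
  · exact Unitary.coe_mul_star_self hA.eigenvectorUnitary
  · have := hA.conjStarAlgAut_star_eigenvectorUnitary
    rw [Unitary.conjStarAlgAut_star_apply] at this
    exact this

lemma exists_conjTranspose_mul_mul_eq_one {n : ℕ} {B : Matrix (Fin n) (Fin n) ℂ}
    (hB : B.PosDef) : ∃ P : Matrix (Fin n) (Fin n) ℂ, Pᴴ * B * P = 1 := by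
  obtain ⟨U, l, h1, h2, h3⟩ := exists_unitary_diagonal hB.isHermitian
  have hU : Function.Injective U.mulVec := by
    intro x y hxy
    have := congrArg (Uᴴ *ᵥ ·) hxy
    simpa [Matrix.mulVec_mulVec, h1] using this
  have hl : ∀ i, 0 < l i := by
    have h4 : (Uᴴ * B * U).PosDef := hB.conjTranspose_mul_mul_same hU
    rw [h3, Matrix.posDef_diagonal_iff] at h4
    intro i
    exact_mod_cast h4 i
  refine ⟨U * Matrix.diagonal fun i => ((1 / Real.sqrt (l i) : ℝ) : ℂ), ?_⟩
  have : (U * Matrix.diagonal fun i => ((1 / Real.sqrt (l i) : ℝ) : ℂ))ᴴ * B *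
      (U * Matrix.diagonal fun i => ((1 / Real.sqrt (l i) : ℝ) : ℂ)) =
      (Matrix.diagonal fun i => ((1 / Real.sqrt (l i) : ℝ) : ℂ))ᴴ * (Uᴴ * B * U) *
      (Matrix.diagonal fun i => ((1 / Real.sqrt (l i) : ℝ) : ℂ)) := by
    simp only [Matrix.conjTranspose_mul, Matrix.mul_assoc]
  rw [this, h3, Matrix.diagonal_conjTranspose, Matrix.diagonal_mul_diagonal,
    Matrix.diagonal_mul_diagonal, ← Matrix.diagonal_one]
  congr 1
  ext i
  have h5 : Real.sqrt (l i) * Real.sqrt (l i) = l i := Real.mul_self_sqrt (hl i).le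
  have h6 : 0 < Real.sqrt (l i) := Real.sqrt_pos.2 (hl i)
  have h7 : (1 / Real.sqrt (l i)) * l i * (1 / Real.sqrt (l i)) = 1 := by
    field_simp
    rw [sq, h5]
  simp only [Pi.star_apply, RCLike.star_def, Complex.conj_ofReal]
  exact_mod_cast h7

lemma exists_simultaneous_diagonal {n : ℕ} {A B : Matrix (Fin n) (Fin n) ℂ}
    (hB : B.PosDef) (hA : A.IsHermitian) :
    ∃ (P : Matrix (Fin n) (Fin n) ℂ) (l : Fin n → ℝ), Pᴴ * B * P = 1 ∧
      Pᴴ * A * P = Matrix.diagonal fun i => (l i : ℂ) := by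
  obtain ⟨P, hP⟩ := exists_conjTranspose_mul_mul_eq_one hB
  have hA' : (Pᴴ * A * P).IsHermitian := Matrix.isHermitian_conjTranspose_mul_mul P hA
  obtain ⟨U, l, h1, -, h3⟩ := exists_unitary_diagonal hA'
  refine ⟨P * U, l, ?_, ?_⟩
  · calc (P * U)ᴴ * B * (P * U) = Uᴴ * (Pᴴ * B * P) * U := by
          simp only [Matrix.conjTranspose_mul, Matrix.mul_assoc]
      _ = 1 := by rw [hP, Matrix.mul_one, h1]
  · rw [← h3]
    simp only [Matrix.conjTranspose_mul, Matrix.mul_assoc]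

lemma isUnit_det_of_conj_eq_one {n : ℕ} {B P : Matrix (Fin n) (Fin n) ℂ} (h : Pᴴ * B * P = 1) :
    IsUnit P.det := by
  have := congrArg Matrix.det h
  rw [Matrix.det_mul, Matrix.det_one] at this
  exact IsUnit.of_mul_eq_one_right _ this

lemma inv_eq_of_conj_eq_one {n : ℕ} {B P : Matrix (Fin n) (Fin n) ℂ} (h : Pᴴ * B * P = 1) :
    B⁻¹ = P * Pᴴ := by
  apply Matrix.inv_eq_left_inv
  have h1 : P * (Pᴴ * B) = 1 := by
    rw [mul_eq_one_comm]; exact h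
  rw [Matrix.mul_assoc, h1]

/-- Since `B⁻¹ = P Pᴴ`, the matrices `B⁻¹ A` and `Pᴴ A P` are the two orders of a product and share
their characteristic polynomial. -/
lemma roots_charpoly_of_conj_eq_one {n : ℕ} {A B P : Matrix (Fin n) (Fin n) ℂ} {l : Fin n → ℝ}
    (h : Pᴴ * B * P = 1) (hl : Pᴴ * A * P = Matrix.diagonal fun i => (l i : ℂ)) :
    (B⁻¹ * A).charpoly.roots = Finset.univ.val.map fun i => (l i : ℂ) := by
  rw [inv_eq_of_conj_eq_one h, Matrix.mul_assoc, Matrix.charpoly_mul_comm, hl,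
    Matrix.charpoly_diagonal]
  have := Polynomial.roots_multiset_prod_X_sub_C (Finset.univ.val.map fun i => (l i : ℂ))
  rwa [Multiset.map_map] at this

lemma phase_eq_sum {n : ℕ} {A B P : Matrix (Fin n) (Fin n) ℂ} {l : Fin n → ℝ}
    (h : Pᴴ * B * P = 1) (hl : Pᴴ * A * P = Matrix.diagonal fun i => (l i : ℂ)) :
    phase B A = ∑ i, arccot (l i) := by
  rw [phase, roots_charpoly_of_conj_eq_one h hl, Multiset.map_map]
  simp [Finset.sum]

/-- Coordinate changes act on both coefficient matrices by the same congruence. If `P` diagonalizes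
the pair `(B, A)`, then `R⁻¹ P` diagonalizes the new pair with the same eigenvalues. -/
lemma phase_conj {n : ℕ} {A B R : Matrix (Fin n) (Fin n) ℂ} (hB : B.PosDef)
    (hA : A.IsHermitian) (hR : IsUnit R.det) :
    phase (Rᴴ * B * R) (Rᴴ * A * R) = phase B A := by
  obtain ⟨P, l, h1, h2⟩ := exists_simultaneous_diagonal hB hA
  have hRR : R * R⁻¹ = 1 := Matrix.mul_nonsing_inv R hR
  have key : ∀ C : Matrix (Fin n) (Fin n) ℂ,
      (R⁻¹ * P)ᴴ * (Rᴴ * C * R) * (R⁻¹ * P) = Pᴴ * C * P := by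
    intro C
    calc (R⁻¹ * P)ᴴ * (Rᴴ * C * R) * (R⁻¹ * P)
        = Pᴴ * (R * R⁻¹)ᴴ * C * (R * R⁻¹) * P := by
          simp only [Matrix.conjTranspose_mul, Matrix.mul_assoc]
      _ = Pᴴ * C * P := by simp [hRR]
  rw [phase_eq_sum h1 h2, phase_eq_sum ((key B).trans h1) ((key A).trans h2)]

/-- `-cot` of the phase in terms of determinants. -/
lemma Q_eq_det {n : ℕ} {A B : Matrix (Fin n) (Fin n) ℂ} (hB : B.PosDef) (hA : A.IsHermitian) :
    Q B A = -((A + Complex.I • B).det.re / (A + Complex.I • B).det.im) := by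
  obtain ⟨P, l, h1, h2⟩ := exists_simultaneous_diagonal hB hA
  have hP := isUnit_det_of_conj_eq_one h1
  have e1 : Pᴴ * (A + Complex.I • B) * P = Matrix.diagonal fun i => (l i : ℂ) + Complex.I := by
    rw [Matrix.mul_add, Matrix.add_mul, h2, Matrix.mul_smul, Matrix.smul_mul, h1,
      ← Matrix.diagonal_one, ← Matrix.diagonal_smul, Matrix.diagonal_add]
    simp
  -- Each `λ + i` has argument `arccot λ`, so `det (A + i B)` has the phase as an argument, up to
  -- the positive factor `|det P|²`. The resulting formula makes `Q` visibly measurable.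
  have e2 : ∀ x : ℝ, (x : ℂ) + Complex.I =
      ((1 / Real.sin (arccot x) : ℝ) : ℂ) * Complex.exp ((arccot x : ℝ) * Complex.I) := by
    intro x
    have h : Real.sin (arccot x) ≠ 0 := (Real.sin_pos_of_mem_Ioo (arccot_mem_Ioo x)).ne'
    have h' := cot_arccot x
    rw [Real.cot_eq_cos_div_sin] at h'
    have h'' : ((Real.sin (arccot x) : ℝ) : ℂ) ≠ 0 := by exact_mod_cast h
    rw [Complex.exp_mul_I, ← Complex.ofReal_cos, ← Complex.ofReal_sin]
    nth_rewrite 1 [← h']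
    push_cast at h'' ⊢
    field_simp
  have e3 : (star P.det * P.det) * (A + Complex.I • B).det =
      ((∏ i, (1 / Real.sin (arccot (l i))) : ℝ) : ℂ) *
        Complex.exp ((phase B A : ℝ) * Complex.I) := by
    have := congrArg Matrix.det e1
    rw [Matrix.det_mul, Matrix.det_mul, Matrix.det_conjTranspose, Matrix.det_diagonal] at this
    rw [mul_right_comm, this, phase_eq_sum h1 h2]
    simp_rw [e2]
    rw [Finset.prod_mul_distrib, ← Complex.exp_sum, ← Finset.sum_mul]
    push_cast
    rfl
  have e4 : star P.det * P.det = ((Complex.normSq P.det : ℝ) : ℂ) := by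
    rw [Complex.normSq_eq_conj_mul_self]; rfl
  have hr : 0 < Complex.normSq P.det := Complex.normSq_pos.2 hP.ne_zero
  have hs : 0 < ∏ i, (1 / Real.sin (arccot (l i))) := Finset.prod_pos fun i _ =>
    one_div_pos.2 (Real.sin_pos_of_mem_Ioo (arccot_mem_Ioo _))
  rw [e4] at e3
  have hre := congrArg Complex.re e3
  have him := congrArg Complex.im e3
  rw [Complex.re_ofReal_mul, Complex.re_ofReal_mul, Complex.exp_ofReal_mul_I_re] at hre
  rw [Complex.im_ofReal_mul, Complex.im_ofReal_mul, Complex.exp_ofReal_mul_I_im] at him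
  rw [Q, Real.cot_eq_cos_div_sin, ← mul_div_mul_left _ _ hs.ne', ← hre, ← him,
    mul_div_mul_left _ _ hr.ne']

/-! ### Quadratic forms -/

lemma hermForm_add {n : ℕ} (A B : Matrix (Fin n) (Fin n) ℂ) (ξ : Fin n → ℂ) :
    hermForm (A + B) ξ = hermForm A ξ + hermForm B ξ := by
  simp [hermForm, add_mul, Finset.sum_add_distrib]

lemma hermForm_smul {n : ℕ} (c : ℝ) (A : Matrix (Fin n) (Fin n) ℂ) (ξ : Fin n → ℂ) :
    hermForm ((c : ℂ) • A) ξ = c * hermForm A ξ := by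
  simp only [hermForm, Matrix.smul_apply, smul_eq_mul, mul_assoc, ← Finset.mul_sum]
  rw [Complex.re_ofReal_mul]

/-- The diagonal entries of `Pᴴ A P` are values of the Hermitian form of `A`. -/
lemma hermForm_star_col {n : ℕ} (A P : Matrix (Fin n) (Fin n) ℂ) (i : Fin n) (c : ℝ) :
    hermForm A (fun j => (c : ℂ) * star (P j i)) = c ^ 2 * ((Pᴴ * A * P) i i).re := by
  have : (Pᴴ * A * P) i i = ∑ j, ∑ k, star (P j i) * A j k * P k i := by
    simp only [Matrix.mul_apply, Matrix.conjTranspose_apply, Finset.sum_mul]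
    rw [Finset.sum_comm]
  rw [this, hermForm, ← Complex.re_ofReal_mul]
  congr 1
  rw [Finset.mul_sum]
  refine Finset.sum_congr rfl fun j _ => ?_
  rw [Finset.mul_sum]
  refine Finset.sum_congr rfl fun k _ => ?_
  simp
  ring

lemma hermForm_nonneg_of_posSemidef {n : ℕ} {A : Matrix (Fin n) (Fin n) ℂ} (hA : A.PosSemidef)
    (ξ : Fin n → ℂ) : 0 ≤ hermForm A ξ := by
  have := hA.dotProduct_mulVec_nonneg (star ξ)
  rw [star_star] at this
  have h2 : ξ ⬝ᵥ A *ᵥ star ξ = ∑ j, ∑ k, A j k * ξ j * star (ξ k) := by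
    simp only [dotProduct, Matrix.mulVec, Finset.mul_sum, Pi.star_apply]
    exact Finset.sum_congr rfl fun j _ => Finset.sum_congr rfl fun k _ => by ring
  rw [h2] at this
  exact (Complex.le_def.1 this).1

/-- On the set where the phase is less than `π`, `A + Q_B(A) B` is positive semidefinite. -/
lemma neg_Q_le {n : ℕ} {A B P : Matrix (Fin n) (Fin n) ℂ} {l : Fin n → ℝ}
    (h : Pᴴ * B * P = 1) (hl : Pᴴ * A * P = Matrix.diagonal fun i => (l i : ℂ))
    (hph : phase B A < Real.pi) (i : Fin n) : 0 ≤ l i + Q B A := by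
  rw [Q]
  rw [phase_eq_sum h hl] at hph ⊢
  -- One summand is at most the whole phase, which is below `π`; as `cot` decreases there, `λᵢ ≥ cot
  -- θ = -Q`.
  have h1 : arccot (l i) ≤ ∑ i, arccot (l i) :=
    Finset.single_le_sum (fun i _ => (arccot_mem_Ioo (l i)).1.le) (Finset.mem_univ i)
  have := cot_antitoneOn (arccot_mem_Ioo (l i)).1 h1 hph
  rw [cot_arccot] at this
  linarith

lemma posSemidef_add_Q_smul {n : ℕ} {A B : Matrix (Fin n) (Fin n) ℂ} (hB : B.PosDef)
    (hA : A.IsHermitian) (hph : phase B A < Real.pi) :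
    (A + (Q B A : ℂ) • B).PosSemidef := by
  obtain ⟨P, l, h1, h2⟩ := exists_simultaneous_diagonal hB hA
  have e1 : Pᴴ * (A + (Q B A : ℂ) • B) * P =
      Matrix.diagonal fun i => ((l i + Q B A : ℝ) : ℂ) := by
    rw [Matrix.mul_add, Matrix.add_mul, h2, Matrix.mul_smul, Matrix.smul_mul, h1,
      ← Matrix.diagonal_one, ← Matrix.diagonal_smul, Matrix.diagonal_add]
    simp
  have hP : IsUnit P := (Matrix.isUnit_iff_isUnit_det P).2 (isUnit_det_of_conj_eq_one h1)
  rw [← Matrix.IsUnit.posSemidef_star_left_conjugate_iff hP, Matrix.star_eq_conjTranspose, e1,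
    Matrix.posSemidef_diagonal_iff]
  intro i
  exact_mod_cast neg_Q_le h1 h2 hph i

lemma hermForm_add_Q_mul_nonneg {n : ℕ} {A B : Matrix (Fin n) (Fin n) ℂ} (hB : B.PosDef)
    (hA : A.IsHermitian) (hph : phase B A < Real.pi) (ξ : Fin n → ℂ) :
    0 ≤ hermForm A ξ + Q B A * hermForm B ξ := by
  have := hermForm_nonneg_of_posSemidef (posSemidef_add_Q_smul hB hA hph) ξ
  rwa [hermForm_add, hermForm_smul] at this

/-! ### The separation lemma for matrices -/

lemma norm_mul_apply_le {n : ℕ} {X Y : Matrix (Fin n) (Fin n) ℂ} {x y : ℝ} (hx0 : 0 ≤ x)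
    (hx : ∀ i j, ‖X i j‖ ≤ x) (hy : ∀ i j, ‖Y i j‖ ≤ y) (i j : Fin n) :
    ‖(X * Y) i j‖ ≤ n * (x * y) := by
  rw [Matrix.mul_apply]
  refine (norm_sum_le _ _).trans ?_
  calc ∑ k, ‖X i k * Y k j‖ ≤ ∑ _k : Fin n, x * y := Finset.sum_le_sum fun k _ => by
        rw [norm_mul]
        exact mul_le_mul (hx i k) (hy k j) (norm_nonneg _) hx0
    _ = n * (x * y) := by simp

lemma norm_unitary_apply_le {n : ℕ} {U : Matrix (Fin n) (Fin n) ℂ} (hU : Uᴴ * U = 1)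
    (i j : Fin n) : ‖U i j‖ ≤ 1 :=
  entry_norm_bound_of_unitary (Matrix.mem_unitaryGroup_iff'.2 hU) i j

/-- Hermitian matrices near the identity have Hermitian square roots near the identity. -/
lemma exists_sqrt_near_one (n : ℕ) {ε : ℝ} (hε : 0 < ε) :
    ∃ δ > 0, ∀ N : Matrix (Fin n) (Fin n) ℂ, N.IsHermitian →
      (∀ i j, ‖(N - 1) i j‖ ≤ δ) → ∃ G : Matrix (Fin n) (Fin n) ℂ, Gᴴ = G ∧ G * G = N ∧
        IsUnit G.det ∧ ∀ i j, ‖(G - 1) i j‖ ≤ ε := by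
  -- Each conjugation by a unitary costs a factor `n²` in the entrywise norm. The first bound keeps
  -- the eigenvalues at least `1/2`; the second pays for conjugating to the eigenbasis and back. The
  -- `+ 1` covers `n = 0`.
  refine ⟨min (1 / (2 * (n ^ 2 + 1))) (ε / ((n ^ 2 + 1) * (n ^ 2 + 1))), by positivity, ?_⟩
  intro N hN hN1
  set δ := min (1 / (2 * ((n : ℝ) ^ 2 + 1))) (ε / (((n : ℝ) ^ 2 + 1) * (n ^ 2 + 1))) with hδ
  have hδ0 : 0 < δ := by positivity
  obtain ⟨U, l, h1, h2, h3⟩ := exists_unitary_diagonal hN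
  have hU := norm_unitary_apply_le h1
  have hU' : ∀ i j, ‖Uᴴ i j‖ ≤ 1 := fun i j => by
    rw [Matrix.conjTranspose_apply, norm_star]; exact hU j i
  have hl : ∀ i, |l i - 1| ≤ n ^ 2 * δ := by
    intro i
    have e : (Uᴴ * (N - 1) * U) i i = ((l i - 1 : ℝ) : ℂ) := by
      rw [Matrix.mul_sub, Matrix.sub_mul, h3, Matrix.mul_one, h1]
      simp
    have := norm_mul_apply_le (by positivity)
      (norm_mul_apply_le zero_le_one hU' hN1) hU i i
    rw [e, Complex.norm_real, Real.norm_eq_abs] at this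
    calc |l i - 1| ≤ _ := this
      _ = n ^ 2 * δ := by ring
  have hn1 : (n : ℝ) ^ 2 * δ ≤ 1 / 2 := by
    calc (n : ℝ) ^ 2 * δ ≤ (n ^ 2 + 1) * (1 / (2 * (n ^ 2 + 1))) := by
          gcongr
          · linarith
          · exact min_le_left _ _
      _ = 1 / 2 := by field_simp
  have hn2 : (n : ℝ) ^ 2 * (n ^ 2 * δ) ≤ ε := by
    calc (n : ℝ) ^ 2 * (n ^ 2 * δ) ≤ (n ^ 2 + 1) * ((n ^ 2 + 1) *
          (ε / ((n ^ 2 + 1) * (n ^ 2 + 1)))) := by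
          gcongr
          · linarith
          · linarith
          · exact min_le_right _ _
      _ = ε := by field_simp
  have hlpos : ∀ i, 0 < l i := fun i => by
    have := abs_le.1 (hl i)
    linarith
  set D : Matrix (Fin n) (Fin n) ℂ := Matrix.diagonal fun i => ((Real.sqrt (l i) : ℝ) : ℂ) with hD
  have hDD : D * D = Matrix.diagonal fun i => (l i : ℂ) := by
    rw [hD, Matrix.diagonal_mul_diagonal]
    congr 1
    ext i
    rw [← Complex.ofReal_mul, Real.mul_self_sqrt (hlpos i).le]
  have hDH : Dᴴ = D := by
    rw [hD, Matrix.diagonal_conjTranspose]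
    congr 1
    ext i
    simp
  have hGG : U * D * Uᴴ * (U * D * Uᴴ) = N := by
    calc U * D * Uᴴ * (U * D * Uᴴ) = U * (D * (Uᴴ * U) * D) * Uᴴ := by
          simp only [Matrix.mul_assoc]
      _ = (U * Uᴴ) * N * (U * Uᴴ) := by
          rw [h1, Matrix.mul_one, hDD, ← h3]
          simp only [Matrix.mul_assoc]
      _ = N := by rw [h2, Matrix.one_mul, Matrix.mul_one]
  refine ⟨U * D * Uᴴ, ?_, hGG, ?_, ?_⟩
  · simp only [Matrix.conjTranspose_mul, Matrix.conjTranspose_conjTranspose, hDH,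
      Matrix.mul_assoc]
  · have : IsUnit (D.det * D.det) := by
      rw [← Matrix.det_mul, hDD, Matrix.det_diagonal]
      exact (Finset.prod_ne_zero_iff.2 fun i _ => by exact_mod_cast (hlpos i).ne').isUnit
    have hUdet : IsUnit (U.det * Uᴴ.det) := by rw [← Matrix.det_mul, h2]; simp
    rw [Matrix.det_mul, Matrix.det_mul]
    exact ((isUnit_of_mul_isUnit_left hUdet).mul (isUnit_of_mul_isUnit_left this)).mul
      (isUnit_of_mul_isUnit_right hUdet)
  · intro i j
    have e : U * D * Uᴴ - 1 = U * (D - 1) * Uᴴ := by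
      rw [Matrix.mul_sub, Matrix.sub_mul, Matrix.mul_one, h2]
    have hD1 : ∀ i j, ‖(D - 1) i j‖ ≤ n ^ 2 * δ := by
      intro i j
      rw [hD, ← Matrix.diagonal_one, Matrix.diagonal_sub]
      rcases eq_or_ne i j with rfl | hij
      · rw [Matrix.diagonal_apply_eq, ← Complex.ofReal_one, ← Complex.ofReal_sub,
          Complex.norm_real, Real.norm_eq_abs]
        refine le_trans ?_ (hl i)
        -- The second factor is at least `1`, so taking square roots does not increase the distance
        -- to `1`.
        have h5 : l i - 1 = (Real.sqrt (l i) - 1) * (Real.sqrt (l i) + 1) := by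
          nlinarith [Real.mul_self_sqrt (hlpos i).le]
        rw [h5, abs_mul]
        refine le_mul_of_one_le_right (abs_nonneg _) ?_
        rw [abs_of_nonneg (by positivity)]
        linarith [Real.sqrt_nonneg (l i)]
      · rw [Matrix.diagonal_apply_ne _ hij, norm_zero]
        positivity
    rw [e]
    have := norm_mul_apply_le (by positivity)
      (norm_mul_apply_le zero_le_one hU hD1) hU' i j
    calc _ ≤ _ := this
      _ = (n : ℝ) ^ 2 * (n ^ 2 * δ) := by ring
      _ ≤ ε := hn2

/-- With `G = 1 + E`, the difference is `Eᴴ K + K E + Eᴴ K E`, and each term is at most `n² ε k`.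
The error is proportional to the size of `K`, which has no a priori bound in the application. -/
lemma norm_conj_sub_apply_le {n : ℕ} {G K : Matrix (Fin n) (Fin n) ℂ} {ε k : ℝ} (hε : 0 ≤ ε)
    (hε1 : ε ≤ 1) (hG : ∀ i j, ‖(G - 1) i j‖ ≤ ε) (hk : 0 ≤ k) (hK : ∀ i j, ‖K i j‖ ≤ k)
    (i : Fin n) : ‖(Gᴴ * K * G) i i - K i i‖ ≤ 3 * n ^ 2 * ε * k := by
  set E := G - 1 with hE
  have hGE : G = 1 + E := by rw [hE]; abel
  have hE' : ∀ i j, ‖Eᴴ i j‖ ≤ ε := fun i j => by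
    rw [Matrix.conjTranspose_apply, norm_star]; exact hG j i
  have e : Gᴴ * K * G - K = Eᴴ * K + K * E + Eᴴ * K * E := by
    rw [hGE, Matrix.conjTranspose_add, Matrix.conjTranspose_one]
    noncomm_ring
  have h1 := norm_mul_apply_le hε hE' hK
  have h2 := norm_mul_apply_le hk hK hG i i
  have h3 := norm_mul_apply_le (by positivity) h1 hG i i
  rw [← Matrix.sub_apply, e, Matrix.add_apply, Matrix.add_apply]
  refine (norm_add₃_le).trans ?_
  have hn : (n : ℝ) ≤ n ^ 2 := by
    rcases Nat.eq_zero_or_pos n with h | h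
    · simp [h]
    · have : (1 : ℝ) ≤ n := by exact_mod_cast h
      nlinarith
  have hek : 0 ≤ ε * k := by positivity
  have h4 : (n : ℝ) * (n * (ε * k) * ε) ≤ n ^ 2 * (ε * k) := by
    calc (n : ℝ) * (n * (ε * k) * ε) = n ^ 2 * (ε * k) * ε := by ring
      _ ≤ n ^ 2 * (ε * k) * 1 := by gcongr
      _ = _ := by ring
  have h5 : (n : ℝ) * (ε * k) ≤ n ^ 2 * (ε * k) := by gcongr
  have := h1 i i
  calc _ ≤ n * (ε * k) + n * (k * ε) + n * (n * (ε * k) * ε) := by gcongr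
    _ ≤ n ^ 2 * (ε * k) + n ^ 2 * (ε * k) + n ^ 2 * (ε * k) := by
        rw [mul_comm k ε]; gcongr
    _ = _ := by ring

lemma conj_diagonal_apply {n : ℕ} (U : Matrix (Fin n) (Fin n) ℂ) (m : Fin n → ℝ)
    (i k : Fin n) : (Uᴴ * (Matrix.diagonal fun j => (m j : ℂ)) * U) i k =
      ∑ j, star (U j i) * m j * U j k := by
  rw [Matrix.mul_apply]
  refine Finset.sum_congr rfl fun j _ => ?_
  rw [Matrix.mul_diagonal, Matrix.conjTranspose_apply]

lemma conj_diagonal_apply_self {n : ℕ} (U : Matrix (Fin n) (Fin n) ℂ) (m : Fin n → ℝ)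
    (i : Fin n) : (Uᴴ * (Matrix.diagonal fun j => (m j : ℂ)) * U) i i =
      ((∑ j, ‖U j i‖ ^ 2 * m j : ℝ) : ℂ) := by
  rw [conj_diagonal_apply, Complex.ofReal_sum]
  refine Finset.sum_congr rfl fun j _ => ?_
  rw [mul_right_comm, RCLike.star_def, Complex.conj_mul']
  push_cast
  ring

/-- The entries of a positive semidefinite matrix are controlled by its trace. -/
lemma norm_conj_diagonal_apply_le {n : ℕ} {U : Matrix (Fin n) (Fin n) ℂ} (hU : Uᴴ * U = 1)
    {m : Fin n → ℝ} (hm : ∀ j, 0 ≤ m j) (i k : Fin n) :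
    ‖(Uᴴ * (Matrix.diagonal fun j => (m j : ℂ)) * U) i k‖ ≤ ∑ j, m j := by
  rw [conj_diagonal_apply]
  refine (norm_sum_le _ _).trans (Finset.sum_le_sum fun j _ => ?_)
  rw [norm_mul, norm_mul, norm_star, Complex.norm_real, Real.norm_eq_abs, abs_of_nonneg (hm j)]
  have h1 := norm_unitary_apply_le hU j i
  have h2 := norm_unitary_apply_le hU j k
  calc ‖U j i‖ * m j * ‖U j k‖ ≤ 1 * m j * 1 := by
        gcongr
        exact mul_nonneg zero_le_one (hm j)
        exact hm j
    _ = m j := by ring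

lemma doublyStochastic_of_unitary {n : ℕ} {U : Matrix (Fin n) (Fin n) ℂ} (hU : Uᴴ * U = 1) :
    (Matrix.of fun i j => ‖U j i‖ ^ 2) ∈ doublyStochastic ℝ (Fin n) := by
  have hU' : U * Uᴴ = 1 := mul_eq_one_comm.1 hU
  rw [mem_doublyStochastic_iff_sum]
  refine ⟨fun i j => sq_nonneg _, fun i => ?_, fun j => ?_⟩
  · have := congrFun (congrFun hU i) i
    rw [Matrix.mul_apply, Matrix.one_apply_eq] at this
    simp only [Matrix.conjTranspose_apply, RCLike.star_def, Complex.conj_mul'] at this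
    exact_mod_cast this
  · have := congrFun (congrFun hU' j) j
    rw [Matrix.mul_apply, Matrix.one_apply_eq] at this
    simp only [Matrix.conjTranspose_apply, RCLike.star_def, Complex.mul_conj'] at this
    exact_mod_cast this

/-- The phase of the Hessian of a test may exceed `π`, outside the domain where `Q` is convex.
Adding `t ≥ 0` to all eigenvalues lowers the phase continuously to `0`, so it can be brought between
`θ₀` and `π`, while the matrix only increases. -/
lemma exists_shift_sum_arccot {n : ℕ} (μ : Fin n → ℝ) {a b : ℝ} (ha : 0 < a) (hab : a < b)
    (hμ : a < ∑ i, arccot (μ i)) :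
    ∃ t, 0 ≤ t ∧ ∑ i, arccot (μ i + t) ∈ Ioo a b := by
  by_cases h : ∑ i, arccot (μ i) < b
  · exact ⟨0, le_rfl, by simpa using ⟨hμ, h⟩⟩
  · push Not at h
    have hcont : Continuous fun t => ∑ i, arccot (μ i + t) :=
      continuous_finsetSum _ fun i _ => continuous_arccot.comp (by fun_prop)
    have hlim : Tendsto (fun t => ∑ i, arccot (μ i + t)) atTop (𝓝 (∑ _i : Fin n, 0)) :=
      tendsto_finsetSum _ fun i _ => tendsto_arccot_atTop.comp (tendsto_atTop_add_const_left _ _ tendsto_id)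
    rw [Finset.sum_const_zero] at hlim
    obtain ⟨T, hT, hT0⟩ := ((hlim.eventually (gt_mem_nhds ha)).and (eventually_ge_atTop 0)).exists
    have hmem : (a + b) / 2 ∈ Icc (∑ i, arccot (μ i + T)) (∑ i, arccot (μ i + 0)) := by
      simp only [add_zero]
      exact ⟨by linarith, by linarith⟩
    obtain ⟨t, ht, hte⟩ := intermediate_value_Icc' hT0 hcont.continuousOn hmem
    exact ⟨t, ht.1, by simp only at hte; rw [hte]; constructor <;> linarith⟩

/-- The convexity estimate in a frame `G` close to being unitary. -/
lemma weighted_gradient_le {n : ℕ} {U G : Matrix (Fin n) (Fin n) ℂ} (hU : Uᴴ * U = 1)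
    {ν l : Fin n → ℝ} {q τ ε : ℝ} (hq : -Real.cot (∑ i, arccot (l i)) = q)
    (hl : ∑ i, arccot (l i) < Real.pi) (hlq : ∀ i, 0 ≤ l i + q)
    (hε : 0 ≤ ε) (hε1 : ε ≤ 1) (hG : ∀ i j, ‖(G - 1) i j‖ ≤ ε)
    (hετ : n * (3 * n ^ 2 * ε) * (∑ i, (1 + ν i ^ 2)) ≤ τ)  (hτ1 : τ ≤ 1)
    (hN : ∀ i, ‖(Gᴴ * G - 1) i i‖ ≤ τ) :
    (1 - τ) * (-Real.sin (∑ i, arccot (ν i)) ^ 2 * q -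
        Real.sin (∑ i, arccot (ν i)) * Real.cos (∑ i, arccot (ν i)) +
        ∑ i, 1 / (1 + ν i ^ 2) * ν i) - 2 * τ * |q| * ∑ i, 1 / (1 + ν i ^ 2) ≤
      ∑ i, 1 / (1 + ν i ^ 2) *
        ((Gᴴ * (Uᴴ * (Matrix.diagonal fun j => (l j : ℂ)) * U) * G) i i).re := by
  set w : Fin n → ℝ := fun i => 1 / (1 + ν i ^ 2) with hw
  have hw0 : ∀ i, 0 < w i := fun i => by positivity
  have hw1 : ∀ i, w i ≤ 1 := fun i => by
    rw [hw]; simp only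
    rw [div_le_one (by positivity)]
    nlinarith [sq_nonneg (ν i)]
  set R := -Real.sin (∑ i, arccot (ν i)) ^ 2 * q -
        Real.sin (∑ i, arccot (ν i)) * Real.cos (∑ i, arccot (ν i)) with hR
  -- The shift by `q` makes the matrix positive semidefinite, so that its entries can be bounded by
  -- its trace.
  set K := Uᴴ * (Matrix.diagonal fun j => ((l j + q : ℝ) : ℂ)) * U with hK
  have hKeq : K = Uᴴ * (Matrix.diagonal fun j => (l j : ℂ)) * U + (q : ℂ) • 1 := by
    have : (Matrix.diagonal fun j => ((l j + q : ℝ) : ℂ)) =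
        (Matrix.diagonal fun j => (l j : ℂ)) + (q : ℂ) • (1 : Matrix (Fin n) (Fin n) ℂ) := by
      rw [← Matrix.diagonal_one, ← Matrix.diagonal_smul, Matrix.diagonal_add]
      simp
    rw [hK, this, Matrix.mul_add, Matrix.add_mul, Matrix.mul_smul, Matrix.smul_mul,
      Matrix.mul_one, hU]
  set k : Fin n → ℝ := fun i => ∑ j, ‖U j i‖ ^ 2 * (l j + q) with hk
  have hKk : ∀ i, K i i = ((k i : ℝ) : ℂ) := fun i => conj_diagonal_apply_self U _ i
  have hds := doublyStochastic_of_unitary hU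
  have hds' := mem_doublyStochastic_iff_sum.1 hds
  have hk0 : ∀ i, 0 ≤ k i := fun i =>
    Finset.sum_nonneg fun j _ => mul_nonneg (sq_nonneg _) (hlq j)
  have hksum : ∑ i, k i = ∑ j, (l j + q) := by
    rw [hk, Finset.sum_comm]
    refine Finset.sum_congr rfl fun j _ => ?_
    rw [← Finset.sum_mul]
    have := hds'.2.2 j
    simp only [Matrix.of_apply] at this
    rw [this, one_mul]
  have hkl : ∀ i, k i = ∑ j, ‖U j i‖ ^ 2 * l j + q := by
    intro i
    have := hds'.2.1 i
    simp only [Matrix.of_apply] at this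
    simp only [hk, mul_add, Finset.sum_add_distrib, ← Finset.sum_mul, this, one_mul]
  have hgrad : R + ∑ i, w i * ν i + q * ∑ i, w i ≤ ∑ i, w i * k i := by
    have h := sum_arccot_gradient_le_doublyStochastic ν l hl hds
    simp only [Matrix.of_apply] at h
    have h2 : ∑ i, w i * k i = ∑ i, w i * (∑ j, ‖U j i‖ ^ 2 * l j - ν i) +
        ∑ i, w i * ν i + q * ∑ i, w i := by
      rw [Finset.mul_sum, ← Finset.sum_add_distrib, ← Finset.sum_add_distrib]
      exact Finset.sum_congr rfl fun i _ => by rw [hkl]; ring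
    have h3 : Real.sin (∑ i, arccot (ν i)) ^ 2 * Real.cot (∑ i, arccot (l i)) =
        -Real.sin (∑ i, arccot (ν i)) ^ 2 * q := by rw [← hq]; ring
    rw [h3] at h
    rw [h2]
    linarith
  -- The trace is bounded by the weighted trace being estimated, so the effect of `G` becomes the
  -- relative error `τ`, however large the eigenvalues are.
  have htr : ∑ j, (l j + q) ≤ (∑ i, (1 + ν i ^ 2)) * ∑ i, w i * k i := by
    rw [← hksum, Finset.sum_mul]
    refine Finset.sum_le_sum fun i _ => ?_
    calc k i = (1 + ν i ^ 2) * (w i * k i) := by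
          rw [hw]; field_simp
      _ ≤ (1 + ν i ^ 2) * ∑ i, w i * k i := by
          gcongr
          exact Finset.single_le_sum (f := fun i => w i * k i)
            (fun j _ => mul_nonneg (hw0 j).le (hk0 j)) (Finset.mem_univ i)
  have hGKG : (1 - τ) * ∑ i, w i * k i ≤ ∑ i, w i * ((Gᴴ * K * G) i i).re := by
    have h1 : ∀ i, k i - 3 * n ^ 2 * ε * ∑ j, (l j + q) ≤ ((Gᴴ * K * G) i i).re := by
      intro i
      have := norm_conj_sub_apply_le hε hε1 hG (Finset.sum_nonneg fun j _ => hlq j)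
        (norm_conj_diagonal_apply_le hU hlq) i
      have h2 := (Complex.abs_re_le_norm _).trans this
      rw [← hK, hKk, Complex.sub_re, Complex.ofReal_re] at h2
      linarith [(abs_le.1 h2).1]
    have h0 : 0 ≤ 3 * n ^ 2 * ε * ∑ j, (l j + q) :=
      mul_nonneg (by positivity) (Finset.sum_nonneg fun j _ => hlq j)
    have hwk : 0 ≤ ∑ i, w i * k i :=
      Finset.sum_nonneg fun i _ => mul_nonneg (hw0 i).le (hk0 i)
    calc (1 - τ) * ∑ i, w i * k i
        ≤ ∑ i, w i * k i - (n * (3 * n ^ 2 * ε) * (∑ i, (1 + ν i ^ 2))) * ∑ i, w i * k i := by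
          rw [sub_mul, one_mul]; gcongr
      _ ≤ ∑ i, w i * k i - n * (3 * n ^ 2 * ε * ∑ j, (l j + q)) := by
          have : n * (3 * n ^ 2 * ε * ∑ j, (l j + q)) ≤
            n * (3 * n ^ 2 * ε * ((∑ i, (1 + ν i ^ 2)) * ∑ i, w i * k i)) := by gcongr
          linarith
      _ = ∑ i, (w i * k i - 3 * n ^ 2 * ε * ∑ j, (l j + q)) := by
          rw [Finset.sum_sub_distrib, Finset.sum_const, Finset.card_univ, Fintype.card_fin,
            nsmul_eq_mul]
      _ ≤ ∑ i, w i * ((Gᴴ * K * G) i i).re := by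
          refine Finset.sum_le_sum fun i _ => ?_
          have := mul_le_mul_of_nonneg_left (h1 i) (hw0 i).le
          have h3 := mul_le_mul_of_nonneg_right (hw1 i) h0
          linarith
  have hNre : ∀ i, |((Gᴴ * G) i i).re - 1| ≤ τ := by
    intro i
    have := (Complex.abs_re_le_norm _).trans (hN i)
    simpa using this
  have hfin : ∑ i, w i * ((Gᴴ * K * G) i i).re =
      ∑ i, w i * ((Gᴴ * (Uᴴ * (Matrix.diagonal fun j => (l j : ℂ)) * U) * G) i i).re +
        ∑ i, w i * (q * ((Gᴴ * G) i i).re) := by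
    rw [← Finset.sum_add_distrib]
    refine Finset.sum_congr rfl fun i _ => ?_
    rw [hKeq, Matrix.mul_add, Matrix.add_mul, Matrix.mul_smul, Matrix.smul_mul, Matrix.mul_one,
      Matrix.add_apply, Matrix.smul_apply, smul_eq_mul, Complex.add_re, Complex.re_ofReal_mul,
      mul_add]
  -- Undoing the shift costs `τ |q| ∑ w` here, and as much again because `q ∑ w` has been multiplied
  -- by `1 - τ`: hence the factor `2 τ` in the conclusion.
  have hNsum : ∑ i, w i * (q * ((Gᴴ * G) i i).re) ≤ q * ∑ i, w i + τ * |q| * ∑ i, w i := by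
    rw [Finset.mul_sum, Finset.mul_sum, ← Finset.sum_add_distrib]
    refine Finset.sum_le_sum fun i _ => ?_
    have h1 : q * (((Gᴴ * G) i i).re - 1) ≤ |q| * τ :=
      (le_abs_self _).trans (by rw [abs_mul]; gcongr; exact hNre i)
    have := mul_le_mul_of_nonneg_left h1 (hw0 i).le
    linarith
  have hτ0 : 0 ≤ 1 - τ := by linarith
  have hW : 0 ≤ ∑ i, w i := Finset.sum_nonneg fun i _ => (hw0 i).le
  have h6 := mul_le_mul_of_nonneg_left hgrad hτ0
  have hτ' : 0 ≤ τ := le_trans (mul_nonneg (by positivity) (Finset.sum_nonneg fun i _ => by positivity)) hετ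
  have h7 : q * (τ * ∑ i, w i) ≤ |q| * (τ * ∑ i, w i) :=
    mul_le_mul_of_nonneg_right (le_abs_self q) (mul_nonneg hτ' hW)
  linarith

/-- If the phase of `H` exceeds `θ₀`, then `H` is strictly separated from the matrices of phase at
most `θ₀` by a sum of the Hermitian forms at the vectors of a basis, with an error controlled by
`Q`, uniformly for small perturbations of `B`. -/
lemma exists_separating_basis {n : ℕ} {B H : Matrix (Fin n) (Fin n) ℂ} (hB : B.PosDef)
    (hH : H.IsHermitian) {θ₀ : ℝ} (hθ₀ : θ₀ ∈ Ioo 0 Real.pi) (hph : θ₀ < phase B H) :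
    ∃ v : Module.Basis (Fin n) ℂ (Fin n → ℂ), ∃ δ > 0, ∃ C : ℝ, 0 ≤ C ∧ ∃ r > 0,
      ∀ B' : Matrix (Fin n) (Fin n) ℂ, B'.PosDef → (∀ i j, ‖(B' - B) i j‖ ≤ r) →
      ∀ A : Matrix (Fin n) (Fin n) ℂ, A.IsHermitian → phase B' A < Real.pi →
        ∑ i, hermForm H (v i) + δ - C * |Q B' A + Real.cot θ₀| ≤ ∑ i, hermForm A (v i) := by
  obtain ⟨P, μ, hP1, hP2⟩ := exists_simultaneous_diagonal hB hH
  rw [phase_eq_sum hP1 hP2] at hph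
  obtain ⟨t, ht, htΘ⟩ := exists_shift_sum_arccot μ hθ₀.1 hθ₀.2 hph
  set ν : Fin n → ℝ := fun i => μ i + t with hν
  set Θ := ∑ i, arccot (ν i) with hΘ
  have hPdet := isUnit_det_of_conj_eq_one hP1
  -- These weights are the gradient of `Q` at the shifted eigenvalues, up to the common factor `-1 /
  -- sin² Θ`.
  set w : Fin n → ℝ := fun i => 1 / (1 + ν i ^ 2) with hw
  have hw0 : ∀ i, 0 < w i := fun i => by positivity
  -- The rows of `V` are the conjugated columns of `P` scaled by `√wᵢ`, so the Hermitian form at the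
  -- `i`-th row is `wᵢ (Pᴴ A P)ᵢᵢ`.
  set V : Matrix (Fin n) (Fin n) ℂ :=
    (Matrix.diagonal fun i => ((Real.sqrt (w i) : ℝ) : ℂ)) * Pᴴ with hV
  have hVdet : IsUnit V.det := by
    rw [hV, Matrix.det_mul, Matrix.det_diagonal, Matrix.det_conjTranspose]
    refine IsUnit.mul (Finset.prod_ne_zero_iff.2 fun i _ => ?_).isUnit hPdet.star
    exact_mod_cast (Real.sqrt_pos.2 (hw0 i)).ne'
  have hlin : LinearIndependent ℂ V.row :=
    Matrix.linearIndependent_rows_iff_isUnit.2 ((Matrix.isUnit_iff_isUnit_det V).2 hVdet)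
  let v : Module.Basis (Fin n) ℂ (Fin n → ℂ) :=
    basisOfLinearIndependentOfCardEqFinrank' _ hlin (by simp)
  have hv : ∀ A : Matrix (Fin n) (Fin n) ℂ, ∀ i,
      hermForm A (v i) = w i * ((Pᴴ * A * P) i i).re := by
    intro A i
    have h1 : v i = fun j => ((Real.sqrt (w i) : ℝ) : ℂ) * star (P j i) := by
      simp only [v, coe_basisOfLinearIndependentOfCardEqFinrank']
      ext j
      rw [Matrix.row, hV, Matrix.diagonal_mul, Matrix.conjTranspose_apply]
    rw [h1, hermForm_star_col, Real.sq_sqrt (hw0 i).le]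
  set s := ∑ i, w i * ν i with hs
  set W := ∑ i, w i with hW
  have hW0 : 0 ≤ W := Finset.sum_nonneg fun i _ => (hw0 i).le
  have hsinΘ : 0 < Real.sin Θ :=
    Real.sin_pos_of_pos_of_lt_pi (hθ₀.1.trans htΘ.1) htΘ.2
  -- The gap given by the tangent inequality at `ν` for a matrix with `Q = -cot θ₀`. Half of it
  -- becomes `δ`; the other half absorbs the errors proportional to `τ`.
  set d := Real.sin Θ ^ 2 * (Real.cot θ₀ - Real.cot Θ) with hd
  have hd0 : 0 < d := mul_pos (by positivity) (sub_pos.2 (cot_lt_cot hθ₀.1 htΘ.1 htΘ.2))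
  have hHs : ∑ i, hermForm H (v i) ≤ s := by
    refine Finset.sum_le_sum fun i _ => ?_
    rw [hv, hP2, Matrix.diagonal_apply_eq, Complex.ofReal_re]
    exact mul_le_mul_of_nonneg_left (by rw [hν]; linarith) (hw0 i).le
  obtain ⟨τ, hτ0, hτ1, hτ⟩ : ∃ τ : ℝ, 0 < τ ∧ τ ≤ 1 ∧
      τ * (d + |s| + 2 * |Real.cot θ₀| * W) ≤ d / 2 := by
    have hX : 0 < d + |s| + 2 * |Real.cot θ₀| * W := by positivity
    refine ⟨min 1 (d / 2 / (d + |s| + 2 * |Real.cot θ₀| * W)), by positivity, min_le_left _ _, ?_⟩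
    exact (mul_le_mul_of_nonneg_right (min_le_right _ _) hX.le).trans (by
      rw [div_mul_cancel₀ _ hX.ne'])
  obtain ⟨ε, hε0, hε1, hε⟩ : ∃ ε : ℝ, 0 < ε ∧ ε ≤ 1 ∧
      n * (3 * n ^ 2 * ε) * (∑ i, (1 + ν i ^ 2)) ≤ τ := by
    set X := n * (3 * (n : ℝ) ^ 2) * (∑ i, (1 + ν i ^ 2)) with hXdef
    have hX : 0 ≤ X := mul_nonneg (by positivity) (Finset.sum_nonneg fun i _ => by positivity)
    refine ⟨min 1 (τ / (X + 1)), by positivity, min_le_left _ _, ?_⟩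
    calc _ = X * min 1 (τ / (X + 1)) := by rw [hXdef]; ring
      _ ≤ (X + 1) * (τ / (X + 1)) := by
          gcongr
          · linarith
          · exact min_le_right _ _
      _ = τ := by field_simp
  obtain ⟨δ, hδ0, hδ⟩ := exists_sqrt_near_one n hε0
  obtain ⟨p, hp0, hp⟩ : ∃ p : ℝ, 0 ≤ p ∧ ∀ i j, ‖P i j‖ ≤ p :=
    ⟨∑ i, ∑ j, ‖P i j‖, by positivity, fun i j =>
      (Finset.single_le_sum (f := fun j => ‖P i j‖) (fun _ _ => norm_nonneg _)
        (Finset.mem_univ j)).trans (Finset.single_le_sum (f := fun i => ∑ j, ‖P i j‖)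
          (fun _ _ => Finset.sum_nonneg fun _ _ => norm_nonneg _) (Finset.mem_univ i))⟩
  have hpH : ∀ i j, ‖Pᴴ i j‖ ≤ p := fun i j => by
    rw [Matrix.conjTranspose_apply, norm_star]; exact hp j i
  set X : ℝ := n * (n * p * p) with hXdef
  have hX0 : 0 ≤ X := by positivity
  have hmin : 0 < min δ τ := lt_min hδ0 hτ0
  refine ⟨v, d / 2, half_pos hd0, 1 + 2 * W, by positivity, min δ τ / (X + 1), by positivity, ?_⟩
  intro B' hB' hBB' A hA hAph
  obtain ⟨P', l, hP1', hP2'⟩ := exists_simultaneous_diagonal hB' hA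
  have hP'det := isUnit_det_of_conj_eq_one hP1'
  -- `S` relates the frame adapted to `(B, H)` to the one adapted to `(B', A)`. Below it is
  -- polar-decomposed as `S = U G` with `G² = Pᴴ B' P`, so `U` is unitary and `G` is close to `1`
  -- when `B'` is close to `B`.
  set S := P'⁻¹ * P with hS
  have hPS : P' * S = P := by
    rw [hS, ← Matrix.mul_assoc, Matrix.mul_nonsing_inv _ hP'det, Matrix.one_mul]
  have hconj : ∀ C : Matrix (Fin n) (Fin n) ℂ, Pᴴ * C * P = Sᴴ * (P'ᴴ * C * P') * S := by
    intro C
    rw [← hPS]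
    simp only [Matrix.conjTranspose_mul, Matrix.mul_assoc]
  have hNS : Pᴴ * B' * P = Sᴴ * S := by rw [hconj, hP1', Matrix.mul_one]
  have hNe : ∀ i j, ‖(Pᴴ * B' * P - 1) i j‖ ≤ min δ τ := by
    intro i j
    have e : Pᴴ * B' * P - 1 = Pᴴ * (B' - B) * P := by
      rw [Matrix.mul_sub, Matrix.sub_mul, hP1]
    rw [e]
    refine (norm_mul_apply_le (by positivity) (norm_mul_apply_le hp0 hpH hBB') hp i j).trans ?_
    calc (n : ℝ) * (n * (p * (min δ τ / (X + 1))) * p) = X * (min δ τ / (X + 1)) := by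
          rw [hXdef]; ring
      _ ≤ (X + 1) * (min δ τ / (X + 1)) := by gcongr; linarith
      _ = min δ τ := by field_simp
  obtain ⟨G, hGH, hGG, hGdet, hG1⟩ := hδ (Pᴴ * B' * P)
    (Matrix.isHermitian_conjTranspose_mul_mul P hB'.isHermitian)
    (fun i j => (hNe i j).trans (min_le_left _ _))
  set U := S * G⁻¹ with hU
  have hUG : U * G = S := by
    rw [hU, Matrix.mul_assoc, Matrix.nonsing_inv_mul _ hGdet, Matrix.mul_one]
  have hUU : Uᴴ * U = 1 := by
    have h1 : G * (Uᴴ * U) * G = G * 1 * G := by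
      calc G * (Uᴴ * U) * G = (U * G)ᴴ * (U * G) := by
            rw [Matrix.conjTranspose_mul U G, hGH]; simp only [Matrix.mul_assoc]
        _ = G * 1 * G := by rw [hUG, ← hNS, Matrix.mul_one, hGG]
    have hGu := (Matrix.isUnit_iff_isUnit_det G).2 hGdet
    exact hGu.mul_left_cancel (hGu.mul_right_cancel h1)
  have hQ : -Real.cot (∑ i, arccot (l i)) = Q B' A := by rw [Q, phase_eq_sum hP1' hP2']
  have hmain := weighted_gradient_le (ν := ν) hUU hQ (by rwa [phase_eq_sum hP1' hP2'] at hAph)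
    (neg_Q_le hP1' hP2' hAph) hε0.le hε1 hG1 hε hτ1
    (fun i => by rw [hGH, hGG]; exact (hNe i i).trans (min_le_right _ _))
  have hA' : Gᴴ * (Uᴴ * (Matrix.diagonal fun j => (l j : ℂ)) * U) * G = Pᴴ * A * P := by
    rw [hconj, hP2', ← hUG]
    simp only [Matrix.conjTranspose_mul, Matrix.mul_assoc]
  rw [hA'] at hmain
  have hsumA : ∑ i, hermForm A (v i) = ∑ i, w i * ((Pᴴ * A * P) i i).re :=
    Finset.sum_congr rfl fun i _ => hv A i
  rw [hsumA]
  refine le_trans ?_ hmain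
  obtain ⟨x, hx⟩ : ∃ x, x = Q B' A + Real.cot θ₀ := ⟨_, rfl⟩
  have hqx : Q B' A = x - Real.cot θ₀ := by rw [hx]; ring
  rw [← hx, hqx]
  have hcos : Real.sin Θ * Real.cos Θ = Real.sin Θ ^ 2 * Real.cot Θ := by
    rw [Real.cot_eq_cos_div_sin]; field_simp
  rw [hcos]
  have e1 : -Real.sin Θ ^ 2 * (x - Real.cot θ₀) - Real.sin Θ ^ 2 * Real.cot Θ =
      d - Real.sin Θ ^ 2 * x := by rw [hd]; ring
  rw [e1]
  change _ ≤ (1 - τ) * (d - Real.sin Θ ^ 2 * x + s) - 2 * τ * |x - Real.cot θ₀| * W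
  clear_value W s d
  have e2 : Real.sin Θ ^ 2 * x ≤ |x| := by
    calc Real.sin Θ ^ 2 * x ≤ Real.sin Θ ^ 2 * |x| := by gcongr; exact le_abs_self x
      _ ≤ 1 * |x| := by gcongr; exact Real.sin_sq_le_one Θ
      _ = |x| := one_mul _
  have e3 : |x - Real.cot θ₀| ≤ |x| + |Real.cot θ₀| := abs_sub _ _
  have e4 : (1 - τ) * (d - |x| + s) ≤ (1 - τ) * (d - Real.sin Θ ^ 2 * x + s) :=
    mul_le_mul_of_nonneg_left (by linarith) (by linarith)
  have e5 : 2 * τ * |x - Real.cot θ₀| * W ≤ 2 * τ * (|x| + |Real.cot θ₀|) * W := by gcongr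
  have e6 : τ * s ≤ τ * |s| := by gcongr; exact le_abs_self s
  have e7 : 0 ≤ τ * |x| := by positivity
  have e8 : τ * |x| * W ≤ 1 * |x| * W := by gcongr
  linarith

/-! ### The Levi form -/

lemma two_le_infty : (2 : WithTop ℕ∞) ≤ ((⊤ : ℕ∞) : WithTop ℕ∞) := by
  exact WithTop.coe_le_coe.2 (le_top : (2 : ℕ∞) ≤ ⊤)

/-- The Levi form of `g` at `z` in the direction `ξ`, in terms of the second derivative. -/
def levi {n : ℕ} (g : (Fin n → ℂ) → ℝ) (ξ z : Fin n → ℂ) : ℝ :=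
  (fderiv ℝ (fderiv ℝ g) z ξ ξ +
    fderiv ℝ (fderiv ℝ g) z (Complex.I • ξ) (Complex.I • ξ)) / 4

lemma complexHessian_apply {n : ℕ} {g : (Fin n → ℂ) → ℝ} {z : Fin n → ℂ}
    (hg : ContDiffAt ℝ 2 g z) (j k : Fin n) :
    complexHessian g z j k =
      (((fderiv ℝ (fderiv ℝ g) z (Pi.single j 1) (Pi.single k 1) +
        fderiv ℝ (fderiv ℝ g) z (Pi.single j Complex.I) (Pi.single k Complex.I)) / 4 : ℝ) : ℂ) +
      Complex.I * (((fderiv ℝ (fderiv ℝ g) z (Pi.single j 1) (Pi.single k Complex.I) -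
        fderiv ℝ (fderiv ℝ g) z (Pi.single j Complex.I) (Pi.single k 1)) / 4 : ℝ) : ℂ) := by
  have hD : DifferentiableAt ℝ (fderiv ℝ g) z :=
    (hg.fderiv_right (m := 1) (by norm_num)).differentiableAt (by norm_num)
  have hev : (dzbar k fun w => (g w : ℂ)) =ᶠ[𝓝 z] fun w =>
      (((fderiv ℝ g w (Pi.single k 1) : ℝ) : ℂ) +
        Complex.I * ((fderiv ℝ g w (Pi.single k Complex.I) : ℝ) : ℂ)) / 2 := by
    filter_upwards [hg.eventually (by simp)] with w hw
    have h1 : HasFDerivAt (fun w => (g w : ℂ)) (Complex.ofRealCLM.comp (fderiv ℝ g w)) w :=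
      Complex.ofRealCLM.hasFDerivAt.comp w (hw.differentiableAt (by norm_num)).hasFDerivAt
    rw [dzbar, h1.fderiv]
    rfl
  have hu : ∀ u : Fin n → ℂ, HasFDerivAt (fun w => fderiv ℝ g w u)
      ((ContinuousLinearMap.apply ℝ ℝ u).comp (fderiv ℝ (fderiv ℝ g) z)) z := fun u =>
    (ContinuousLinearMap.apply ℝ ℝ u).hasFDerivAt.comp z hD.hasFDerivAt
  have hc : ∀ u : Fin n → ℂ, HasFDerivAt (fun w => ((fderiv ℝ g w u : ℝ) : ℂ))
      (Complex.ofRealCLM.comp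
        ((ContinuousLinearMap.apply ℝ ℝ u).comp (fderiv ℝ (fderiv ℝ g) z))) z := fun u =>
    Complex.ofRealCLM.hasFDerivAt.comp z (hu u)
  have h2 := ((hc (Pi.single k 1)).add ((hc (Pi.single k Complex.I)).const_mul Complex.I)).mul_const
    (1 / 2 : ℂ)
  have h3 : fderiv ℝ (dzbar k fun w => (g w : ℂ)) z = _ :=
    (hev.trans (Eventually.of_forall fun w => by
      simp only [div_eq_mul_inv, one_mul]; rfl)).fderiv_eq.trans h2.fderiv
  rw [complexHessian, Matrix.of_apply, dz, h3]
  have hval : ∀ u : Fin n → ℂ, (((1 / 2 : ℂ) • (Complex.ofRealCLM.comp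
        ((ContinuousLinearMap.apply ℝ ℝ (Pi.single k (1 : ℂ))).comp (fderiv ℝ (fderiv ℝ g) z)) +
        Complex.I • Complex.ofRealCLM.comp
        ((ContinuousLinearMap.apply ℝ ℝ (Pi.single k Complex.I)).comp
          (fderiv ℝ (fderiv ℝ g) z)))) : (Fin n → ℂ) →L[ℝ] ℂ) u =
      (1 / 2 : ℂ) * (((fderiv ℝ (fderiv ℝ g) z u (Pi.single k 1) : ℝ) : ℂ) +
        Complex.I * ((fderiv ℝ (fderiv ℝ g) z u (Pi.single k Complex.I) : ℝ) : ℂ)) := fun u => rfl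
  rw [hval, hval]
  push_cast
  linear_combination (-(1 / 4 : ℂ) * ((fderiv ℝ (fderiv ℝ g) z (Pi.single j Complex.I)
    (Pi.single k Complex.I) : ℝ) : ℂ)) * Complex.I_sq

lemma isHermitian_complexHessian {n : ℕ} {g : (Fin n → ℂ) → ℝ} {z : Fin n → ℂ}
    (hg : ContDiffAt ℝ 2 g z) : (complexHessian g z).IsHermitian := by
  have hs : IsSymmSndFDerivAt ℝ g z := hg.isSymmSndFDerivAt (by simp)
  ext j k
  rw [Matrix.conjTranspose_apply, complexHessian_apply hg, complexHessian_apply hg,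
    hs.eq (Pi.single k 1) (Pi.single j 1), hs.eq (Pi.single k Complex.I) (Pi.single j Complex.I),
    hs.eq (Pi.single k 1) (Pi.single j Complex.I), hs.eq (Pi.single k Complex.I) (Pi.single j 1)]
  simp only [RCLike.star_def, map_add, map_mul, Complex.conj_ofReal, Complex.conj_I]
  push_cast
  ring

lemma eq_sum_single {n : ℕ} (ξ : Fin n → ℂ) : ξ = ∑ j, ((ξ j).re • (Pi.single j 1 : Fin n → ℂ) +
    (ξ j).im • (Pi.single j Complex.I : Fin n → ℂ)) := by
  ext k
  rw [Finset.sum_apply, Finset.sum_eq_single k]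
  · simp
  · intro j _ hj
    simp [hj.symm]
  · simp

lemma bilin_apply_eq_sum {n : ℕ} (b : (Fin n → ℂ) →L[ℝ] (Fin n → ℂ) →L[ℝ] ℝ)
    (ξ : Fin n → ℂ) :
    b ξ ξ = ∑ j, ∑ k,
      ((ξ j).re * (ξ k).re * b (Pi.single j 1) (Pi.single k 1) +
      (ξ j).re * (ξ k).im * b (Pi.single j 1) (Pi.single k Complex.I) +
      (ξ j).im * (ξ k).re * b (Pi.single j Complex.I) (Pi.single k 1) +
      (ξ j).im * (ξ k).im * b (Pi.single j Complex.I) (Pi.single k Complex.I)) := by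
  conv_lhs => rw [eq_sum_single ξ]
  rw [map_sum, Finset.sum_comm]
  refine Finset.sum_congr rfl fun k _ => ?_
  rw [map_sum, sum_apply]
  refine Finset.sum_congr rfl fun j _ => ?_
  simp only [map_add, map_smul, add_apply, smul_apply,
    smul_eq_mul]
  ring

lemma hermForm_complexHessian {n : ℕ} {g : (Fin n → ℂ) → ℝ} {z : Fin n → ℂ}
    (hg : ContDiffAt ℝ 2 g z) (ξ : Fin n → ℂ) :
    hermForm (complexHessian g z) ξ = levi g ξ z := by
  rw [levi, bilin_apply_eq_sum, bilin_apply_eq_sum, hermForm, ← Finset.sum_add_distrib,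
    Finset.sum_div, Complex.re_sum]
  refine Finset.sum_congr rfl fun j _ => ?_
  rw [← Finset.sum_add_distrib, Finset.sum_div, Complex.re_sum]
  refine Finset.sum_congr rfl fun k _ => ?_
  rw [complexHessian_apply hg]
  simp only [Pi.smul_apply, smul_eq_mul, Complex.mul_re, Complex.mul_im, Complex.add_re,
    Complex.add_im, Complex.ofReal_re, Complex.ofReal_im, Complex.I_re, Complex.I_im,
    RCLike.star_def, Complex.conj_re, Complex.conj_im]
  ring

lemma continuousOn_levi {n : ℕ} {g : (Fin n → ℂ) → ℝ} {U : Set (Fin n → ℂ)} (hU : IsOpen U)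
    (hg : ContDiffOn ℝ 2 g U) (ξ : Fin n → ℂ) : ContinuousOn (levi g ξ) U := by
  have h1 : ContDiffOn ℝ 1 (fderiv ℝ g) U := hg.fderiv_of_isOpen hU (by norm_num)
  have h2 : ContinuousOn (fderiv ℝ (fderiv ℝ g)) U := h1.continuousOn_fderiv_of_isOpen hU (by norm_num)
  unfold levi
  have h3 : ∀ u : Fin n → ℂ, ContinuousOn (fun z => fderiv ℝ (fderiv ℝ g) z u u) U := fun u =>
    (h2.clm_apply continuousOn_const).clm_apply continuousOn_const
  exact ((h3 _).add (h3 _)).div_const _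

lemma tsupport_levi_subset {n : ℕ} (g : (Fin n → ℂ) → ℝ) (ξ : Fin n → ℂ) :
    tsupport (levi g ξ) ⊆ tsupport g := by
  have h : tsupport (fderiv ℝ (fderiv ℝ g)) ⊆ tsupport g :=
    (tsupport_fderiv_subset ℝ).trans (tsupport_fderiv_subset ℝ)
  refine (closure_minimal ?_ (isClosed_tsupport _)).trans h
  intro z hz
  by_contra h0
  have := image_eq_zero_of_notMem_tsupport h0
  exact hz (by simp [levi, this])

lemma IsTestFunction.continuous_levi {n : ℕ} {U : Set (Fin n → ℂ)} {η : (Fin n → ℂ) → ℝ}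
    (hη : IsTestFunction U η) (ξ : Fin n → ℂ) : Continuous (levi η ξ) := by
  rw [← continuousOn_univ]
  exact continuousOn_levi isOpen_univ (hη.1.of_le (two_le_infty)).contDiffOn ξ

lemma IsTestFunction.hasCompactSupport_levi {n : ℕ} {U : Set (Fin n → ℂ)}
    {η : (Fin n → ℂ) → ℝ} (hη : IsTestFunction U η) (ξ : Fin n → ℂ) :
    HasCompactSupport (levi η ξ) :=
  HasCompactSupport.of_support_subset_isCompact hη.2.1
    ((subset_tsupport _).trans (tsupport_levi_subset η ξ))

lemma integrable_mul_of_continuousOn {n : ℕ} {U : Set (Fin n → ℂ)} (hU : IsOpen U)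
    {f η : (Fin n → ℂ) → ℝ} (hf : ContinuousOn f U) (hη : Continuous η)
    (hc : HasCompactSupport η) (hs : tsupport η ⊆ U) :
    Integrable (fun z => f z * η z) := by
  have hsup : tsupport (fun z => f z * η z) ⊆ tsupport η := tsupport_mul_subset_right
  have : Continuous (fun z => f z * η z) :=
    (hf.mul hη.continuousOn).continuous_of_tsupport_subset hU (hsup.trans hs)
  exact this.integrable_of_hasCompactSupport hc.mul_left

/-- Two integrations by parts on the whole space. Although `f` is regular only on `U`, every
integrand carries `η` or one of its derivatives and so vanishes off a compact subset of `U`. -/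
lemma integral_mul_snd_fderiv {n : ℕ} {U : Set (Fin n → ℂ)} (hU : IsOpen U)
    {f η : (Fin n → ℂ) → ℝ} (hf : ContDiffOn ℝ 2 f U) (hη : IsTestFunction U η)
    (u : Fin n → ℂ) :
    Integrable (fun z => f z * fderiv ℝ (fderiv ℝ η) z u u) ∧
    Integrable (fun z => fderiv ℝ (fderiv ℝ f) z u u * η z) ∧
    ∫ z, f z * fderiv ℝ (fderiv ℝ η) z u u = ∫ z, fderiv ℝ (fderiv ℝ f) z u u * η z := by
  have hη2 : ContDiff ℝ 2 η := hη.1.of_le (two_le_infty)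
  have hη' : ContDiff ℝ 1 (fderiv ℝ η) := hη2.fderiv_right (by norm_num)
  have hη'' : Continuous (fderiv ℝ (fderiv ℝ η)) := hη'.continuous_fderiv (by norm_num)
  have hf' : ContDiffOn ℝ 1 (fderiv ℝ f) U := hf.fderiv_of_isOpen hU (by norm_num)
  have hf'' : ContinuousOn (fderiv ℝ (fderiv ℝ f)) U :=
    hf'.continuousOn_fderiv_of_isOpen hU (by norm_num)
  have s1 : tsupport (fun z => fderiv ℝ η z u) ⊆ tsupport η := tsupport_fderiv_apply_subset ℝ u
  have c1 : HasCompactSupport (fun z => fderiv ℝ η z u) := hη.2.1.fderiv_apply ℝ u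
  have e1 : ∀ z, fderiv ℝ (fun y => fderiv ℝ η y u) z u = fderiv ℝ (fderiv ℝ η) z u u := by
    intro z
    have h := ((ContinuousLinearMap.apply ℝ ℝ u).hasFDerivAt.comp z
      (hη'.differentiable (by norm_num) z).hasFDerivAt).fderiv
    have h' : fderiv ℝ (fun y => fderiv ℝ η y u) z = _ := h
    rw [h']; rfl
  have e2 : ∀ z ∈ U, fderiv ℝ (fun y => fderiv ℝ f y u) z u = fderiv ℝ (fderiv ℝ f) z u u := by
    intro z hz
    have h := ((ContinuousLinearMap.apply ℝ ℝ u).hasFDerivAt.comp z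
      ((hf'.differentiableOn (by norm_num)).differentiableAt (hU.mem_nhds hz)).hasFDerivAt).fderiv
    have h' : fderiv ℝ (fun y => fderiv ℝ f y u) z = _ := h
    rw [h']; rfl
  have s2 : tsupport (fun z => fderiv ℝ (fderiv ℝ η) z u u) ⊆ tsupport η := by
    simp_rw [← e1]
    exact (tsupport_fderiv_apply_subset ℝ u).trans s1
  have c2 : HasCompactSupport (fun z => fderiv ℝ (fderiv ℝ η) z u u) := by
    simp_rw [← e1]
    exact c1.fderiv_apply ℝ u
  have k1 : Continuous (fun z => fderiv ℝ η z u) := hη'.continuous.clm_apply continuous_const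
  have k2 : Continuous (fun z => fderiv ℝ (fderiv ℝ η) z u u) :=
    (hη''.clm_apply continuous_const).clm_apply continuous_const
  have kf1 : ContinuousOn (fun z => fderiv ℝ f z u) U :=
    hf'.continuousOn.clm_apply continuousOn_const
  have kf2 : ContinuousOn (fun z => fderiv ℝ (fderiv ℝ f) z u u) U :=
    (hf''.clm_apply continuousOn_const).clm_apply continuousOn_const
  have i1 := integrable_mul_of_continuousOn hU hf.continuousOn k2 c2 (s2.trans hη.2.2)
  have i2 := integrable_mul_of_continuousOn hU kf2 hη.1.continuous hη.2.1 hη.2.2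
  have i3 := integrable_mul_of_continuousOn hU kf1 k1 c1 (s1.trans hη.2.2)
  have i4 := integrable_mul_of_continuousOn hU hf.continuousOn k1 c1 (s1.trans hη.2.2)
  have i5 := integrable_mul_of_continuousOn hU kf1 hη.1.continuous hη.2.1 hη.2.2
  have key : ∀ z, fderiv ℝ (fun y => fderiv ℝ f y u) z u * η z =
      fderiv ℝ (fderiv ℝ f) z u u * η z := by
    intro z
    by_cases hz : z ∈ U
    · rw [e2 z hz]
    · rw [image_eq_zero_of_notMem_tsupport fun h => hz (hη.2.2 h), mul_zero, mul_zero]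
  refine ⟨i1, i2, ?_⟩
  have p1 := integral_mul_fderiv_eq_neg_fderiv_mul_of_integrable (μ := volume) (𝕜 := ℝ)
    (f := f) (g := fun z => fderiv ℝ η z u) (v := u) i3 (by simpa only [e1] using i1) i4
    (fun z hz => (hf.contDiffAt (hU.mem_nhds (hη.2.2 (s1 hz)))).differentiableAt (by norm_num))
    (fun z _ => (hη'.differentiable (by norm_num) z).clm_apply (differentiableAt_const _))
  have p2 := integral_mul_fderiv_eq_neg_fderiv_mul_of_integrable (μ := volume) (𝕜 := ℝ)
    (f := fun z => fderiv ℝ f z u) (g := η) (v := u) (by simpa only [key] using i2) i3 i5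
    (fun z hz => ((hf'.differentiableOn (by norm_num)).differentiableAt
      (hU.mem_nhds (hη.2.2 hz))).clm_apply (differentiableAt_const _))
    (fun z _ => hη2.differentiable (by norm_num) z)
  simp only [e1] at p1
  simp only [key] at p2
  rw [p1, p2, neg_neg]

/-- Integration by parts for the Levi form. -/
lemma integral_mul_levi {n : ℕ} {U : Set (Fin n → ℂ)} (hU : IsOpen U)
    {f η : (Fin n → ℂ) → ℝ} (hf : ContDiffOn ℝ 2 f U) (hη : IsTestFunction U η)
    (ξ : Fin n → ℂ) :
    ∫ z in U, f z * levi η ξ z = ∫ z in U, levi f ξ z * η z := by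
  obtain ⟨a1, a2, a3⟩ := integral_mul_snd_fderiv hU hf hη ξ
  obtain ⟨b1, b2, b3⟩ := integral_mul_snd_fderiv hU hf hη (Complex.I • ξ)
  rw [setIntegral_eq_integral_of_forall_compl_eq_zero, setIntegral_eq_integral_of_forall_compl_eq_zero]
  · have e1 : ∀ z, f z * levi η ξ z = (f z * fderiv ℝ (fderiv ℝ η) z ξ ξ +
        f z * fderiv ℝ (fderiv ℝ η) z (Complex.I • ξ) (Complex.I • ξ)) / 4 := fun z => by
      rw [levi]; ring
    have e2 : ∀ z, levi f ξ z * η z = (fderiv ℝ (fderiv ℝ f) z ξ ξ * η z +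
        fderiv ℝ (fderiv ℝ f) z (Complex.I • ξ) (Complex.I • ξ) * η z) / 4 := fun z => by
      rw [levi]; ring
    simp only [e1, e2, integral_div]
    rw [integral_add a1 b1, integral_add a2 b2, a3, b3]
  · intro z hz
    rw [image_eq_zero_of_notMem_tsupport fun h => hz (hη.2.2 h), mul_zero]
  · intro z hz
    rw [image_eq_zero_of_notMem_tsupport fun h => hz (hη.2.2 (tsupport_levi_subset _ _ h)), mul_zero]

/-! ### Passage to holomorphic charts -/

section Charts

variable {n : ℕ} {X : Type*} [TopologicalSpace X] [ChartedSpace (Fin n → ℂ) X]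

lemma contDiffAt_chartTransition [IsManifold 𝓘(ℂ, Fin n → ℂ) (⊤ : ℕ∞) X]
    {e : OpenPartialHomeomorph X (Fin n → ℂ)} (he : e ∈ holCharts n X) {z : Fin n → ℂ}
    (hz : z ∈ e.target) :
    ContDiffAt ℂ (⊤ : ℕ∞) (fun w => chartAt (Fin n → ℂ) (e.symm z) (e.symm w)) z := by
  have h1 : ContMDiffAt 𝓘(ℂ, Fin n → ℂ) 𝓘(ℂ, Fin n → ℂ) (⊤ : ℕ∞) e.symm z :=
    (contMDiffOn_symm_of_mem_maximalAtlas he).contMDiffAt (e.open_target.mem_nhds hz)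
  have h2 : ContMDiffAt 𝓘(ℂ, Fin n → ℂ) 𝓘(ℂ, Fin n → ℂ) (⊤ : ℕ∞)
      (chartAt (Fin n → ℂ) (e.symm z)) (e.symm z) :=
    contMDiffAt_of_mem_maximalAtlas (IsManifold.chart_mem_maximalAtlas _)
      (mem_chart_source _ _)
  exact contMDiffAt_iff_contDiffAt.1 (h2.comp z h1)

/-- Smoothness of `ψ` over `ℝ` is read off in the preferred charts, and the transition from `e` to
these is holomorphic, hence smooth over `ℝ`. -/
lemma contDiffOn_comp_symm [IsManifold 𝓘(ℂ, Fin n → ℂ) (⊤ : ℕ∞) X]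
    {e : OpenPartialHomeomorph X (Fin n → ℂ)} (he : e ∈ holCharts n X) {ψ : X → ℝ}
    (hψ : ContMDiff 𝓘(ℝ, Fin n → ℂ) 𝓘(ℝ, ℝ) (⊤ : ℕ∞) ψ) :
    ContDiffOn ℝ 2 (fun w => ψ (e.symm w)) e.target := by
  intro z hz
  set c := chartAt (Fin n → ℂ) (e.symm z) with hc
  have h1 : ContDiffAt ℝ 2 (fun w => c (e.symm w)) z :=
    ((contDiffAt_chartTransition he hz).restrict_scalars ℝ).of_le two_le_infty
  have h2 : ContDiffAt ℝ 2 (fun w => ψ (c.symm w)) (c (e.symm z)) := by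
    have := (contMDiffAt_iff.1 (hψ (e.symm z))).2
    simp only [mfld_simps, contDiffWithinAt_univ] at this
    exact this.of_le two_le_infty
  have h3 : ContDiffAt ℝ 2 (fun w => ψ (c.symm (c (e.symm w)))) z :=
    ContDiffAt.comp (g := fun w => ψ (c.symm w)) z h2 h1
  refine (h3.congr_of_eventuallyEq ?_).contDiffWithinAt
  have : e.symm ⁻¹' c.source ∈ 𝓝 z :=
    (e.continuousAt_symm hz).preimage_mem_nhds (c.open_source.mem_nhds (mem_chart_source _ _))
  filter_upwards [this] with w hw
  rw [c.left_inv hw]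

lemma form_eq_conj {ω : ClosedRealForm11 n X} {e e' : OpenPartialHomeomorph X (Fin n → ℂ)}
    (he : e ∈ holCharts n X) (he' : e' ∈ holCharts n X) {z : Fin n → ℂ}
    (hz : z ∈ e.target) (hz' : e.symm z ∈ e'.source) :
    ω.coeff e z = ((jacobian (e.symm.trans e') z).map star)ᴴ * ω.coeff e' (e' (e.symm z)) *
      (jacobian (e.symm.trans e') z).map star := by
  have h : z ∈ (e.symm.trans e').source := by
    simp [hz, hz']
  rw [ω.transform e he e' he' z h]
  congr 2
  ext a b
  simp [Matrix.conjTranspose_apply]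

lemma formPhase_symm_apply [IsManifold 𝓘(ℂ, Fin n → ℂ) (⊤ : ℕ∞) X]
    {ω : ClosedRealForm11 n X} (hω : IsKahler ω) (α : ClosedRealForm11 n X)
    {e : OpenPartialHomeomorph X (Fin n → ℂ)}
    (he : e ∈ holCharts n X) {z : Fin n → ℂ} (hz : z ∈ e.target) :
    formPhase ω α (e.symm z) = phase (ω.coeff e z) (α.coeff e z) := by
  set c := chartAt (Fin n → ℂ) (e.symm z) with hc
  have hcm : c ∈ holCharts n X := IsManifold.chart_mem_maximalAtlas _
  have hz' : e.symm z ∈ c.source := mem_chart_source _ _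
  have h1 := form_eq_conj (ω := ω) he hcm hz hz'
  have h2 := form_eq_conj (ω := α) he hcm hz hz'
  set R := (jacobian (e.symm.trans c) z).map star with hR
  have ht := c.map_source hz'
  have hdet : IsUnit R.det := by
    have h3 := (Matrix.isUnit_iff_isUnit_det _).1 (hω e he z hz).isUnit
    rw [h1, Matrix.det_mul] at h3
    exact isUnit_of_mul_isUnit_right h3
  rw [h1, h2, phase_conj (hω c hcm _ ht) (α.hermitian c hcm _ ht) hdet]
  rfl

lemma formQ_symm_apply [IsManifold 𝓘(ℂ, Fin n → ℂ) (⊤ : ℕ∞) X]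
    {ω : ClosedRealForm11 n X} (hω : IsKahler ω) (α : ClosedRealForm11 n X)
    {e : OpenPartialHomeomorph X (Fin n → ℂ)}
    (he : e ∈ holCharts n X) {z : Fin n → ℂ} (hz : z ∈ e.target) :
    formQ ω α (e.symm z) = Q (ω.coeff e z) (α.coeff e z) := by
  rw [Q, ← formPhase_symm_apply hω α he hz]
  rfl

lemma continuousOn_coeff (ω : ClosedRealForm11 n X) {e : OpenPartialHomeomorph X (Fin n → ℂ)}
    (he : e ∈ holCharts n X) : ContinuousOn (ω.coeff e) e.target :=
  continuousOn_pi.2 fun j => continuousOn_pi.2 fun k => (ω.smooth e he j k).continuousOn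

lemma continuousOn_det_coeff (ω : ClosedRealForm11 n X)
    {e : OpenPartialHomeomorph X (Fin n → ℂ)} (he : e ∈ holCharts n X) :
    ContinuousOn (fun z => (ω.coeff e z).det.re) e.target :=
  Complex.continuous_re.comp_continuousOn
    (continuous_id.matrix_det.comp_continuousOn (continuousOn_coeff ω he))

/-- The phase is defined through roots of a polynomial, but `Q_eq_det` writes `Q` as a quotient of
continuous functions. -/
lemma measurable_Q_coeff {ω : ClosedRealForm11 n X} (hω : IsKahler ω) (α : ClosedRealForm11 n X)
    {e : OpenPartialHomeomorph X (Fin n → ℂ)} (he : e ∈ holCharts n X) :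
    AEMeasurable (fun z => Q (ω.coeff e z) (α.coeff e z)) (volume.restrict e.target) := by
  have h1 : ContinuousOn (fun z => (α.coeff e z + Complex.I • ω.coeff e z).det) e.target :=
    continuous_id.matrix_det.comp_continuousOn
      ((continuousOn_coeff α he).add ((continuousOn_coeff ω he).fun_const_smul Complex.I))
  have h2 := (Complex.continuous_re.comp_continuousOn h1).aemeasurable (μ := volume)
    e.open_target.measurableSet
  have h3 := (Complex.continuous_im.comp_continuousOn h1).aemeasurable (μ := volume)
    e.open_target.measurableSet
  refine (h2.div h3).neg.congr ?_
  filter_upwards [ae_restrict_mem e.open_target.measurableSet] with z hz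
  exact (Q_eq_det (hω e he z hz) (α.hermitian e he z hz)).symm

/-- The density of the volume form in a chart. -/
def chartDensity (ω : ClosedRealForm11 n X) (e : OpenPartialHomeomorph X (Fin n → ℂ)) :
    Measure (Fin n → ℂ) :=
  (volume.restrict e.target).withDensity fun z => ENNReal.ofReal (2 ^ n * (ω.coeff e z).det.re)

lemma chartDensity_absolutelyContinuous (ω : ClosedRealForm11 n X)
    (e : OpenPartialHomeomorph X (Fin n → ℂ)) : chartDensity ω e ≪ volume.restrict e.target :=
  withDensity_absolutelyContinuous _ _

/-- The determinant of the metric is continuous and positive, hence bounded below on a compact set.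
-/
lemma restrict_le_chartDensity {ω : ClosedRealForm11 n X} (hω : IsKahler ω)
    {e : OpenPartialHomeomorph X (Fin n → ℂ)} (he : e ∈ holCharts n X) {K : Set (Fin n → ℂ)}
    (hK : IsCompact K) (hKe : K ⊆ e.target) :
    ∃ C : ENNReal, C ≠ ⊤ ∧ volume.restrict K ≤ C • chartDensity ω e := by
  have hpos : ∀ z ∈ K, 0 < 2 ^ n * (ω.coeff e z).det.re := fun z hz =>
    mul_pos (by positivity) (Complex.lt_def.1 (hω e he z (hKe hz)).det_pos).1
  have hcont : ContinuousOn (fun z => 2 ^ n * (ω.coeff e z).det.re) K :=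
    continuousOn_const.mul ((continuousOn_det_coeff ω he).mono hKe)
  obtain ⟨c, hc0, hc⟩ : ∃ c > 0, ∀ z ∈ K, c ≤ 2 ^ n * (ω.coeff e z).det.re := by
    rcases K.eq_empty_or_nonempty with rfl | hne
    · exact ⟨1, one_pos, by simp⟩
    · obtain ⟨z, hz, hmin⟩ := hK.exists_isMinOn hne hcont
      exact ⟨_, hpos z hz, fun y hy => hmin hy⟩
  have hc' : ENNReal.ofReal c ≠ 0 := (ENNReal.ofReal_pos.2 hc0).ne'
  refine ⟨(ENNReal.ofReal c)⁻¹, ENNReal.inv_ne_top.2 hc', Measure.le_iff.2 fun s hs => ?_⟩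
  rw [Measure.smul_apply, smul_eq_mul, chartDensity, withDensity_apply _ hs,
    Measure.restrict_restrict hs, Measure.restrict_apply hs, mul_comm,
    ← div_eq_mul_inv, ENNReal.le_div_iff_mul_le (Or.inl hc') (Or.inl ENNReal.ofReal_ne_top)]
  have hm : MeasurableSet (s ∩ K) := hs.inter hK.measurableSet
  calc volume (s ∩ K) * ENNReal.ofReal c = ∫⁻ _ in s ∩ K, ENNReal.ofReal c := by
        rw [setLIntegral_const, mul_comm]
    _ ≤ ∫⁻ z in s ∩ K, ENNReal.ofReal (2 ^ n * (ω.coeff e z).det.re) :=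
        setLIntegral_mono' hm fun z hz => ENNReal.ofReal_le_ofReal (hc z hz.2)
    _ ≤ _ := lintegral_mono_set (inter_subset_inter_right s hKe)

lemma chartVolume_le_kahlerVolume [MeasurableSpace X] (ω : ClosedRealForm11 n X)
    {e : OpenPartialHomeomorph X (Fin n → ℂ)} (he : e ∈ holCharts n X) :
    (chartDensity ω e).map e.symm ≤ kahlerVolume ω :=
  le_iSup₂ (f := fun e (_ : e ∈ holCharts n X) => chartVolume ω e) e he

lemma aemeasurable_symm [MeasurableSpace X] [BorelSpace X] (ω : ClosedRealForm11 n X)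
    (e : OpenPartialHomeomorph X (Fin n → ℂ)) : AEMeasurable e.symm (chartDensity ω e) :=
  (e.continuousOn_symm.aemeasurable e.open_target.measurableSet).mono_ac
    (chartDensity_absolutelyContinuous ω e)

lemma ae_mem_source [MeasurableSpace X] [BorelSpace X] (ω : ClosedRealForm11 n X)
    (e : OpenPartialHomeomorph X (Fin n → ℂ)) :
    ∀ᵐ x ∂(chartDensity ω e).map e.symm, x ∈ e.source := by
  refine (ae_map_iff (p := fun x => x ∈ e.source) (aemeasurable_symm ω e)
    (by simpa using e.open_source.measurableSet)).2 ?_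
  filter_upwards [(chartDensity_absolutelyContinuous ω e).ae_le
    (ae_restrict_mem e.open_target.measurableSet)] with z hz
  exact e.map_target hz

/-- The pushed-forward measure lives on the source of `e`, where `e` and its inverse match it with
the chart density. Measurability can thus be checked in the chart. -/
lemma aestronglyMeasurable_of_comp_symm [MeasurableSpace X] [BorelSpace X]
    (ω : ClosedRealForm11 n X) (e : OpenPartialHomeomorph X (Fin n → ℂ)) {f : X → ℝ}
    (hf : AEMeasurable (fun z => f (e.symm z)) (volume.restrict e.target)) :
    AEStronglyMeasurable f ((chartDensity ω e).map e.symm) := by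
  set ν := (chartDensity ω e).map e.symm with hν
  have hs := ae_mem_source ω e
  have he : AEMeasurable e ν := by
    have := e.continuousOn.aemeasurable (μ := ν) e.open_source.measurableSet
    rwa [Measure.restrict_eq_self_of_ae_mem hs] at this
  have hmap : ν.map e = chartDensity ω e := by
    rw [hν, AEMeasurable.map_map_of_aemeasurable he (aemeasurable_symm ω e)]
    have : (e ∘ e.symm) =ᵐ[chartDensity ω e] id := by
      filter_upwards [(chartDensity_absolutelyContinuous ω e).ae_le
        (ae_restrict_mem e.open_target.measurableSet)] with z hz
      exact e.right_inv hz
    rw [Measure.map_congr this, Measure.map_id]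
  have h1 : AEStronglyMeasurable (fun z => f (e.symm z)) (ν.map e) := by
    rw [hmap]
    exact (hf.mono_ac (chartDensity_absolutelyContinuous ω e)).aestronglyMeasurable
  refine (h1.comp_aemeasurable he).congr ?_
  filter_upwards [hs] with x hx
  simp [e.left_inv hx]

lemma eLpNorm_comp_symm_le [MeasurableSpace X] [BorelSpace X] {ω : ClosedRealForm11 n X}
    (hω : IsKahler ω) {e : OpenPartialHomeomorph X (Fin n → ℂ)} (he : e ∈ holCharts n X)
    {K : Set (Fin n → ℂ)} (hK : IsCompact K) (hKe : K ⊆ e.target) (p : ENNReal) (hp : p ≠ ⊤) :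
    ∃ C : ENNReal, C ≠ ⊤ ∧ ∀ f : X → ℝ,
      AEMeasurable (fun z => f (e.symm z)) (volume.restrict e.target) →
      eLpNorm (fun z => f (e.symm z)) p (volume.restrict K) ≤
        C * eLpNorm f p (kahlerVolume ω) := by
  obtain ⟨C, hC, hle⟩ := restrict_le_chartDensity hω he hK hKe
  refine ⟨C ^ (1 / p).toReal, ENNReal.rpow_ne_top_of_nonneg ENNReal.toReal_nonneg hC,
    fun f hf => ?_⟩
  refine (eLpNorm_mono_measure _ hle).trans ?_
  rw [eLpNorm_smul_measure_of_ne_top hp, smul_eq_mul]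
  gcongr
  have := eLpNorm_map_measure (p := p) (aestronglyMeasurable_of_comp_symm ω e hf)
    (aemeasurable_symm ω e)
  calc _ = eLpNorm f p ((chartDensity ω e).map e.symm) := this.symm
    _ ≤ _ := eLpNorm_mono_measure _ (chartVolume_le_kahlerVolume ω he)

/-- `L^p` convergence on the manifold gives `L¹` convergence on compact subsets of a chart. -/
lemma tendsto_eLpNorm_one_comp_symm [MeasurableSpace X] [BorelSpace X]
    {ω : ClosedRealForm11 n X} (hω : IsKahler ω) {e : OpenPartialHomeomorph X (Fin n → ℂ)}
    (he : e ∈ holCharts n X) {K : Set (Fin n → ℂ)} (hK : IsCompact K) (hKe : K ⊆ e.target)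
    {p : ENNReal} (hp1 : 1 ≤ p) (hp : p ≠ ⊤) {f : ℕ → X → ℝ}
    (hf : ∀ k, AEMeasurable (fun z => f k (e.symm z)) (volume.restrict e.target))
    (hlim : Tendsto (fun k => eLpNorm (f k) p (kahlerVolume ω)) atTop (𝓝 0)) :
    Tendsto (fun k => eLpNorm (fun z => f k (e.symm z)) 1 (volume.restrict K)) atTop (𝓝 0) := by
  obtain ⟨C, hC, hle⟩ := eLpNorm_comp_symm_le hω he hK hKe p hp
  set D : ENNReal := volume.restrict K univ ^ (1 / (1 : ENNReal).toReal - 1 / p.toReal) with hD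
  have hKfin : volume.restrict K univ ≠ ⊤ := by
    rw [Measure.restrict_apply_univ]; exact hK.measure_lt_top.ne
  have hexp : 0 ≤ 1 / (1 : ENNReal).toReal - 1 / p.toReal := by
    have : 1 ≤ p.toReal := by
      rw [← ENNReal.toReal_one]; exact ENNReal.toReal_mono hp hp1
    rw [ENNReal.toReal_one, div_one, sub_nonneg, div_le_one (by linarith)]
    exact this
  have hDtop : D ≠ ⊤ := ENNReal.rpow_ne_top_of_nonneg hexp hKfin
  have hb : ∀ k, eLpNorm (fun z => f k (e.symm z)) 1 (volume.restrict K) ≤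
      C * D * eLpNorm (f k) p (kahlerVolume ω) := by
    intro k
    have hm : AEStronglyMeasurable (fun z => f k (e.symm z)) (volume.restrict K) :=
      ((hf k).mono_measure (Measure.restrict_mono hKe le_rfl)).aestronglyMeasurable
    calc _ ≤ eLpNorm (fun z => f k (e.symm z)) p (volume.restrict K) * D :=
          eLpNorm_le_eLpNorm_mul_rpow_measure_univ hp1 hm
      _ ≤ C * eLpNorm (f k) p (kahlerVolume ω) * D := by gcongr; exact hle _ (hf k)
      _ = _ := by ring
  have hlim' : Tendsto (fun k => C * D * eLpNorm (f k) p (kahlerVolume ω)) atTop (𝓝 0) := by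
    have := ENNReal.Tendsto.const_mul hlim (Or.inr (ENNReal.mul_ne_top hC hDtop))
    rwa [mul_zero] at this
  exact tendsto_of_tendsto_of_tendsto_of_le_of_le tendsto_const_nhds hlim' (fun _ => zero_le) hb

end Charts

/-! ### Integrals against test functions -/

lemma integrable_mul_of_integrableOn {n : ℕ} {R : Type*} [NormedRing R]
    {f g : (Fin n → ℂ) → R} {K : Set (Fin n → ℂ)} (hK : IsCompact K) (hf : IntegrableOn f K)
    (hg : ContinuousOn g K) (hgK : ∀ z ∉ K, g z = 0) : Integrable (fun z => f z * g z) :=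
  (integrableOn_iff_integrable_of_support_subset (s := K) (by
    intro z hz
    by_contra h
    exact hz (by simp [hgK z h]))).1 (hf.mul_continuousOn hg hK)

/-- The factor `g` is bounded on `K` and vanishes elsewhere. The bound by the lower integral of the
norm needs no integrability of `h k`, as the Bochner integral defaults to `0`. -/
lemma tendsto_integral_mul_zero {n : ℕ} {U K : Set (Fin n → ℂ)} (hU : MeasurableSet U)
    (hK : IsCompact K) (hKU : K ⊆ U) {h : ℕ → (Fin n → ℂ) → ℝ} {g : (Fin n → ℂ) → ℝ} (hg : ContinuousOn g K)
    (hgK : ∀ z ∉ K, g z = 0)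
    (hlim : Tendsto (fun k => eLpNorm (h k) 1 (volume.restrict K)) atTop (𝓝 0)) :
    Tendsto (fun k => ∫ z in U, h k z * g z) atTop (𝓝 0) := by
  obtain ⟨M, hM⟩ := hK.exists_bound_of_continuousOn hg
  have hb : ∀ k, ‖∫ z in U, h k z * g z‖ₑ ≤
      ENNReal.ofReal M * eLpNorm (h k) 1 (volume.restrict K) := by
    intro k
    have e : ∫ z in U, h k z * g z = ∫ z in K, h k z * g z := by
      exact setIntegral_eq_of_subset_of_forall_sdiff_eq_zero hU hKU fun z hz => by
        rw [hgK z hz.2, mul_zero]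
    rw [e]
    refine (enorm_integral_le_lintegral_enorm _).trans ?_
    rw [eLpNorm_one_eq_lintegral_enorm, ← lintegral_const_mul' _ _ ENNReal.ofReal_ne_top]
    refine setLIntegral_mono' hK.measurableSet fun z hz => ?_
    rw [enorm_mul, mul_comm]
    gcongr
    rw [← ofReal_norm]
    exact ENNReal.ofReal_le_ofReal (hM z hz)
  have hlim' : Tendsto (fun k => ENNReal.ofReal M * eLpNorm (h k) 1 (volume.restrict K)) atTop
      (𝓝 0) := by
    have := ENNReal.Tendsto.const_mul hlim (Or.inr (ENNReal.ofReal_ne_top (r := M)))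
    rwa [mul_zero] at this
  rw [tendsto_zero_iff_enorm_tendsto_zero]
  exact tendsto_of_tendsto_of_tendsto_of_le_of_le tendsto_const_nhds hlim' (fun _ => zero_le) hb

lemma continuous_complexHessian_apply {n : ℕ} {η : (Fin n → ℂ) → ℝ} (hη : ContDiff ℝ 2 η)
    (j k : Fin n) : Continuous fun z => complexHessian η z j k := by
  have h : Continuous (fderiv ℝ (fderiv ℝ η)) :=
    (hη.fderiv_right (m := 1) (by norm_num)).continuous_fderiv (by norm_num)
  have h2 : ∀ u v : Fin n → ℂ, Continuous fun z => fderiv ℝ (fderiv ℝ η) z u v := fun u v =>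
    (h.clm_apply continuous_const).clm_apply continuous_const
  simp_rw [fun z => complexHessian_apply (hη.contDiffAt (x := z)) j k]
  exact (Complex.continuous_ofReal.comp (((h2 _ _).add (h2 _ _)).div_const _)).add
    (continuous_const.mul (Complex.continuous_ofReal.comp (((h2 _ _).sub (h2 _ _)).div_const _)))

lemma complexHessian_apply_eq_zero {n : ℕ} {η : (Fin n → ℂ) → ℝ} (hη : ContDiff ℝ 2 η)
    (j k : Fin n) {z : Fin n → ℂ} (hz : z ∉ tsupport η) : complexHessian η z j k = 0 := by
  have h : tsupport (fderiv ℝ (fderiv ℝ η)) ⊆ tsupport η :=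
    (tsupport_fderiv_subset ℝ).trans (tsupport_fderiv_subset ℝ)
  have h0 := image_eq_zero_of_notMem_tsupport fun hz' => hz (h hz')
  rw [complexHessian_apply hη.contDiffAt, h0]
  simp

lemma IsTestFunction.contDiff_two {n : ℕ} {U : Set (Fin n → ℂ)} {η : (Fin n → ℂ) → ℝ}
    (hη : IsTestFunction U η) : ContDiff ℝ 2 η := hη.1.of_le two_le_infty

lemma IsTestFunction.eq_zero {n : ℕ} {U : Set (Fin n → ℂ)} {η : (Fin n → ℂ) → ℝ}
    (_hη : IsTestFunction U η) {z : Fin n → ℂ} (hz : z ∉ tsupport η) : η z = 0 :=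
  image_eq_zero_of_notMem_tsupport hz

lemma IsTestFunction.levi_eq_zero {n : ℕ} {U : Set (Fin n → ℂ)} {η : (Fin n → ℂ) → ℝ}
    (_hη : IsTestFunction U η) (ξ : Fin n → ℂ) {z : Fin n → ℂ} (hz : z ∉ tsupport η) :
    levi η ξ z = 0 :=
  image_eq_zero_of_notMem_tsupport fun h => hz (tsupport_levi_subset _ _ h)

lemma re_sum_integral {n : ℕ} {U : Set (Fin n → ℂ)} {f : Fin n → Fin n → (Fin n → ℂ) → ℂ}
    (hf : ∀ j k, IntegrableOn (f j k) U) (ξ : Fin n → ℂ) :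
    (∑ j, ∑ k, (∫ z in U, f j k z) * ξ j * star (ξ k)).re =
      ∫ z in U, (∑ j, ∑ k, f j k z * ξ j * star (ξ k)).re := by
  have h1 : ∀ j k, IntegrableOn (fun z => f j k z * ξ j * star (ξ k)) U := fun j k =>
    ((hf j k).mul_const _).mul_const _
  have h2 : ∀ j, IntegrableOn (fun z => ∑ k, f j k z * ξ j * star (ξ k)) U := fun j =>
    integrable_finsetSum _ fun k _ => h1 j k
  have h3 : IntegrableOn (fun z => ∑ j, ∑ k, f j k z * ξ j * star (ξ k)) U :=
    integrable_finsetSum _ fun j _ => h2 j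
  have h4 := Complex.reCLM.integral_comp_comm h3
  simp only [Complex.reCLM_apply] at h4
  rw [h4, integral_finsetSum _ fun j _ => h2 j]
  congr 1
  refine Finset.sum_congr rfl fun j _ => ?_
  rw [integral_finsetSum _ fun k _ => h1 j k]
  refine Finset.sum_congr rfl fun k _ => ?_
  rw [integral_mul_const, integral_mul_const]

/-! ### Currents in a chart, tested in a fixed direction -/

section Currents

variable {n : ℕ} {X : Type*} [TopologicalSpace X] [ChartedSpace (Fin n → ℂ) X]

lemma continuousOn_hermForm_coeff (ω : ClosedRealForm11 n X)
    {e : OpenPartialHomeomorph X (Fin n → ℂ)} (he : e ∈ holCharts n X) (ξ : Fin n → ℂ) :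
    ContinuousOn (fun z => hermForm (ω.coeff e z) ξ) e.target := by
  refine Complex.continuous_re.comp_continuousOn ?_
  refine continuousOn_finsetSum _ fun j _ => continuousOn_finsetSum _ fun k _ => ?_
  exact ((ω.smooth e he j k).continuousOn.mul continuousOn_const).mul continuousOn_const

lemma integrableOn_coeff_mul (ω : ClosedRealForm11 n X)
    {e : OpenPartialHomeomorph X (Fin n → ℂ)} (he : e ∈ holCharts n X) {η : (Fin n → ℂ) → ℝ}
    (hη : IsTestFunction e.target η) (j k : Fin n) :
    Integrable (fun z => ω.coeff e z j k * (η z : ℂ)) :=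
  integrable_mul_of_integrableOn hη.2.1
    (((ω.smooth e he j k).continuousOn.mono hη.2.2).integrableOn_compact hη.2.1)
    (Complex.continuous_ofReal.comp hη.1.continuous).continuousOn
    (fun z hz => by rw [hη.eq_zero hz]; rfl)

lemma integrable_hermForm_coeff_mul (ω : ClosedRealForm11 n X)
    {e : OpenPartialHomeomorph X (Fin n → ℂ)} (he : e ∈ holCharts n X) {η : (Fin n → ℂ) → ℝ}
    (hη : IsTestFunction e.target η) (ξ : Fin n → ℂ) :
    Integrable (fun z => hermForm (ω.coeff e z) ξ * η z) :=
  integrable_mul_of_continuousOn e.open_target (continuousOn_hermForm_coeff ω he ξ)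
    hη.1.continuous hη.2.1 hη.2.2

/-- The current `α + √-1 ∂∂̄ ψ` in the direction `ξ`, evaluated at a test function. -/
def currentForm (α : ClosedRealForm11 n X) (ψ : X → ℝ)
    (e : OpenPartialHomeomorph X (Fin n → ℂ)) (ξ : Fin n → ℂ) (η : (Fin n → ℂ) → ℝ) : ℝ :=
  ∫ z in e.target, (hermForm (α.coeff e z) ξ * η z + ψ (e.symm z) * levi η ξ z)

lemma re_sum_ofReal_mul_complexHessian {η : (Fin n → ℂ) → ℝ} (hη : ContDiff ℝ 2 η)
    (c : ℝ) (z ξ : Fin n → ℂ) :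
    (∑ j, ∑ k, (c : ℂ) * complexHessian η z j k * ξ j * star (ξ k)).re = c * levi η ξ z := by
  rw [← hermForm_complexHessian hη.contDiffAt, ← hermForm_smul]
  rfl

lemma re_sum_currentCoeff (α : ClosedRealForm11 n X) {ψ : X → ℝ}
    {e : OpenPartialHomeomorph X (Fin n → ℂ)} (he : e ∈ holCharts n X) {η : (Fin n → ℂ) → ℝ}
    (hη : IsTestFunction e.target η)
    (hψ : IntegrableOn (fun z => ψ (e.symm z)) (tsupport η)) (ξ : Fin n → ℂ) :
    (∑ j, ∑ k, currentCoeff α ψ e j k η * ξ j * star (ξ k)).re = currentForm α ψ e ξ η := by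
  have hH : ∀ j k, Integrable (fun z => (ψ (e.symm z) : ℂ) * complexHessian η z j k) := fun j k =>
    integrable_mul_of_integrableOn hη.2.1 hψ.ofReal
      (continuous_complexHessian_apply hη.contDiff_two j k).continuousOn
      (fun z hz => complexHessian_apply_eq_zero hη.contDiff_two j k hz)
  have := re_sum_integral (U := e.target)
    (f := fun j k z => α.coeff e z j k * (η z : ℂ) + (ψ (e.symm z) : ℂ) * complexHessian η z j k)
    (fun j k => ((integrableOn_coeff_mul α he hη j k).add (hH j k)).integrableOn) ξ
  refine this.trans (integral_congr_ae (Eventually.of_forall fun z => ?_))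
  simp only
  rw [← re_sum_ofReal_mul_complexHessian hη.contDiff_two, mul_comm (hermForm _ _), ← hermForm_smul,
    hermForm, ← Complex.add_re, ← Finset.sum_add_distrib]
  congr 1
  refine Finset.sum_congr rfl fun j _ => ?_
  rw [← Finset.sum_add_distrib]
  refine Finset.sum_congr rfl fun k _ => ?_
  rw [Matrix.smul_apply, smul_eq_mul]
  ring

/-- For smooth `ψ`, integration by parts moves the Levi form from `η` to `ψ`, so the current acts as
the pointwise form `α'`. -/
lemma currentForm_eq_of_isAddDDbar [IsManifold 𝓘(ℂ, Fin n → ℂ) (⊤ : ℕ∞) X]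
    {α α' : ClosedRealForm11 n X} {ψ : X → ℝ}
    (hψ : ContMDiff 𝓘(ℝ, Fin n → ℂ) 𝓘(ℝ, ℝ) (⊤ : ℕ∞) ψ) (h : IsAddDDbar α' α ψ)
    {e : OpenPartialHomeomorph X (Fin n → ℂ)} (he : e ∈ holCharts n X) {η : (Fin n → ℂ) → ℝ}
    (hη : IsTestFunction e.target η) (ξ : Fin n → ℂ) :
    currentForm α ψ e ξ η = ∫ z in e.target, hermForm (α'.coeff e z) ξ * η z := by
  have hs := contDiffOn_comp_symm he hψ
  have h1 := integral_mul_levi e.open_target hs hη ξ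
  have i1 := (integrable_hermForm_coeff_mul α he hη ξ).integrableOn (s := e.target)
  have i2 : IntegrableOn (fun z => ψ (e.symm z) * levi η ξ z) e.target :=
    (integrable_mul_of_continuousOn e.open_target hs.continuousOn (hη.continuous_levi ξ)
      (hη.hasCompactSupport_levi ξ) ((tsupport_levi_subset η ξ).trans hη.2.2)).integrableOn
  have i3 : IntegrableOn (fun z => levi (fun w => ψ (e.symm w)) ξ z * η z) e.target :=
    (integrable_mul_of_continuousOn e.open_target (continuousOn_levi e.open_target hs ξ)
      hη.1.continuous hη.2.1 hη.2.2).integrableOn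
  rw [currentForm, integral_add i1 i2, h1, ← integral_add i1 i3]
  refine setIntegral_congr_fun e.open_target.measurableSet fun z hz => ?_
  rw [h e he z hz, hermForm_add,
    hermForm_complexHessian (hs.contDiffAt (e.open_target.mem_nhds hz)), add_mul]

lemma tendsto_currentForm {α : ClosedRealForm11 n X} {ψ : ℕ → X → ℝ} {ψ_lim : X → ℝ}
    {e : OpenPartialHomeomorph X (Fin n → ℂ)} (he : e ∈ holCharts n X) {η : (Fin n → ℂ) → ℝ}
    (hη : IsTestFunction e.target η)
    (hψ : ∀ k, IntegrableOn (fun z => ψ k (e.symm z)) (tsupport η))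
    (hψ_lim : IntegrableOn (fun z => ψ_lim (e.symm z)) (tsupport η))
    (hlim : Tendsto (fun k => eLpNorm (fun z => ψ k (e.symm z) - ψ_lim (e.symm z)) 1
      (volume.restrict (tsupport η))) atTop (𝓝 0)) (ξ : Fin n → ℂ) :
    Tendsto (fun k => currentForm α (ψ k) e ξ η) atTop (𝓝 (currentForm α ψ_lim e ξ η)) := by
  have i1 := (integrable_hermForm_coeff_mul α he hη ξ).integrableOn (s := e.target)
  have i2 : ∀ {f : X → ℝ}, IntegrableOn (fun z => f (e.symm z)) (tsupport η) →
      IntegrableOn (fun z => f (e.symm z) * levi η ξ z) e.target := fun hf =>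
    (integrable_mul_of_integrableOn hη.2.1 hf (hη.continuous_levi ξ).continuousOn
      fun z hz => hη.levi_eq_zero ξ hz).integrableOn
  have h0 := tendsto_integral_mul_zero e.open_target.measurableSet hη.2.1 hη.2.2
    (hη.continuous_levi ξ).continuousOn (fun z hz => hη.levi_eq_zero ξ hz) hlim
  have h1 := h0.add_const (currentForm α ψ_lim e ξ η)
  rw [zero_add] at h1
  refine h1.congr fun k => ?_
  rw [currentForm, currentForm, integral_add i1 (i2 hψ_lim), integral_add i1 (i2 (hψ k))]
  simp only [sub_mul]
  rw [integral_sub (i2 (hψ k)) (i2 hψ_lim)]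
  ring

end Currents

/-! ### Limits of the currents -/

section Limits

variable {n : ℕ} {X : Type*} [TopologicalSpace X] [ChartedSpace (Fin n → ℂ) X]

lemma restrict_absolutelyContinuous_chartDensity {ω : ClosedRealForm11 n X} (hω : IsKahler ω)
    {e : OpenPartialHomeomorph X (Fin n → ℂ)} (he : e ∈ holCharts n X) :
    volume.restrict e.target ≪ chartDensity ω e := by
  refine withDensity_absolutelyContinuous' ?_ ?_
  · exact ((continuousOn_const.mul (continuousOn_det_coeff ω he)).aemeasurable
      e.open_target.measurableSet).ennreal_ofReal
  · filter_upwards [ae_restrict_mem e.open_target.measurableSet] with z hz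
    exact (ENNReal.ofReal_pos.2 (mul_pos (by positivity)
      (Complex.lt_def.1 (hω e he z hz).det_pos).1)).ne'

lemma aemeasurable_comp_symm [MeasurableSpace X] [BorelSpace X] {ω : ClosedRealForm11 n X}
    (hω : IsKahler ω) {e : OpenPartialHomeomorph X (Fin n → ℂ)} (he : e ∈ holCharts n X)
    {f : X → ℝ} (hf : AEMeasurable f (kahlerVolume ω)) :
    AEMeasurable (fun z => f (e.symm z)) (volume.restrict e.target) :=
  ((hf.mono_measure (chartVolume_le_kahlerVolume ω he)).comp_aemeasurable
    (aemeasurable_symm ω e)).mono_ac (restrict_absolutelyContinuous_chartDensity hω he)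

lemma integrableOn_comp_symm [MeasurableSpace X] [BorelSpace X] {ω : ClosedRealForm11 n X}
    (hω : IsKahler ω) {e : OpenPartialHomeomorph X (Fin n → ℂ)} (he : e ∈ holCharts n X)
    {f : X → ℝ} (hf : Integrable f (kahlerVolume ω)) {K : Set (Fin n → ℂ)} (hK : IsCompact K)
    (hKe : K ⊆ e.target) : IntegrableOn (fun z => f (e.symm z)) K := by
  have hm := aemeasurable_comp_symm hω he hf.aemeasurable
  obtain ⟨C, hC, hle⟩ := eLpNorm_comp_symm_le hω he hK hKe 1 ENNReal.one_ne_top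
  rw [IntegrableOn, ← memLp_one_iff_integrable]
  refine ⟨(hm.mono_measure (Measure.restrict_mono hKe le_rfl)).aestronglyMeasurable, ?_⟩
  exact (hle f hm).trans_lt
    (ENNReal.mul_lt_top hC.lt_top (memLp_one_iff_integrable.2 hf).2)

/-- The convergence used in the proof, on compact subsets of a chart. -/
structure LocalConvergence (ω α : ClosedRealForm11 n X) (θ₀ : ℝ) (αk : ℕ → ClosedRealForm11 n X)
    (ψ : ℕ → X → ℝ) (ψ_lim : X → ℝ) (e : OpenPartialHomeomorph X (Fin n → ℂ)) : Prop where
  integrableOn : ∀ K ⊆ e.target, IsCompact K → ∀ k, IntegrableOn (fun z => ψ k (e.symm z)) K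
  integrableOn_lim : ∀ K ⊆ e.target, IsCompact K → IntegrableOn (fun z => ψ_lim (e.symm z)) K
  currentForm_eq : ∀ k η, IsTestFunction e.target η → ∀ ξ,
    currentForm α (ψ k) e ξ η = ∫ z in e.target, hermForm ((αk k).coeff e z) ξ * η z
  tendsto_potential : ∀ K ⊆ e.target, IsCompact K → Tendsto (fun k =>
    eLpNorm (fun z => ψ k (e.symm z) - ψ_lim (e.symm z)) 1 (volume.restrict K)) atTop (𝓝 0)
  tendsto_Q : ∀ K ⊆ e.target, IsCompact K → Tendsto (fun k =>
    eLpNorm (fun z => Q (ω.coeff e z) ((αk k).coeff e z) + Real.cot θ₀) 1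
      (volume.restrict K)) atTop (𝓝 0)
  aemeasurable_Q : ∀ k, AEMeasurable (fun z => Q (ω.coeff e z) ((αk k).coeff e z))
    (volume.restrict e.target)
  phase_lt : ∀ k, ∀ z ∈ e.target, phase (ω.coeff e z) ((αk k).coeff e z) < Real.pi

lemma localConvergence [MeasurableSpace X] [BorelSpace X]
    [IsManifold 𝓘(ℂ, Fin n → ℂ) (⊤ : ℕ∞) X]
    {ω : ClosedRealForm11 n X} (hω : IsKahler ω) {α : ClosedRealForm11 n X}
    {θ₀ : ℝ} {αk : ℕ → ClosedRealForm11 n X} {ψ : ℕ → X → ℝ}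
    (hψ : ∀ k, ContMDiff 𝓘(ℝ, Fin n → ℂ) 𝓘(ℝ, ℝ) (⊤ : ℕ∞) (ψ k))
    (hαk : ∀ k, IsAddDDbar (αk k) α (ψ k))
    (hphase : ∀ k x, formPhase ω (αk k) x ∈ Set.Ioo 0 Real.pi)
    {ψ_lim : X → ℝ} (hψ_lim : Integrable ψ_lim (kahlerVolume ω))
    (hL1 : Tendsto (fun k => eLpNorm (fun x => ψ k x - ψ_lim x) 1 (kahlerVolume ω))
      atTop (𝓝 0))
    (hL2 : Tendsto (fun k => eLpNorm (fun x => formQ ω (αk k) x + Real.cot θ₀) 2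
      (kahlerVolume ω)) atTop (𝓝 0))
    {e : OpenPartialHomeomorph X (Fin n → ℂ)} (he : e ∈ holCharts n X) :
    LocalConvergence ω α θ₀ αk ψ ψ_lim e where
  integrableOn K hKe hK k :=
    ((contDiffOn_comp_symm he (hψ k)).continuousOn.mono hKe).integrableOn_compact hK
  integrableOn_lim K hKe hK := integrableOn_comp_symm hω he hψ_lim hK hKe
  currentForm_eq k η hη ξ := currentForm_eq_of_isAddDDbar (hψ k) (hαk k) he hη ξ
  tendsto_potential K hKe hK := by
    refine tendsto_eLpNorm_one_comp_symm (f := fun k x => ψ k x - ψ_lim x) hω he hK hKe le_rfl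
      ENNReal.one_ne_top (fun k => ?_) hL1
    exact ((contDiffOn_comp_symm he (hψ k)).continuousOn.aemeasurable
      e.open_target.measurableSet).sub (aemeasurable_comp_symm hω he hψ_lim.aemeasurable)
  aemeasurable_Q k := measurable_Q_coeff hω (αk k) he
  tendsto_Q K hKe hK := by
    have h := tendsto_eLpNorm_one_comp_symm (f := fun k x => formQ ω (αk k) x + Real.cot θ₀) hω he
      hK hKe (p := 2) (by norm_num) (by norm_num) (fun k => ?_) hL2
    · refine h.congr fun k => eLpNorm_congr_ae ?_
      filter_upwards [ae_restrict_mem hK.measurableSet] with z hz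
      rw [formQ_symm_apply hω _ he (hKe hz)]
    · refine ((measurable_Q_coeff hω (αk k) he).add_const (Real.cot θ₀)).congr ?_
      filter_upwards [ae_restrict_mem e.open_target.measurableSet] with z hz
      rw [formQ_symm_apply hω _ he hz]
  phase_lt k z hz := by
    rw [← formPhase_symm_apply hω _ he hz]
    exact (hphase k _).2

lemma integral_const_mul_re_sum (ω : ClosedRealForm11 n X)
    {e : OpenPartialHomeomorph X (Fin n → ℂ)} (he : e ∈ holCharts n X) {η : (Fin n → ℂ) → ℝ}
    (hη : IsTestFunction e.target η) (C : ℝ) (ξ : Fin n → ℂ) :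
    (∑ j, ∑ k, ((C : ℂ) * ∫ z in e.target, ω.coeff e z j k * (η z : ℂ)) * ξ j * star (ξ k)).re =
      C * ∫ z in e.target, hermForm (ω.coeff e z) ξ * η z := by
  have := re_sum_integral (U := e.target) (f := fun j k z => ω.coeff e z j k * (η z : ℂ))
    (fun j k => (integrableOn_coeff_mul ω he hη j k).integrableOn) ξ
  simp only [mul_assoc (C : ℂ), ← Finset.mul_sum]
  rw [Complex.re_ofReal_mul]
  simp only [mul_assoc] at this ⊢
  rw [this]
  congr 1
  refine integral_congr_ae (Eventually.of_forall fun z => ?_)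
  simp only
  rw [mul_comm (hermForm _ _), ← hermForm_smul, hermForm]
  congr 1
  refine Finset.sum_congr rfl fun j _ => Finset.sum_congr rfl fun k _ => ?_
  rw [Matrix.smul_apply, smul_eq_mul]
  ring

/-- Write `α_k - cot θ₀ ω = (α_k + Q_k ω) - (Q_k + cot θ₀) ω`. The first term is nonnegative because
the phase is below `π`, and the second tends to zero against test functions. -/
lemma LocalConvergence.isPositive {ω α : ClosedRealForm11 n X} (hω : IsKahler ω) {θ₀ : ℝ}
    {αk : ℕ → ClosedRealForm11 n X} {ψ : ℕ → X → ℝ} {ψ_lim : X → ℝ}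
    {e : OpenPartialHomeomorph X (Fin n → ℂ)} (he : e ∈ holCharts n X)
    (h : LocalConvergence ω α θ₀ αk ψ ψ_lim e) {η : (Fin n → ℂ) → ℝ}
    (hη : IsTestFunction e.target η) (hη0 : ∀ z, 0 ≤ η z) (ξ : Fin n → ℂ) :
    0 ≤ currentForm α ψ_lim e ξ η +
      -Real.cot θ₀ * ∫ z in e.target, hermForm (ω.coeff e z) ξ * η z := by
  have hK := hη.2.1.isCompact
  have hKe := hη.2.2
  have hlim := tendsto_currentForm (α := α) he hη (h.integrableOn _ hKe hK) (h.integrableOn_lim _ hKe hK)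
    (h.tendsto_potential _ hKe hK) ξ
  have hgc : ContinuousOn (fun z => hermForm (ω.coeff e z) ξ * η z) (tsupport η) :=
    ((continuousOn_hermForm_coeff ω he ξ).mono hKe).mul hη.1.continuous.continuousOn
  have hg0 : ∀ z ∉ tsupport η, hermForm (ω.coeff e z) ξ * η z = 0 := fun z hz => by
    rw [hη.eq_zero hz, mul_zero]
  have hlimQ := tendsto_integral_mul_zero e.open_target.measurableSet hK hKe hgc hg0
    (h.tendsto_Q _ hKe hK)
  have hsum := (hlim.add hlimQ).add_const
    (-Real.cot θ₀ * ∫ z in e.target, hermForm (ω.coeff e z) ξ * η z)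
  rw [add_zero] at hsum
  refine ge_of_tendsto hsum ?_
  -- Convergence to `0` makes the norm eventually finite; this supplies the integrability needed to
  -- add the integrals.
  have hfin : ∀ᶠ k in atTop, eLpNorm (fun z => Q (ω.coeff e z) ((αk k).coeff e z) +
      Real.cot θ₀) 1 (volume.restrict (tsupport η)) < ⊤ :=
    (h.tendsto_Q _ hKe hK).eventually (gt_mem_nhds ENNReal.zero_lt_top)
  filter_upwards [hfin] with k hk
  have hQi : IntegrableOn (fun z => Q (ω.coeff e z) ((αk k).coeff e z) + Real.cot θ₀)
      (tsupport η) := by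
    rw [IntegrableOn, ← memLp_one_iff_integrable]
    exact ⟨(((h.aemeasurable_Q k).add_const _).mono_measure
      (Measure.restrict_mono hKe le_rfl)).aestronglyMeasurable, hk⟩
  have i1 := (integrable_hermForm_coeff_mul (αk k) he hη ξ).integrableOn (s := e.target)
  have i2 := (integrable_mul_of_integrableOn hK hQi hgc hg0).integrableOn (s := e.target)
  have i3 := ((integrable_hermForm_coeff_mul ω he hη ξ).const_mul
    (-Real.cot θ₀)).integrableOn (s := e.target)
  have i12 : IntegrableOn (fun z => hermForm ((αk k).coeff e z) ξ * η z +
      (Q (ω.coeff e z) ((αk k).coeff e z) + Real.cot θ₀) * (hermForm (ω.coeff e z) ξ * η z))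
      e.target := i1.add i2
  rw [h.currentForm_eq k η hη ξ, ← integral_const_mul, ← integral_add i1 i2,
    ← integral_add i12 i3]
  refine setIntegral_nonneg e.open_target.measurableSet fun z hz => ?_
  have h1 := hermForm_add_Q_mul_nonneg (hω e he z hz) ((αk k).hermitian e he z hz)
    (h.phase_lt k z hz) ξ
  have h2 := mul_nonneg h1 (hη0 z)
  linarith

lemma LocalConvergence.isPositiveAfterAdding {ω α : ClosedRealForm11 n X} (hω : IsKahler ω)
    {θ₀ : ℝ} {αk : ℕ → ClosedRealForm11 n X} {ψ : ℕ → X → ℝ} {ψ_lim : X → ℝ}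
    (h : ∀ e ∈ holCharts n X, LocalConvergence ω α θ₀ αk ψ ψ_lim e) :
    IsPositiveAfterAdding ω α ψ_lim (-Real.cot θ₀) := by
  intro e he η hη hη0 ξ
  have h1 := (h e he).isPositive hω he hη hη0 ξ
  rw [← re_sum_currentCoeff α he hη ((h e he).integrableOn_lim _ hη.2.2 hη.2.1) ξ,
    ← integral_const_mul_re_sum ω he hη, ← Complex.add_re, ← Finset.sum_add_distrib] at h1
  simp only [← Finset.sum_add_distrib] at h1
  simpa only [add_mul] using h1

/-- The distributional inequality satisfied by the limit current. -/
lemma LocalConvergence.le_sum_currentForm {ω α : ClosedRealForm11 n X} (hω : IsKahler ω)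
    {θ₀ : ℝ} (hθ₀ : θ₀ ∈ Ioo 0 Real.pi)
    {αk : ℕ → ClosedRealForm11 n X} {ψ : ℕ → X → ℝ} {ψ_lim : X → ℝ}
    {e : OpenPartialHomeomorph X (Fin n → ℂ)} (he : e ∈ holCharts n X)
    (h : LocalConvergence ω α θ₀ αk ψ ψ_lim e) {z₀ : Fin n → ℂ} (hz₀ : z₀ ∈ e.target)
    {H : Matrix (Fin n) (Fin n) ℂ} (hH : H.IsHermitian) (hph : θ₀ < phase (ω.coeff e z₀) H) :
    ∃ v : Module.Basis (Fin n) ℂ (Fin n → ℂ), ∃ δ > 0, ∃ V ∈ 𝓝 z₀, IsOpen V ∧ V ⊆ e.target ∧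
      ∀ η, IsTestFunction V η → (∀ z, 0 ≤ η z) →
        (∑ i, hermForm H (v i) + δ) * ∫ z, η z ≤ ∑ i, currentForm α ψ_lim e (v i) η := by
  obtain ⟨v, δ, hδ, C, hC, r, hr, hsep⟩ := exists_separating_basis (hω e he z₀ hz₀) hH hθ₀ hph
  -- Near `z₀` the metric stays within the tolerance of the separation lemma, so one basis `v`
  -- serves on a whole neighbourhood.
  have hnear : ∀ᶠ z in 𝓝 z₀, ∀ i j, ‖(ω.coeff e z - ω.coeff e z₀) i j‖ ≤ r := by
    rw [eventually_all]
    intro i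
    rw [eventually_all]
    intro j
    have hc : ContinuousAt (fun z => ω.coeff e z i j) z₀ :=
      (ω.smooth e he i j).continuousOn.continuousAt (e.open_target.mem_nhds hz₀)
    filter_upwards [Metric.tendsto_nhds.1 hc r hr] with z hz
    rw [Matrix.sub_apply, ← dist_eq_norm]
    exact hz.le
  obtain ⟨V, hVsub, hVo, hzV⟩ := mem_nhds_iff.1
    (hnear.and (e.open_target.mem_nhds hz₀))
  refine ⟨v, δ, hδ, V, hVo.mem_nhds hzV, hVo, fun z hz => (hVsub hz).2, fun η hη' hη0 => ?_⟩
  have hη : IsTestFunction e.target η := ⟨hη'.1, hη'.2.1, hη'.2.2.trans fun z hz => (hVsub hz).2⟩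
  have hK := hη.2.1.isCompact
  have hKe := hη.2.2
  have hlim : Tendsto (fun k => ∑ i, currentForm α (ψ k) e (v i) η) atTop
      (𝓝 (∑ i, currentForm α ψ_lim e (v i) η)) := tendsto_finsetSum _ fun i _ =>
    tendsto_currentForm he hη (h.integrableOn _ hKe hK) (h.integrableOn_lim _ hKe hK)
      (h.tendsto_potential _ hKe hK) (v i)
  have habs : Tendsto (fun k => eLpNorm (fun z =>
      |Q (ω.coeff e z) ((αk k).coeff e z) + Real.cot θ₀|) 1 (volume.restrict (tsupport η)))
      atTop (𝓝 0) := by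
    refine (h.tendsto_Q _ hKe hK).congr fun k => ?_
    simp_rw [← Real.norm_eq_abs]
    exact (eLpNorm_norm _).symm
  have hη_zero : ∀ z ∉ tsupport η, η z = 0 := fun z hz => hη.eq_zero hz
  have hlimQ := (tendsto_integral_mul_zero e.open_target.measurableSet hK hKe
    hη.1.continuous.continuousOn hη_zero habs).const_mul C
  rw [mul_zero] at hlimQ
  have hsum := hlim.add hlimQ
  rw [add_zero] at hsum
  refine ge_of_tendsto hsum ?_
  have hfin : ∀ᶠ k in atTop, eLpNorm (fun z => Q (ω.coeff e z) ((αk k).coeff e z) +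
      Real.cot θ₀) 1 (volume.restrict (tsupport η)) < ⊤ :=
    (h.tendsto_Q _ hKe hK).eventually (gt_mem_nhds ENNReal.zero_lt_top)
  filter_upwards [hfin] with k hk
  have hQi : IntegrableOn (fun z => |Q (ω.coeff e z) ((αk k).coeff e z) + Real.cot θ₀|)
      (tsupport η) := by
    refine Integrable.abs ?_
    rw [← memLp_one_iff_integrable]
    exact ⟨(((h.aemeasurable_Q k).add_const _).mono_measure
      (Measure.restrict_mono hKe le_rfl)).aestronglyMeasurable, hk⟩
  have i1 : ∀ i, IntegrableOn (fun z => hermForm ((αk k).coeff e z) (v i) * η z) e.target :=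
    fun i => (integrable_hermForm_coeff_mul (αk k) he hη (v i)).integrableOn
  have i2 := ((integrable_mul_of_integrableOn hK hQi hη.1.continuous.continuousOn
    (fun z hz => hη.eq_zero hz)).const_mul C).integrableOn (s := e.target)
  have i3 : IntegrableOn (fun z => (∑ i, hermForm H (v i) + δ) * η z) e.target :=
    ((hη.1.continuous.integrable_of_hasCompactSupport hη.2.1).const_mul _).integrableOn
  have e0 : ∫ z, η z = ∫ z in e.target, η z :=
    (setIntegral_eq_integral_of_forall_compl_eq_zero fun z hz =>
      hη.eq_zero fun h => hz (hKe h)).symm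
  simp_rw [h.currentForm_eq k η hη]
  rw [← integral_finsetSum _ fun i _ => i1 i, e0, ← integral_const_mul, ← integral_const_mul,
    ← integral_add (integrable_finsetSum _ fun i _ => i1 i) i2]
  refine setIntegral_mono_on i3 ((integrable_finsetSum _ fun i _ => i1 i).add i2)
    e.open_target.measurableSet fun z hz => ?_
  by_cases hzs : z ∈ tsupport η
  · have h1 := hsep (ω.coeff e z) (hω e he z hz) (hVsub (hη'.2.2 hzs)).1 _
      ((αk k).hermitian e he z hz) (h.phase_lt k z hz)
    have h2 := mul_le_mul_of_nonneg_right h1 (hη0 z)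
    rw [← Finset.sum_mul]
    linarith
  · simp [hη.eq_zero hzs]

end Limits

/-! ### Radial kernels -/

/-- A smooth nonincreasing function, positive on `(-∞, 1)` and zero on `[1, ∞)`. -/
def radialCutoff (s : ℝ) : ℝ := expNegInvGlue (1 - s)

lemma contDiff_radialCutoff {m : ℕ∞} : ContDiff ℝ m radialCutoff :=
  expNegInvGlue.contDiff.comp (contDiff_const.sub contDiff_id)

lemma radialCutoff_nonneg (s : ℝ) : 0 ≤ radialCutoff s := expNegInvGlue.nonneg _

lemma radialCutoff_eq_zero {s : ℝ} (hs : 1 ≤ s) : radialCutoff s = 0 :=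
  expNegInvGlue.zero_of_nonpos (by linarith)

lemma radialCutoff_pos {s : ℝ} (hs : s < 1) : 0 < radialCutoff s :=
  expNegInvGlue.pos_of_pos (by linarith)

lemma expNegInvGlue_monotone : Monotone expNegInvGlue := by
  intro x y hxy
  rcases le_or_gt x 0 with hx | hx
  · rw [expNegInvGlue.zero_of_nonpos hx]
    exact expNegInvGlue.nonneg y
  · have hy : 0 < y := hx.trans_le hxy
    rw [expNegInvGlue, expNegInvGlue, if_neg (not_le.2 hx), if_neg (not_le.2 hy)]
    exact Real.exp_le_exp.2 (neg_le_neg (inv_anti₀ hx hxy))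

lemma radialCutoff_antitone : Antitone radialCutoff := fun _ _ h =>
  expNegInvGlue_monotone (by linarith)

lemma contDiff_deriv_radialCutoff {m : ℕ} : ContDiff ℝ m (deriv radialCutoff) :=
  (contDiff_radialCutoff (m := ((m + 1 : ℕ) : ℕ∞))).deriv' 

lemma hasDerivAt_radialCutoff (s : ℝ) :
    HasDerivAt radialCutoff (deriv radialCutoff s) s :=
  ((contDiff_radialCutoff (m := 1)).differentiable (by norm_num) s).hasDerivAt

lemma hasDerivAt_deriv_radialCutoff (s : ℝ) :
    HasDerivAt (deriv radialCutoff) (deriv (deriv radialCutoff) s) s :=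
  ((contDiff_deriv_radialCutoff (m := 1)).differentiable (by norm_num) s).hasDerivAt

lemma continuous_deriv_deriv_radialCutoff : Continuous (deriv (deriv radialCutoff)) :=
  (contDiff_deriv_radialCutoff (m := 1)).continuous_deriv (by norm_num)

lemma deriv_radialCutoff_nonpos (s : ℝ) : deriv radialCutoff s ≤ 0 :=
  radialCutoff_antitone.deriv_nonpos

/-- Beyond `1` the function is locally zero; the endpoint follows from continuity of the derivative.
-/
lemma deriv_eq_zero_of_eq_zero {f : ℝ → ℝ} (hf : Continuous (deriv f))
    (h0 : ∀ s, 1 ≤ s → f s = 0) {s : ℝ} (hs : 1 ≤ s) : deriv f s = 0 := by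
  have h1 : ∀ t ∈ Ioi (1 : ℝ), deriv f t = 0 := fun t ht => by
    have : f =ᶠ[𝓝 t] fun _ => 0 := by
      filter_upwards [Ioi_mem_nhds ht] with y hy
      exact h0 y (le_of_lt hy)
    rw [this.deriv_eq, deriv_const]
  have h2 : EqOn (deriv f) (fun _ => 0) (closure (Ioi 1)) :=
    EqOn.closure h1 hf continuous_const
  rw [closure_Ioi] at h2
  exact h2 hs

lemma deriv_radialCutoff_eq_zero {s : ℝ} (hs : 1 ≤ s) : deriv radialCutoff s = 0 :=
  deriv_eq_zero_of_eq_zero (contDiff_deriv_radialCutoff (m := 0)).continuous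
    (fun _ => radialCutoff_eq_zero) hs

lemma deriv_deriv_radialCutoff_eq_zero {s : ℝ} (hs : 1 ≤ s) :
    deriv (deriv radialCutoff) s = 0 :=
  deriv_eq_zero_of_eq_zero continuous_deriv_deriv_radialCutoff
    (fun _ => deriv_radialCutoff_eq_zero) hs

section Kernel

variable {n : ℕ} (v : Module.Basis (Fin n) ℂ (Fin n → ℂ))

/-- The coordinates with respect to `v` as continuous real-linear maps. -/
def coordCLM (i : Fin n) : (Fin n → ℂ) →L[ℝ] ℂ :=
  LinearMap.toContinuousLinearMap ((v.coord i).restrictScalars ℝ)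

@[simp] lemma coordCLM_apply (i : Fin n) (y : Fin n → ℂ) : coordCLM v i y = v.coord i y := rfl

/-- The squared Hermitian norm for which `v` is orthonormal. -/
def basisNormSq (y : Fin n → ℂ) : ℝ := ∑ i, ((v.coord i y).re ^ 2 + (v.coord i y).im ^ 2)

/-- The derivative of `basisNormSq`. -/
def basisNormSqDeriv : (Fin n → ℂ) →L[ℝ] (Fin n → ℂ) →L[ℝ] ℝ :=
  ∑ i, (((2 : ℝ) • Complex.reCLM.comp (coordCLM v i)).smulRight (Complex.reCLM.comp (coordCLM v i)) +
    ((2 : ℝ) • Complex.imCLM.comp (coordCLM v i)).smulRight (Complex.imCLM.comp (coordCLM v i)))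

lemma basisNormSqDeriv_apply (y ξ : Fin n → ℂ) : basisNormSqDeriv v y ξ =
    ∑ i, (2 * (v.coord i y).re * (v.coord i ξ).re + 2 * (v.coord i y).im * (v.coord i ξ).im) := by
  rw [basisNormSqDeriv, sum_apply, sum_apply]
  rfl

lemma hasFDerivAt_basisNormSq (y : Fin n → ℂ) :
    HasFDerivAt (basisNormSq v) (basisNormSqDeriv v y) y := by
  have h : HasFDerivAt (basisNormSq v) (∑ i,
      ((2 • (v.coord i y).re ^ (2 - 1)) • Complex.reCLM.comp (coordCLM v i) +
        (2 • (v.coord i y).im ^ (2 - 1)) • Complex.imCLM.comp (coordCLM v i))) y := by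
    refine HasFDerivAt.fun_sum fun i _ => HasFDerivAt.add ?_ ?_
    · exact HasFDerivAt.pow (x := y) (Complex.reCLM.comp (coordCLM v i)).hasFDerivAt 2
    · exact HasFDerivAt.pow (x := y) (Complex.imCLM.comp (coordCLM v i)).hasFDerivAt 2
  convert h using 1
  ext ξ
  rw [basisNormSqDeriv_apply, sum_apply]
  refine Finset.sum_congr rfl fun i _ => ?_
  simp

lemma basisNormSq_nonneg (y : Fin n → ℂ) : 0 ≤ basisNormSq v y :=
  Finset.sum_nonneg fun _ _ => by positivity

lemma basisNormSq_smul (c : ℂ) (hc : ‖c‖ = 1) (y : Fin n → ℂ) :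
    basisNormSq v (c • y) = basisNormSq v y := by
  refine Finset.sum_congr rfl fun i _ => ?_
  have h : ∀ w : ℂ, w.re ^ 2 + w.im ^ 2 = ‖w‖ ^ 2 := fun w => by
    rw [← Complex.normSq_eq_norm_sq, Complex.normSq_apply]; ring
  rw [h, h, map_smul, smul_eq_mul, norm_mul, hc, one_mul]

lemma basisNormSq_real_smul (c : ℝ) (y : Fin n → ℂ) :
    basisNormSq v (c • y) = c ^ 2 * basisNormSq v y := by
  rw [basisNormSq, basisNormSq, Finset.mul_sum]
  refine Finset.sum_congr rfl fun i _ => ?_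
  have : v.coord i (c • y) = (c : ℂ) * v.coord i y := by
    rw [← Complex.coe_smul, map_smul, smul_eq_mul]
  rw [this, Complex.re_ofReal_mul, Complex.im_ofReal_mul]
  ring

/-- Ensures that kernels in the `v`-norm shrink into small balls of the ambient sup norm as `a`
grows. -/
lemma exists_norm_sq_le_basisNormSq : ∃ M > 0, ∀ y : Fin n → ℂ, ‖y‖ ^ 2 ≤ M * basisNormSq v y := by
  refine ⟨(∑ i, ‖v i‖) ^ 2 + 1, by positivity, fun y => ?_⟩
  have h0 := basisNormSq_nonneg v y
  have hc : ∀ i, ‖v.coord i y‖ ≤ Real.sqrt (basisNormSq v y) := by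
    intro i
    apply Real.le_sqrt_of_sq_le
    rw [← Complex.normSq_eq_norm_sq, Complex.normSq_apply]
    have := Finset.single_le_sum (f := fun i => (v.coord i y).re ^ 2 + (v.coord i y).im ^ 2)
      (fun _ _ => by positivity) (Finset.mem_univ i)
    calc _ = (v.coord i y).re ^ 2 + (v.coord i y).im ^ 2 := by ring
      _ ≤ _ := this
  have hy : ‖y‖ ≤ (∑ i, ‖v i‖) * Real.sqrt (basisNormSq v y) := by
    conv_lhs => rw [← v.sum_repr y]
    rw [Finset.sum_mul]
    refine (norm_sum_le _ _).trans (Finset.sum_le_sum fun i _ => ?_)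
    rw [norm_smul, mul_comm]
    gcongr
    exact hc i
  calc ‖y‖ ^ 2 ≤ ((∑ i, ‖v i‖) * Real.sqrt (basisNormSq v y)) ^ 2 := by gcongr
    _ = (∑ i, ‖v i‖) ^ 2 * basisNormSq v y := by rw [mul_pow, Real.sq_sqrt h0]
    _ ≤ _ := by nlinarith

/-- The kernel `F(a |y - z|²)`. -/
def radialKernel (z : Fin n → ℂ) (a : ℝ) (F : ℝ → ℝ) (y : Fin n → ℂ) : ℝ :=
  F (a * basisNormSq v (y - z))

lemma contDiff_basisNormSq {m : WithTop ℕ∞} : ContDiff ℝ m (basisNormSq v) := by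
  unfold basisNormSq
  refine ContDiff.sum fun i _ => ContDiff.add ?_ ?_
  · exact (Complex.reCLM.comp (coordCLM v i)).contDiff.pow 2
  · exact (Complex.imCLM.comp (coordCLM v i)).contDiff.pow 2

/-- The sum of Levi forms is a quarter of the Laplacian of the norm in which `v` is orthonormal.
With `ρ` the cutoff and `cᵢ` the coordinates of `y - z`, the direction `vᵢ` contributes `a² ρ''
|cᵢ|² + a ρ'`. -/
lemma sum_levi_radialKernel (z : Fin n → ℂ) (a : ℝ) (y : Fin n → ℂ) :
    ∑ i, levi (radialKernel v z a radialCutoff) (v i) y =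
      a * (radialKernel v z a (fun s => s * deriv (deriv radialCutoff) s +
        n * deriv radialCutoff s) y) := by
  have hN : ∀ y, HasFDerivAt (fun y => a * basisNormSq v (y - z))
      (a • basisNormSqDeriv v (y - z)) y := by
    intro y
    have h1 : HasFDerivAt (fun y : Fin n → ℂ => y - z) (ContinuousLinearMap.id ℝ _) y :=
      (hasFDerivAt_id y).sub_const z
    have h2 := ((hasFDerivAt_basisNormSq v (y - z)).comp y h1).const_mul a
    exact h2
  have h1 : fderiv ℝ (radialKernel v z a radialCutoff) = fun y =>
      deriv radialCutoff (a * basisNormSq v (y - z)) • (a • basisNormSqDeriv v (y - z)) := by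
    ext1 y
    exact ((hasDerivAt_radialCutoff _).comp_hasFDerivAt y (hN y)).fderiv
  have hT : HasFDerivAt (fun y => a • basisNormSqDeriv v (y - z)) (a • basisNormSqDeriv v) y := by
    have h3 : HasFDerivAt (fun y : Fin n → ℂ => y - z) (ContinuousLinearMap.id ℝ _) y :=
      (hasFDerivAt_id y).sub_const z
    exact ((basisNormSqDeriv v).hasFDerivAt.comp y h3).const_smul a
  have h2 := (((hasDerivAt_deriv_radialCutoff _).comp_hasFDerivAt y (hN y)).smul hT).fderiv
  have h3 : ∀ ξ : Fin n → ℂ, fderiv ℝ (fderiv ℝ (radialKernel v z a radialCutoff)) y ξ ξ =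
      deriv (deriv radialCutoff) (a * basisNormSq v (y - z)) *
        (a * basisNormSqDeriv v (y - z) ξ) ^ 2 +
      deriv radialCutoff (a * basisNormSq v (y - z)) * (a * basisNormSqDeriv v ξ ξ) := by
    intro ξ
    rw [h1]
    have h4 := congrArg (fun L => L ξ ξ) h2
    refine Eq.trans h4 ?_
    simp
    ring
  have hcoord : ∀ i j, v.coord i (v j) = if i = j then 1 else 0 := by
    intro i j
    simp [Finsupp.single_apply, eq_comm]
  have c1 : ∀ i, basisNormSqDeriv v (y - z) (v i) = 2 * (v.coord i (y - z)).re := by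
    intro i
    rw [basisNormSqDeriv_apply, Finset.sum_eq_single i]
    · rw [hcoord]; simp
    · intro j _ hj
      rw [hcoord, if_neg hj]; simp
    · simp
  have c2 : ∀ i, basisNormSqDeriv v (y - z) (Complex.I • v i) = 2 * (v.coord i (y - z)).im := by
    intro i
    rw [basisNormSqDeriv_apply, Finset.sum_eq_single i]
    · rw [map_smul (v.coord i), hcoord]; simp
    · intro j _ hj
      rw [map_smul (v.coord j), hcoord, if_neg hj]; simp
    · simp
  have c3 : ∀ i, basisNormSqDeriv v (v i) (v i) = 2 := by
    intro i
    rw [basisNormSqDeriv_apply, Finset.sum_eq_single i]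
    · rw [hcoord]; simp
    · intro j _ hj
      rw [hcoord, if_neg hj]; simp
    · simp
  have c4 : ∀ i, basisNormSqDeriv v (Complex.I • v i) (Complex.I • v i) = 2 := by
    intro i
    rw [basisNormSqDeriv_apply, Finset.sum_eq_single i]
    · rw [map_smul (v.coord i), hcoord]; simp
    · intro j _ hj
      rw [map_smul (v.coord j), hcoord, if_neg hj]; simp
    · simp
  have h5 : ∀ i, levi (radialKernel v z a radialCutoff) (v i) y =
      a ^ 2 * deriv (deriv radialCutoff) (a * basisNormSq v (y - z)) *
        ((v.coord i (y - z)).re ^ 2 + (v.coord i (y - z)).im ^ 2) +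
      a * deriv radialCutoff (a * basisNormSq v (y - z)) := by
    intro i
    rw [levi, h3, h3, c1, c2, c3, c4]
    ring
  simp_rw [h5]
  rw [Finset.sum_add_distrib, ← Finset.mul_sum, Finset.sum_const, Finset.card_univ,
    Fintype.card_fin, nsmul_eq_mul, radialKernel]
  change a ^ 2 * _ * basisNormSq v (y - z) + _ = _
  ring

end Kernel

/-! ### The mean value inequality for circle-invariant kernels -/

lemma measurePreserving_exp_smul {n : ℕ} (t : ℝ) :
    MeasurePreserving (fun y : Fin n → ℂ => Complex.exp (t * Complex.I) • y) := by
  have h : MeasurePreserving (fun w : ℂ => Complex.exp (t * Complex.I) * w) :=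
    (rotation (Circle.exp t)).measurePreserving
  exact volume_preserving_pi fun _ : Fin n => h

lemma measurable_exp_smul {n : ℕ} :
    Measurable fun p : ℝ × (Fin n → ℂ) => Complex.exp (p.1 * Complex.I) • p.2 := by
  have : Continuous fun p : ℝ × (Fin n → ℂ) => Complex.exp (p.1 * Complex.I) • p.2 := by
    fun_prop
  exact this.measurable

/-- Each rotation preserves Lebesgue measure, so averaging over circles can be exchanged with
integration over space without polar coordinates. -/
lemma measurePreserving_skew {n : ℕ} (T : Measure ℝ) [SFinite T] :
    MeasurePreserving (fun p : (Fin n → ℂ) × ℝ => (p.2, Complex.exp (p.2 * Complex.I) • p.1))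
      ((volume : Measure (Fin n → ℂ)).prod T) (T.prod volume) := by
  have h1 : MeasurePreserving
      (fun p : ℝ × (Fin n → ℂ) => (p.1, Complex.exp (p.1 * Complex.I) • p.2))
      (T.prod volume) (T.prod volume) :=
    (MeasurePreserving.id T).skew_product (g := fun t y => Complex.exp (t * Complex.I) • y)
      measurable_exp_smul (Eventually.of_forall fun t => (measurePreserving_exp_smul t).map_eq)
  exact h1.comp Measure.measurePreserving_swap

lemma circle_mean_le {T : Measure ℝ} {u : ℝ → EReal} {c : ℝ}
    (hu : ∀ᵐ t ∂T, u t ≠ ⊥ ∧ u t ≠ ⊤) (hint : Integrable (fun t => (u t).toReal) T)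
    (h : (c : EReal) ≤ ((∫⁻ t, (u t).toENNReal ∂T : ENNReal) : EReal) -
      ((∫⁻ t, (-u t).toENNReal ∂T : ENNReal) : EReal)) :
    c ≤ ∫ t, (u t).toReal ∂T := by
  have e1 : ∫⁻ t, (u t).toENNReal ∂T = ∫⁻ t, ENNReal.ofReal (u t).toReal ∂T := by
    refine lintegral_congr_ae ?_
    filter_upwards [hu] with t ht
    rw [EReal.toENNReal_of_ne_top ht.2]
  have e2 : ∫⁻ t, (-u t).toENNReal ∂T = ∫⁻ t, ENNReal.ofReal (-(u t).toReal) ∂T := by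
    refine lintegral_congr_ae ?_
    filter_upwards [hu] with t ht
    rw [EReal.toENNReal_of_ne_top (by simpa using ht.1), EReal.toReal_neg_eq]
  have f1 : ∫⁻ t, ENNReal.ofReal (u t).toReal ∂T ≠ ⊤ :=
    (hint.lintegral_lt_top).ne
  have f2 : ∫⁻ t, ENNReal.ofReal (-(u t).toReal) ∂T ≠ ⊤ := hint.neg.lintegral_lt_top.ne
  rw [e1, e2, ← EReal.coe_ennreal_toReal f1, ← EReal.coe_ennreal_toReal f2, ← EReal.coe_sub,
    EReal.coe_le_coe_iff] at h
  rwa [integral_eq_lintegral_pos_part_sub_lintegral_neg_part hint]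

/-- Apply the mean value inequality on each circle `t ↦ z + e^{it} y`, multiply by `χ(z + y)`, which
is constant on that circle, and integrate over `y`. By rotation invariance the averaging over `t`
contributes only the factor `2π`. -/
lemma IsPSH.mul_integral_le {n : ℕ} {z : Fin n → ℂ} {r : ℝ} {u : (Fin n → ℂ) → EReal}
    (hu : IsPSH (Metric.ball z r) u)
    (hbot : ∀ᵐ y, y ∈ Metric.ball z r → u y ≠ ⊥) {c : ℝ} (hc : u z = (c : EReal))
    {χ : (Fin n → ℂ) → ℝ} (hχ0 : ∀ y, 0 ≤ χ y)
    (hχ : ∀ t : ℝ, ∀ y, χ (z + Complex.exp (t * Complex.I) • y) = χ (z + y))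
    (hsupp : ∀ y ∉ Metric.ball z r, χ y = 0) (hχi : Integrable χ)
    (hi : Integrable fun y => (u y).toReal * χ y) :
    c * ∫ y, χ y ≤ ∫ y, (u y).toReal * χ y := by
  set T : Measure ℝ := volume.restrict (Ioc 0 (2 * Real.pi)) with hT
  have hTuniv : T.real univ = 2 * Real.pi := by
    rw [hT, Measure.real, Measure.restrict_apply_univ, Real.volume_Ioc, sub_zero,
      ENNReal.toReal_ofReal (by positivity)]
  set h : (Fin n → ℂ) → ℝ := fun y => (u (z + y)).toReal * χ (z + y) with hh
  have hhi : Integrable h := hi.comp_add_left z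
  have hMP := measurePreserving_skew (n := n) T
  have hprod : Integrable (fun p : ℝ × (Fin n → ℂ) => h p.2) (T.prod volume) := hhi.comp_snd T
  have hprod' : Integrable (fun p : (Fin n → ℂ) × ℝ => h (Complex.exp (p.2 * Complex.I) • p.1))
      (volume.prod T) := hMP.integrable_comp_of_integrable hprod
  have hmap : ∫ p, h (Complex.exp (p.2 * Complex.I) • p.1) ∂((volume : Measure (Fin n → ℂ)).prod T) =
      ∫ p, h p.2 ∂(T.prod (volume : Measure (Fin n → ℂ))) := by
    have := integral_map (μ := (volume : Measure (Fin n → ℂ)).prod T)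
      hMP.measurable.aemeasurable (f := fun p : ℝ × (Fin n → ℂ) => h p.2)
      (by rw [hMP.map_eq]; exact hprod.aestronglyMeasurable)
    rw [hMP.map_eq] at this
    exact this.symm
  have hval : ∫ y, ∫ t, h (Complex.exp (t * Complex.I) • y) ∂T =
      2 * Real.pi * ∫ y, (u y).toReal * χ y := by
    have e := integral_prod _ hprod'
    simp only at e
    rw [← e, hmap, integral_prod _ hprod]
    simp only
    rw [integral_const, hTuniv, smul_eq_mul, hh,
      integral_add_left_eq_self (fun y => (u y).toReal * χ y) z]
  have hae : ∀ᵐ y : Fin n → ℂ, ∀ᵐ t : ℝ ∂T, z + Complex.exp (t * Complex.I) • y ∈ Metric.ball z r →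
      u (z + Complex.exp (t * Complex.I) • y) ≠ ⊥ := by
    have h1 : ∀ᵐ y : Fin n → ℂ, z + y ∈ Metric.ball z r → u (z + y) ≠ ⊥ :=
      (measurePreserving_add_left volume z).quasiMeasurePreserving.ae hbot
    have h2 : ∀ᵐ p ∂(T.prod (volume : Measure (Fin n → ℂ))),
        z + p.2 ∈ Metric.ball z r → u (z + p.2) ≠ ⊥ :=
      Measure.quasiMeasurePreserving_snd.ae h1
    exact Measure.ae_ae_of_ae_prod (hMP.quasiMeasurePreserving.ae h2)
  have hpt : ∀ᵐ y : Fin n → ℂ, 2 * Real.pi * c * χ (z + y) ≤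
      ∫ t, h (Complex.exp (t * Complex.I) • y) ∂T := by
    filter_upwards [hae, hprod'.prod_right_ae] with y hy hyi
    have e : ∀ t : ℝ, h (Complex.exp (t * Complex.I) • y) =
        (u (z + Complex.exp (t * Complex.I) • y)).toReal * χ (z + y) := fun t => by
      rw [hh]; simp only; rw [hχ]
    simp only [e] at hyi ⊢
    rcases eq_or_ne (χ (z + y)) 0 with h0 | h0
    · simp [h0]
    · have hball : z + y ∈ Metric.ball z r := by
        by_contra hnot
        exact h0 (hsupp _ hnot)
      -- Balls about `z` are balanced, so they contain the whole disc through each of their points.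
      have hdisc : ∀ ζ : ℂ, ‖ζ‖ ≤ 1 → z + ζ • y ∈ Metric.ball z r := by
        intro ζ hζ
        rw [mem_ball_iff_norm, add_sub_cancel_left] at hball ⊢
        rw [norm_smul]
        exact (mul_le_of_le_one_left (norm_nonneg _) hζ).trans_lt hball
      have hcirc : ∀ t : ℝ, z + Complex.exp (t * Complex.I) • y ∈ Metric.ball z r := fun t =>
        hdisc _ (Complex.norm_exp_ofReal_mul_I t).le
      have hint : Integrable (fun t : ℝ => (u (z + Complex.exp (t * Complex.I) • y)).toReal) T := by
        have := hyi.mul_const (χ (z + y))⁻¹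
        simpa only [mul_assoc, mul_inv_cancel₀ h0, mul_one] using this
      have hmean := hu.2.2 z y hdisc
      rw [hc, ← EReal.coe_mul] at hmean
      have := circle_mean_le (by
        filter_upwards [hy] with t ht
        exact ⟨ht (hcirc t), hu.2.1 _ (hcirc t)⟩) hint hmean
      rw [integral_mul_const]
      exact mul_le_mul_of_nonneg_right this (hχ0 _)
  have hfin := integral_mono_ae ((hχi.comp_add_left z).const_mul (2 * Real.pi * c))
    hprod'.integral_prod_left hpt
  rw [integral_const_mul, integral_add_left_eq_self χ z] at hfin
  rw [hval] at hfin
  have hpi : 0 < 2 * Real.pi := by positivity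
  rw [mul_assoc] at hfin
  exact le_of_mul_le_mul_left hfin hpi

/-! ### From distributional to viscosity inequalities -/

section Viscosity

variable {n : ℕ} (v : Module.Basis (Fin n) ℂ (Fin n → ℂ))

/-- Scaling by `√a` in real dimension `2n` contributes `a⁻ⁿ`, so `aⁿ` is the normalization that
fixes the total mass. -/
lemma integral_radialKernel (z : Fin n → ℂ) {a : ℝ} (ha : 0 < a) (F : ℝ → ℝ) :
    a ^ n * ∫ y, radialKernel v z a F y = ∫ y, F (basisNormSq v y) := by
  have h1 : ∫ y, radialKernel v z a F y = ∫ y, F (a * basisNormSq v y) :=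
    integral_sub_right_eq_self (fun y => F (a * basisNormSq v y)) z
  have h2 : ∀ y, F (a * basisNormSq v y) = F (basisNormSq v (Real.sqrt a • y)) := fun y => by
    rw [basisNormSq_real_smul, Real.sq_sqrt ha.le]
  have h3 := Measure.integral_comp_smul (volume : Measure (Fin n → ℂ))
    (fun y => F (basisNormSq v y)) (Real.sqrt a)
  have hdim : Module.finrank ℝ (Fin n → ℂ) = 2 * n := by
    rw [Module.finrank_pi_fintype]
    simp [Complex.finrank_real_complex, mul_comm]
  rw [h1]
  simp_rw [h2]
  rw [h3, hdim, pow_mul, Real.sq_sqrt ha.le, smul_eq_mul, abs_of_pos (by positivity),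
    ← mul_assoc, mul_inv_cancel₀ (by positivity), one_mul]

lemma exists_radialKernel_eq_zero (z : Fin n → ℂ) : ∃ M > 0, ∀ R > 0, ∀ a, M / R ^ 2 ≤ a →
    ∀ y ∉ Metric.closedBall z R, ∀ F : ℝ → ℝ, (∀ s, 1 ≤ s → F s = 0) →
      radialKernel v z a F y = 0 := by
  obtain ⟨M, hM, h⟩ := exists_norm_sq_le_basisNormSq v
  refine ⟨M, hM, fun R hR a ha y hy F hF => hF _ ?_⟩
  rw [mem_closedBall_iff_norm, not_le] at hy
  have h1 : R ^ 2 ≤ M * basisNormSq v (y - z) :=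
    (pow_le_pow_left₀ hR.le hy.le 2).trans (h _)
  calc (1 : ℝ) = M / R ^ 2 * (R ^ 2 / M) := by field_simp
    _ ≤ a * basisNormSq v (y - z) := by
        refine mul_le_mul ha ?_ (by positivity) (le_trans (by positivity) ha)
        rw [div_le_iff₀ hM]
        linarith

lemma continuous_radialKernel (z : Fin n → ℂ) (a : ℝ) {F : ℝ → ℝ} (hF : Continuous F) :
    Continuous (radialKernel v z a F) :=
  hF.comp (continuous_const.mul ((contDiff_basisNormSq v (m := 0)).continuous.comp
    (continuous_id.sub continuous_const)))

lemma exists_bound_of_eq_zero {F : ℝ → ℝ} (hF : Continuous F) (h0 : ∀ s, 1 ≤ s → F s = 0) :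
    ∃ K, 0 ≤ K ∧ ∀ s, 0 ≤ s → |F s| ≤ K := by
  obtain ⟨K, hK⟩ := (isCompact_Icc (a := (0 : ℝ)) (b := 1)).exists_bound_of_continuousOn
    hF.continuousOn
  refine ⟨max K 0, le_max_right _ _, fun s hs => ?_⟩
  rcases le_or_gt 1 s with h | h
  · rw [h0 s h, abs_zero]; exact le_max_right _ _
  · exact (hK s ⟨hs, h.le⟩).trans (le_max_left _ _)

lemma hasDerivAt_integral_radialKernel {z : Fin n → ℂ} {R a₀ : ℝ}
    (hz : ∀ a, a₀ ≤ a → ∀ y ∉ Metric.closedBall z R, ∀ F : ℝ → ℝ, (∀ s, 1 ≤ s → F s = 0) →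
      radialKernel v z a F y = 0) (ha₀ : 0 ≤ a₀)
    {w : (Fin n → ℂ) → ℝ} (hw : IntegrableOn w (Metric.closedBall z R))
    {F F' : ℝ → ℝ} (hF : ∀ s, HasDerivAt F (F' s) s) (hF' : Continuous F')
    (h0 : ∀ s, 1 ≤ s → F s = 0) (h0' : ∀ s, 1 ≤ s → F' s = 0) {a : ℝ} (ha : a₀ < a) :
    HasDerivAt (fun a => ∫ y, w y * radialKernel v z a F y)
      (∫ y, w y * (radialKernel v z a F' y * basisNormSq v (y - z))) a := by
  have hFc : Continuous F := continuous_iff_continuousAt.2 fun s => (hF s).continuousAt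
  have hKc : IsCompact (Metric.closedBall z R) := isCompact_closedBall z R
  have hNc : Continuous fun y => basisNormSq v (y - z) :=
    (contDiff_basisNormSq v (m := 0)).continuous.comp (continuous_id.sub continuous_const)
  obtain ⟨K, hK0, hK⟩ := exists_bound_of_eq_zero hF' h0'
  obtain ⟨N, hN⟩ := hKc.exists_bound_of_continuousOn hNc.continuousOn
  have hi : ∀ b, a₀ ≤ b → ∀ {G : ℝ → ℝ}, Continuous G → (∀ s, 1 ≤ s → G s = 0) →
      Integrable (fun y => w y * radialKernel v z b G y) := fun b hb G hG hG0 =>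
    integrable_mul_of_integrableOn hKc hw (continuous_radialKernel v z b hG).continuousOn
      fun y hy => hz b hb y hy G hG0
  have hnhds : Ioi a₀ ∈ 𝓝 a := Ioi_mem_nhds ha
  refine (hasDerivAt_integral_of_dominated_loc_of_deriv_le (μ := volume) (s := Ioi a₀)
    (F := fun a y => w y * radialKernel v z a F y)
    (F' := fun a y => w y * (radialKernel v z a F' y * basisNormSq v (y - z)))
    (bound := fun y => (Metric.closedBall z R).indicator (fun y => |w y| * (K * N)) y) hnhds
    ?_ (hi a ha.le hFc h0) ?_ ?_ ?_ ?_).2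
  · filter_upwards [hnhds] with b hb
    exact (hi b (le_of_lt hb) hFc h0).aestronglyMeasurable
  · have : Integrable (fun y => w y * (radialKernel v z a F' y * basisNormSq v (y - z))) :=
      integrable_mul_of_integrableOn hKc hw
        ((continuous_radialKernel v z a hF').mul hNc).continuousOn
        fun y hy => by rw [hz a ha.le y hy F' h0', zero_mul]
    exact this.aestronglyMeasurable
  · refine Eventually.of_forall fun y b hb => ?_
    by_cases hy : y ∈ Metric.closedBall z R
    · rw [indicator_of_mem hy, norm_mul, norm_mul, Real.norm_eq_abs (w y)]
      have h1 : ‖radialKernel v z b F' y‖ ≤ K :=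
        hK _ (mul_nonneg (ha₀.trans (le_of_lt hb)) (basisNormSq_nonneg v _))
      have h2 := hN y hy
      gcongr
    · rw [indicator_of_notMem hy, hz b (le_of_lt hb) y hy F' h0']
      simp
  · exact (integrable_indicator_iff hKc.measurableSet).2 (hw.abs.mul_const _)
  · refine Eventually.of_forall fun y b _ => ?_
    have h1 : HasDerivAt (fun b : ℝ => b * basisNormSq v (y - z)) (basisNormSq v (y - z)) b := by
      simpa using (hasDerivAt_id b).mul_const (basisNormSq v (y - z))
    exact ((hF _).comp b h1).const_mul (w y)

/-- The radial average of `w`, which is decreasing in `a` if `w` is strictly subharmonic. -/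
def radialAverage (z : Fin n → ℂ) (w : (Fin n → ℂ) → ℝ) (a : ℝ) : ℝ :=
  a ^ n * ∫ y, w y * radialKernel v z a (fun s => -deriv radialCutoff s) y

/-- By the formula for the Levi forms of the kernel, the derivative `d` satisfies `a² d = -aⁿ ∫ w ∑
levi`. The profile `-ρ'` in the average is chosen so that `s ρ'' + n ρ'` appears upon
differentiating in `a`. -/
lemma exists_hasDerivAt_radialAverage_neg {z : Fin n → ℂ} {R a₀ : ℝ}
    (hz : ∀ a, a₀ ≤ a → ∀ y ∉ Metric.closedBall z R, ∀ F : ℝ → ℝ, (∀ s, 1 ≤ s → F s = 0) →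
      radialKernel v z a F y = 0) (ha₀ : 0 ≤ a₀)
    {w : (Fin n → ℂ) → ℝ} (hw : IntegrableOn w (Metric.closedBall z R)) {a : ℝ} (ha : a₀ < a)
    (hpos : 0 < ∫ y, w y * ∑ i, levi (radialKernel v z a radialCutoff) (v i) y) :
    ∃ d < 0, HasDerivAt (radialAverage v z w) d a := by
  have ha0 : 0 < a := ha₀.trans_lt ha
  have h1 := hasDerivAt_integral_radialKernel v hz ha₀ hw
    (F := fun s => -deriv radialCutoff s) (F' := fun s => -deriv (deriv radialCutoff) s)
    (fun s => (hasDerivAt_deriv_radialCutoff s).neg) continuous_deriv_deriv_radialCutoff.neg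
    (fun s hs => by rw [deriv_radialCutoff_eq_zero hs, neg_zero])
    (fun s hs => by rw [deriv_deriv_radialCutoff_eq_zero hs, neg_zero]) ha
  have h2 := (hasDerivAt_pow n a).mul h1
  refine ⟨_, ?_, h2⟩
  have hKc : IsCompact (Metric.closedBall z R) := isCompact_closedBall z R
  have hNc : Continuous fun y => basisNormSq v (y - z) :=
    (contDiff_basisNormSq v (m := 0)).continuous.comp (continuous_id.sub continuous_const)
  have c1 : Continuous fun s => -deriv radialCutoff s :=
    (contDiff_deriv_radialCutoff (m := 0)).continuous.neg
  have c2 : Continuous fun s => -deriv (deriv radialCutoff) s :=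
    continuous_deriv_deriv_radialCutoff.neg
  have i1 : Integrable (fun y => w y * radialKernel v z a (fun s => -deriv radialCutoff s) y) :=
    integrable_mul_of_integrableOn hKc hw (continuous_radialKernel v z a c1).continuousOn
      fun y hy => hz a ha.le y hy _ fun s hs => by rw [deriv_radialCutoff_eq_zero hs, neg_zero]
  have i2 : Integrable (fun y => w y * (radialKernel v z a
      (fun s => -deriv (deriv radialCutoff) s) y * basisNormSq v (y - z))) :=
    integrable_mul_of_integrableOn hKc hw
      ((continuous_radialKernel v z a c2).mul hNc).continuousOn
      fun y hy => by
        rw [hz a ha.le y hy _ fun s hs => by rw [deriv_deriv_radialCutoff_eq_zero hs, neg_zero],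
          zero_mul]
  have e : ∫ y, w y * ∑ i, levi (radialKernel v z a radialCutoff) (v i) y =
      -(a * (n * (∫ y, w y * radialKernel v z a (fun s => -deriv radialCutoff s) y) +
        a * ∫ y, w y * (radialKernel v z a (fun s => -deriv (deriv radialCutoff) s) y *
          basisNormSq v (y - z)))) := by
    rw [← integral_const_mul, ← integral_const_mul,
      ← integral_add (i1.const_mul _) (i2.const_mul _), ← integral_const_mul, ← integral_neg]
    refine integral_congr_ae (Eventually.of_forall fun y => ?_)
    simp only
    rw [sum_levi_radialKernel]
    simp only [radialKernel]
    ring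
  rw [e] at hpos
  have hn : (n : ℝ) * a ^ (n - 1) * a = n * a ^ n := by
    rcases Nat.eq_zero_or_pos n with h | h
    · simp [h]
    · rw [mul_assoc, ← pow_succ, Nat.sub_add_cancel h]
  set I1 := ∫ y, w y * radialKernel v z a (fun s => -deriv radialCutoff s) y
  set I2 := ∫ y, w y * (radialKernel v z a (fun s => -deriv (deriv radialCutoff) s) y *
          basisNormSq v (y - z))
  have h3 : (n * a ^ (n - 1) * I1 + a ^ n * I2) * a = a ^ n * (n * I1 + a * I2) := by
    calc _ = (n * a ^ (n - 1) * a) * I1 + a ^ n * (a * I2) := by ring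
      _ = _ := by rw [hn]; ring
  have h4 : n * I1 + a * I2 < 0 := by
    by_contra hcon
    push Not at hcon
    have := mul_nonneg ha0.le hcon
    linarith
  have h5 : a ^ n * (n * I1 + a * I2) < 0 := mul_neg_of_pos_of_neg (by positivity) h4
  rw [← h3] at h5
  by_contra hcon
  push Not at hcon
  exact absurd (mul_nonneg hcon ha0.le) (not_le.2 h5)

end Viscosity

section Viscosity

variable {n : ℕ} (v : Module.Basis (Fin n) ℂ (Fin n → ℂ))

/-- As `a → ∞` the kernel concentrates at `z`, where `φ - q` vanishes. The function `φ + C|y|²`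
satisfies the mean value inequality at `z`, and `q + C|y|²` is continuous there, so their difference
loses at most `ε` times the mass. -/
lemma eventually_le_radialAverage {z : Fin n → ℂ} {φ : (Fin n → ℂ) → EReal}
    {q : (Fin n → ℂ) → ℝ} {r R C : ℝ} (hR : 0 < R) (hRr : R < r)
    (hpsh : IsPSH (Metric.ball z r) fun y => φ y + ((C * ∑ i, ‖y i‖ ^ 2 : ℝ) : EReal))
    (hbot : ∀ᵐ y, y ∈ Metric.ball z r → φ y ≠ ⊥) (hφq : φ z = (q z : EReal))
    (hint : IntegrableOn (fun y => (φ y).toReal) (Metric.closedBall z R))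
    (hq : ContinuousOn q (Metric.closedBall z R)) {ε : ℝ} (hε : 0 < ε) :
    ∀ᶠ a in atTop, -ε * ∫ y, -deriv radialCutoff (basisNormSq v y) ≤
      radialAverage v z (fun y => (φ y).toReal - q y) a := by
  set s : (Fin n → ℂ) → ℝ := fun y => q y + C * ∑ i, ‖y i‖ ^ 2 with hs
  have hsc : ContinuousOn s (Metric.closedBall z R) := by
    refine hq.add (Continuous.continuousOn ?_)
    fun_prop
  have hsz : ContinuousAt s z := hsc.continuousAt (Metric.closedBall_mem_nhds z hR)
  obtain ⟨R₁, hR₁, hR₁s⟩ := Metric.nhds_basis_closedBall.mem_iff.1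
    ((Metric.tendsto_nhds.1 hsz ε hε).and (Metric.closedBall_mem_nhds z hR))
  obtain ⟨M, hM, hMz⟩ := exists_radialKernel_eq_zero v z
  filter_upwards [eventually_ge_atTop (M / R₁ ^ 2), eventually_gt_atTop 0] with a ha ha0
  set f : ℝ → ℝ := fun s => -deriv radialCutoff s with hf
  have hf0 : ∀ s, 1 ≤ s → f s = 0 := fun s hs => by
    rw [hf]; simp only; rw [deriv_radialCutoff_eq_zero hs, neg_zero]
  have hfc : Continuous f := (contDiff_deriv_radialCutoff (m := 0)).continuous.neg
  set χ := radialKernel v z a f with hχ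
  have hχc : Continuous χ := continuous_radialKernel v z a hfc
  have hχ0 : ∀ y, 0 ≤ χ y := fun y => neg_nonneg.2 (deriv_radialCutoff_nonpos _)
  have hχz : ∀ y ∉ Metric.closedBall z R₁, χ y = 0 := fun y hy => hMz R₁ hR₁ a ha y hy f hf0
  have hKc : IsCompact (Metric.closedBall z R₁) := isCompact_closedBall z R₁
  have hsub : Metric.closedBall z R₁ ⊆ Metric.closedBall z R := fun y hy => (hR₁s hy).2
  have hsubr : Metric.closedBall z R₁ ⊆ Metric.ball z r :=
    hsub.trans (Metric.closedBall_subset_ball hRr)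
  have iφ := integrable_mul_of_integrableOn hKc (hint.mono_set hsub) hχc.continuousOn hχz
  have iq := integrable_mul_of_integrableOn hKc ((hq.mono hsub).integrableOn_compact hKc)
    hχc.continuousOn hχz
  have is := integrable_mul_of_integrableOn hKc ((hsc.mono hsub).integrableOn_compact hKc)
    hχc.continuousOn hχz
  have iχ : Integrable χ := by
    have := integrable_mul_of_integrableOn hKc (f := fun _ => (1 : ℝ))
      (continuousOn_const.integrableOn_compact hKc) hχc.continuousOn hχz
    simpa using this
  have hne : ∀ᵐ y, y ∈ Metric.ball z r →
      φ y + ((C * ∑ i, ‖y i‖ ^ 2 : ℝ) : EReal) ≠ ⊥ ∧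
      (φ y + ((C * ∑ i, ‖y i‖ ^ 2 : ℝ) : EReal)).toReal = (φ y).toReal + C * ∑ i, ‖y i‖ ^ 2 := by
    filter_upwards [hbot] with y hy hyb
    have h1 := hy hyb
    have h2 : φ y ≠ ⊤ := by
      intro h
      refine hpsh.2.1 y hyb ?_
      simp only [h, EReal.top_add_coe]
    refine ⟨?_, ?_⟩
    · rw [Ne, EReal.add_eq_bot_iff, not_or]
      exact ⟨h1, EReal.coe_ne_bot _⟩
    · rw [EReal.toReal_add h2 h1 (EReal.coe_ne_top _) (EReal.coe_ne_bot _), EReal.toReal_coe]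
  have heq : (fun y => (φ y + ((C * ∑ i, ‖y i‖ ^ 2 : ℝ) : EReal)).toReal * χ y) =ᵐ[volume]
      fun y => ((φ y).toReal - q y) * χ y + s y * χ y := by
    filter_upwards [hne] with y hy
    by_cases hyb : y ∈ Metric.closedBall z R₁
    · rw [(hy (hsubr hyb)).2, hs]
      ring
    · rw [hχz y hyb]
      ring
  have iw : Integrable (fun y => ((φ y).toReal - q y) * χ y) := by
    simp only [sub_mul]
    exact iφ.sub iq
  have hmean := hpsh.mul_integral_le (χ := χ) (c := s z)
    (by filter_upwards [hne] with y hy hyb using (hy hyb).1)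
    (by rw [hφq, hs, EReal.coe_add]) hχ0
    (by
      intro t y
      simp only [hχ, radialKernel, add_sub_cancel_left]
      rw [basisNormSq_smul v _ (Complex.norm_exp_ofReal_mul_I t)])
    (fun y hy => hχz y fun h => hy (hsubr h)) iχ ((iw.add is).congr heq.symm)
  rw [integral_congr_ae heq, integral_add iw is] at hmean
  have hs_le : ∫ y, s y * χ y ≤ (s z + ε) * ∫ y, χ y := by
    rw [← integral_const_mul]
    refine integral_mono is (iχ.const_mul _) fun y => ?_
    by_cases hyb : y ∈ Metric.closedBall z R₁
    · refine mul_le_mul_of_nonneg_right ?_ (hχ0 y)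
      have := (hR₁s hyb).1
      rw [Real.dist_eq] at this
      linarith [(abs_lt.1 this).2]
    · simp [hχz y hyb]
  have hfin : -ε * ∫ y, χ y ≤ ∫ y, ((φ y).toReal - q y) * χ y := by linarith
  have hscale := integral_radialKernel v z ha0 f
  rw [radialAverage, ← hscale]
  calc -ε * (a ^ n * ∫ y, χ y) = a ^ n * (-ε * ∫ y, χ y) := by ring
    _ ≤ _ := mul_le_mul_of_nonneg_left hfin (by positivity)

/-- A strict distributional lower bound for the Levi form excludes upper tests with a smaller
Levi form. -/
lemma le_sum_levi_of_isUpperTest {U V : Set (Fin n → ℂ)} {φ : (Fin n → ℂ) → EReal}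
    {z : Fin n → ℂ} (hz : z ∈ U) (hU : IsOpen U) (hφ : IsQuasiPSH U φ)
    (hbot : ∀ᵐ y ∂volume.restrict U, φ y ≠ ⊥)
    (hloc : LocallyIntegrableOn (fun y => (φ y).toReal) U)
    {q : (Fin n → ℂ) → ℝ} (hq : IsUpperTest φ q z) {c : ℝ} (hV : V ∈ 𝓝 z)
    (hineq : ∀ η, IsTestFunction U η → tsupport η ⊆ V → (∀ y, 0 ≤ η y) →
      c * ∫ y, η y ≤ ∑ i, ∫ y in U, (φ y).toReal * levi η (v i) y) :
    c ≤ ∑ i, levi q (v i) z := by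
  by_contra! hc
  obtain ⟨r, hr, C, hrU, hpsh⟩ := hφ z hz
  have hbot' : ∀ᵐ y, y ∈ U → φ y ≠ ⊥ := (ae_restrict_iff' hU.measurableSet).1 hbot
  obtain ⟨W, hWsub, hWo, hzW⟩ := mem_nhds_iff.1 (hq.1.eventually (by simp))
  have hqW : ContDiffOn ℝ 2 q W := fun y hy =>
    (show ContDiffAt ℝ 2 q y from hWsub hy).contDiffWithinAt
  -- The midpoint stays above the Levi sum of `q` on a whole neighbourhood of `z`, by continuity,
  -- and still below `c`.
  set c₁ := (∑ i, levi q (v i) z + c) / 2 with hc₁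
  have hlevc : ContinuousOn (fun y => ∑ i, levi q (v i) y) W :=
    continuousOn_finsetSum _ fun i _ => continuousOn_levi hWo hqW (v i)
  have hlev : ∀ᶠ y in 𝓝 z, ∑ i, levi q (v i) y < c₁ :=
    (hlevc.continuousAt (hWo.mem_nhds hzW)).eventually (gt_mem_nhds (by rw [hc₁]; linarith))
  obtain ⟨R, hR, hRsub⟩ := Metric.nhds_basis_closedBall.mem_iff.1
    (((hlev.and hq.2.1).and (hWo.mem_nhds hzW)).and ((Filter.inter_mem hV (hU.mem_nhds hz))))
  obtain ⟨R', hR'0, hR'R, hR'r⟩ : ∃ R' > 0, R' ≤ R ∧ R' < r :=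
    ⟨min R (r / 2), by positivity, min_le_left _ _, (min_le_right _ _).trans_lt (by linarith)⟩
  have hB : ∀ y ∈ Metric.closedBall z R', (∑ i, levi q (v i) y < c₁ ∧ φ y ≤ (q y : EReal)) ∧
      y ∈ W ∧ y ∈ V ∧ y ∈ U := fun y hy => by
    have := hRsub (Metric.closedBall_subset_closedBall hR'R hy)
    exact ⟨this.1.1, this.1.2, this.2.1, this.2.2⟩
  have hKc : IsCompact (Metric.closedBall z R') := isCompact_closedBall z R'
  have hKU : Metric.closedBall z R' ⊆ U := fun y hy => (hB y hy).2.2.2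
  have hKW : Metric.closedBall z R' ⊆ W := fun y hy => (hB y hy).2.1
  have hφi : IntegrableOn (fun y => (φ y).toReal) (Metric.closedBall z R') :=
    hloc.integrableOn_compact_subset hKU hKc
  have hqi : IntegrableOn q (Metric.closedBall z R') :=
    (hqW.continuousOn.mono hKW).integrableOn_compact hKc
  obtain ⟨M, hM, hMz⟩ := exists_radialKernel_eq_zero v z
  set a₀ := M / R' ^ 2 with ha₀
  have ha₀0 : 0 < a₀ := by positivity
  have hker := hMz R' hR'0
  set w : (Fin n → ℂ) → ℝ := fun y => (φ y).toReal - q y with hw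
  have hwi : IntegrableOn w (Metric.closedBall z R') := hφi.sub hqi
  -- Distributional strict subharmonicity of `φ - q`, tested against the radial kernels: the
  -- integral is at least `(c - c₁) ∫ η`, with `∫ η > 0`.
  have hpos : ∀ a, a₀ < a →
      0 < ∫ y, w y * ∑ i, levi (radialKernel v z a radialCutoff) (v i) y := by
    intro a ha
    have ha0 : 0 < a := ha₀0.trans ha
    set η := radialKernel v z a radialCutoff with hη
    have hsmooth : ContDiff ℝ (⊤ : ℕ∞) η := contDiff_radialCutoff.comp
      (contDiff_const.mul ((contDiff_basisNormSq v).comp (contDiff_id.sub contDiff_const)))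
    have hηz : ∀ y ∉ Metric.closedBall z R', η y = 0 := fun y hy =>
      hker a ha.le y hy _ fun _ => radialCutoff_eq_zero
    have hsuppη : tsupport η ⊆ Metric.closedBall z R' :=
      closure_minimal (fun y hy => by_contra fun h => hy (hηz y h)) Metric.isClosed_closedBall
    have hcs : HasCompactSupport η :=
      HasCompactSupport.of_support_subset_isCompact hKc ((subset_tsupport _).trans hsuppη)
    have hηU : IsTestFunction U η := ⟨hsmooth, hcs, hsuppη.trans hKU⟩
    have hηW : IsTestFunction W η := ⟨hsmooth, hcs, hsuppη.trans hKW⟩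
    have hη0 : ∀ y, 0 ≤ η y := fun y => radialCutoff_nonneg _
    have hlz : ∀ i, ∀ y ∉ Metric.closedBall z R', levi η (v i) y = 0 := fun i y hy =>
      hηU.levi_eq_zero (v i) fun h => hy (hsuppη h)
    have hηi : Integrable η := hsmooth.continuous.integrable_of_hasCompactSupport hcs
    have iφ : ∀ i, Integrable (fun y => (φ y).toReal * levi η (v i) y) := fun i =>
      integrable_mul_of_integrableOn hKc hφi (hηU.continuous_levi (v i)).continuousOn (hlz i)
    have iq : ∀ i, Integrable (fun y => q y * levi η (v i) y) := fun i =>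
      integrable_mul_of_integrableOn hKc hqi (hηU.continuous_levi (v i)).continuousOn (hlz i)
    have h1 := hineq η hηU (hsuppη.trans fun y hy => (hB y hy).2.2.1) hη0
    have e1 : ∀ i, ∫ y in U, (φ y).toReal * levi η (v i) y = ∫ y, (φ y).toReal * levi η (v i) y :=
      fun i => setIntegral_eq_integral_of_forall_compl_eq_zero fun y hy => by
        rw [hlz i y fun h => hy (hKU h), mul_zero]
    have e2 : ∀ i, ∫ y, q y * levi η (v i) y = ∫ y in W, levi q (v i) y * η y := fun i => by
      rw [← integral_mul_levi hWo hqW hηW (v i)]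
      exact (setIntegral_eq_integral_of_forall_compl_eq_zero fun y hy => by
        rw [hlz i y fun h => hy (hKW h), mul_zero]).symm
    have il : ∀ i, IntegrableOn (fun y => levi q (v i) y * η y) W := fun i =>
      (integrable_mul_of_continuousOn hWo (continuousOn_levi hWo hqW (v i)) hsmooth.continuous hcs
        hηW.2.2).integrableOn
    have h2 : ∑ i, ∫ y, q y * levi η (v i) y ≤ c₁ * ∫ y, η y := by
      have e0 : ∫ y, η y = ∫ y in W, η y :=
        (setIntegral_eq_integral_of_forall_compl_eq_zero fun y hy => hηz y fun h => hy (hKW h)).symm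
      simp_rw [e2]
      rw [← integral_finsetSum _ fun i _ => il i, e0, ← integral_const_mul]
      refine setIntegral_mono_on (integrable_finsetSum _ fun i _ => il i)
        (hηi.integrableOn.const_mul _) hWo.measurableSet fun y _ => ?_
      rw [← Finset.sum_mul]
      by_cases hyb : y ∈ Metric.closedBall z R'
      · exact mul_le_mul_of_nonneg_right (hB y hyb).1.1.le (hη0 y)
      · rw [hηz y hyb, mul_zero, mul_zero]
    have h3 : 0 < ∫ y, η y := by
      rw [integral_pos_iff_support_of_nonneg hη0 hηi]
      have hzη : η z ≠ 0 := by
        have : η z = radialCutoff 0 := by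
          simp [hη, radialKernel, basisNormSq]
        rw [this]
        exact (radialCutoff_pos one_pos).ne'
      exact (hsmooth.continuous.isOpen_support).measure_pos volume ⟨z, hzη⟩
    have e3 : ∫ y, w y * ∑ i, levi η (v i) y = (∑ i, ∫ y, (φ y).toReal * levi η (v i) y) -
        ∑ i, ∫ y, q y * levi η (v i) y := by
      rw [← integral_finsetSum _ fun i _ => iφ i, ← integral_finsetSum _ fun i _ => iq i,
        ← integral_sub (integrable_finsetSum _ fun i _ => iφ i)
          (integrable_finsetSum _ fun i _ => iq i)]
      refine integral_congr_ae (Eventually.of_forall fun y => ?_)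
      simp only [hw, sub_mul, Finset.mul_sum, Finset.sum_sub_distrib]
    simp_rw [e1] at h1
    rw [e3]
    have h4 : c₁ * ∫ y, η y < c * ∫ y, η y :=
      mul_lt_mul_of_pos_right (by rw [hc₁]; linarith) h3
    linarith
  have hderiv : ∀ a ∈ Ioi a₀, ∃ d < 0, HasDerivAt (radialAverage v z w) d a := fun a ha =>
    exists_hasDerivAt_radialAverage_neg v hker ha₀0.le hwi ha (hpos a ha)
  have hanti : StrictAntiOn (radialAverage v z w) (Ioi a₀) := by
    refine strictAntiOn_of_deriv_neg (convex_Ioi a₀) (fun a ha => ?_) (fun a ha => ?_)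
    · obtain ⟨d, -, hd⟩ := hderiv a ha
      exact hd.continuousAt.continuousWithinAt
    · rw [interior_Ioi] at ha
      obtain ⟨d, hd0, hd⟩ := hderiv a ha
      rw [hd.deriv]
      exact hd0
  -- `toReal` sends `⊥` to `0`, so `φ ≤ q` passes to real values only where `φ` is finite, which is
  -- almost everywhere.
  have hle0 : radialAverage v z w (a₀ + 1) ≤ 0 := by
    refine mul_nonpos_of_nonneg_of_nonpos (by positivity) (integral_nonpos_of_ae ?_)
    filter_upwards [hbot'] with y hy
    by_cases hyb : y ∈ Metric.closedBall z R'
    · refine mul_nonpos_of_nonpos_of_nonneg ?_ (neg_nonneg.2 (deriv_radialCutoff_nonpos _))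
      have h1 := (hB y hyb).1.2
      have h2 := hy (hKU hyb)
      have := EReal.toReal_le_toReal h1 h2 (EReal.coe_ne_top _)
      rw [EReal.toReal_coe] at this
      rw [hw]
      simp only
      linarith
    · rw [hker (a₀ + 1) (by linarith) y hyb _ fun s hs => by
        rw [deriv_radialCutoff_eq_zero hs, neg_zero], mul_zero]
      rfl
  have hlt : radialAverage v z w (a₀ + 2) < 0 :=
    (hanti (show a₀ + 1 ∈ Ioi a₀ by simp) (show a₀ + 2 ∈ Ioi a₀ by simp)
      (by linarith)).trans_le hle0
  set c_f := ∫ y, -deriv radialCutoff (basisNormSq v y) with hcf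
  have hcf0 : 0 ≤ c_f := integral_nonneg fun y => neg_nonneg.2 (deriv_radialCutoff_nonpos _)
  -- Chosen so that `ε` times the mass `c_f` does not exceed `-radialAverage v z w (a₀ + 2)`. The
  -- averages decrease below their already negative value at `a₀ + 2`, which contradicts the lower
  -- bound as `a → ∞`.
  have hε : 0 < -radialAverage v z w (a₀ + 2) / (2 * (c_f + 1)) :=
    div_pos (by linarith) (by positivity)
  have hev := eventually_le_radialAverage v (q := q) hR'0 hR'r hpsh
    (by filter_upwards [hbot'] with y hy hyb using hy (hrU hyb)) hq.2.2 hφi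
    (hqW.continuousOn.mono hKW) hε
  obtain ⟨a, ha1, ha2⟩ := (hev.and (eventually_gt_atTop (a₀ + 2))).exists
  have h1 : radialAverage v z w a < radialAverage v z w (a₀ + 2) :=
    hanti (show a₀ + 2 ∈ Ioi a₀ by simp) (show a ∈ Ioi a₀ from by
      rw [mem_Ioi]; linarith) ha2
  rw [← hcf] at ha1
  have h2 : -radialAverage v z w (a₀ + 2) / (2 * (c_f + 1)) * c_f ≤
      -radialAverage v z w (a₀ + 2) := by
    rw [div_mul_eq_mul_div, div_le_iff₀ (by positivity)]
    nlinarith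
  rw [neg_mul] at ha1
  linarith

end Viscosity

/-! ### The phase of upper tests and the conclusion -/

section Main

variable {n : ℕ} {X : Type*} [TopologicalSpace X] [ChartedSpace (Fin n → ℂ) X]

lemma IsLocalPotential.currentForm_eq {α : ClosedRealForm11 n X} {ψ : X → ℝ}
    {e : OpenPartialHomeomorph X (Fin n → ℂ)} (he : e ∈ holCharts n X) {U : Set (Fin n → ℂ)}
    (hUe : U ⊆ e.target) {φ : (Fin n → ℂ) → EReal} (hφ : IsLocalPotential α ψ e U φ)
    {η : (Fin n → ℂ) → ℝ} (hη : IsTestFunction U η)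
    (hψ : IntegrableOn (fun z => ψ (e.symm z)) (tsupport η)) (ξ : Fin n → ℂ) :
    currentForm α ψ e ξ η = ∫ z in U, (φ z).toReal * levi η ξ z := by
  have hηe : IsTestFunction e.target η := ⟨hη.1, hη.2.1, hη.2.2.trans hUe⟩
  have hφi : IntegrableOn (fun z => (φ z).toReal) (tsupport η) :=
    hφ.locallyIntegrable.integrableOn_compact_subset hη.2.2 hη.2.1
  have hH : ∀ j k, Integrable (fun z => ((φ z).toReal : ℂ) * complexHessian η z j k) :=
    fun j k => integrable_mul_of_integrableOn hη.2.1 hφi.ofReal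
      (continuous_complexHessian_apply hη.contDiff_two j k).continuousOn
      (fun z hz => complexHessian_apply_eq_zero hη.contDiff_two j k hz)
  rw [← re_sum_currentCoeff α he hηe hψ ξ]
  simp_rw [← hφ.ddbar_eq η hη]
  rw [re_sum_integral (fun j k => (hH j k).integrableOn) ξ]
  refine integral_congr_ae (Eventually.of_forall fun z => ?_)
  exact re_sum_ofReal_mul_complexHessian hη.contDiff_two _ _ _

/-- A larger phase would give, through the separating basis, a distributional lower bound for `∑
levi φ` exceeding `∑ levi q` at `z` by `δ`, which an upper test forbids. -/
lemma LocalConvergence.phase_le {ω α : ClosedRealForm11 n X} (hω : IsKahler ω)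
    {θ₀ : ℝ} (hθ₀ : θ₀ ∈ Ioo 0 Real.pi)
    {αk : ℕ → ClosedRealForm11 n X} {ψ : ℕ → X → ℝ} {ψ_lim : X → ℝ}
    {e : OpenPartialHomeomorph X (Fin n → ℂ)} (he : e ∈ holCharts n X)
    (h : LocalConvergence ω α θ₀ αk ψ ψ_lim e) {U : Set (Fin n → ℂ)} (hU : IsOpen U)
    (hUe : U ⊆ e.target) {φ : (Fin n → ℂ) → EReal} (hφ : IsLocalPotential α ψ_lim e U φ)
    {z : Fin n → ℂ} (hz : z ∈ U) {q : (Fin n → ℂ) → ℝ} (hq : IsUpperTest φ q z) :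
    phase (ω.coeff e z) (complexHessian q z) ≤ θ₀ := by
  by_contra! hph
  obtain ⟨v, δ, hδ, V, hV, -, -, hineq⟩ := h.le_sum_currentForm hω hθ₀ he (hUe hz)
    (isHermitian_complexHessian hq.1) hph
  simp_rw [hermForm_complexHessian hq.1] at hineq
  have := le_sum_levi_of_isUpperTest v hz hU hφ.quasiPSH hφ.ae_ne_bot hφ.locallyIntegrable hq hV
    (c := ∑ i, levi q (v i) z + δ) (fun η hη hηV hη0 => by
      refine (hineq η ⟨hη.1, hη.2.1, hηV⟩ hη0).trans (le_of_eq ?_)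
      exact Finset.sum_congr rfl fun i _ => hφ.currentForm_eq he hUe hη
        (h.integrableOn_lim _ (hη.2.2.trans hUe) hη.2.1) (v i))
  linarith

lemma phase_pos {A B : Matrix (Fin n) (Fin n) ℂ} (hB : B.PosDef) (hA : A.IsHermitian)
    (hn : 0 < n) : 0 < phase B A := by
  obtain ⟨P, l, h1, h2⟩ := exists_simultaneous_diagonal hB hA
  rw [phase_eq_sum h1 h2]
  have : Nonempty (Fin n) := ⟨⟨0, hn⟩⟩
  exact Finset.sum_pos (fun i _ => (arccot_mem_Ioo _).1) Finset.univ_nonempty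

end Main

end DHYM

end

theorem mainTheorem9 {n : ℕ} {X : Type*} [TopologicalSpace X] [T2Space X] [CompactSpace X]
    [ChartedSpace (Fin n → ℂ) X] [IsManifold 𝓘(ℂ, Fin n → ℂ) (⊤ : ℕ∞) X]
    [MeasurableSpace X] [BorelSpace X]
    (ω : DHYM.ClosedRealForm11 n X) (hω : DHYM.IsKahler ω)
    (α : DHYM.ClosedRealForm11 n X)
    (θ₀ : ℝ) (hθ₀ : θ₀ ∈ Set.Ioo 0 Real.pi)
    (αk : ℕ → DHYM.ClosedRealForm11 n X) (ψ : ℕ → X → ℝ)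
    (hψ : ∀ k, ContMDiff 𝓘(ℝ, Fin n → ℂ) 𝓘(ℝ, ℝ) (⊤ : ℕ∞) (ψ k))
    (hαk : ∀ k, DHYM.IsAddDDbar (αk k) α (ψ k))
    (hphase : ∀ k x, DHYM.formPhase ω (αk k) x ∈ Set.Ioo 0 Real.pi)
    (ψ_lim : X → ℝ) (hψ_lim : Integrable ψ_lim (DHYM.kahlerVolume ω))
    (hL1 : Tendsto (fun k => eLpNorm (fun x => ψ k x - ψ_lim x) 1 (DHYM.kahlerVolume ω))
      atTop (𝓝 0))
    (hL2 : Tendsto (fun k => eLpNorm (fun x => DHYM.formQ ω (αk k) x + Real.cot θ₀) 2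
      (DHYM.kahlerVolume ω)) atTop (𝓝 0)) :
    DHYM.IsViscositySubsolution ω α ψ_lim (-Real.cot θ₀) := by
  have hloc : ∀ e ∈ DHYM.holCharts n X, DHYM.LocalConvergence ω α θ₀ αk ψ ψ_lim e := fun e he =>
    DHYM.localConvergence hω hψ hαk hphase hψ_lim hL1 hL2 he
  refine ⟨⟨_, DHYM.LocalConvergence.isPositiveAfterAdding hω hloc⟩,
    fun e he U hU hUe φ hφ z hz q hq => ?_⟩
  have hle := (hloc e he).phase_le hω hθ₀ he hU hUe hφ hz hq
  refine ⟨hle.trans_lt hθ₀.2, neg_le_neg ?_⟩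
  -- In dimension `0` the phase is an empty sum, contradicting its positivity for `αk 0`. A positive
  -- phase is needed because `cot` is monotone only on `(0, π)` and takes the default value `0` at
  -- `0`.
  have hn : 0 < n := by
    have h0 := (hphase 0 (e.symm z)).1
    rw [DHYM.formPhase_symm_apply hω _ he (hUe hz)] at h0
    rcases Nat.eq_zero_or_pos n with rfl | h
    · obtain ⟨P, l, h1, h2⟩ := DHYM.exists_simultaneous_diagonal (hω e he z (hUe hz))
        ((αk 0).hermitian e he z (hUe hz))
      rw [DHYM.phase_eq_sum h1 h2] at h0
      simp at h0
    · exact h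
  exact DHYM.cot_antitoneOn (DHYM.phase_pos (hω e he z (hUe hz))
    (DHYM.isHermitian_complexHessian hq.1) hn) hle hθ₀.2
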